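/- **Setting.** $K$ users, $M$ antennas, $N$ RF chains, pilots of length $\tau$. Given are covariance matrices $\mathbf R_k\succeq 0$ ($M\times M$), a noise variance $\sigma^2>0$, power budgets $P_k>0$, bit bounds $\check b_n,\hat b_n$, an average $\bar b$, and a normalized quantization error $\beta(\cdot)$, a $C^2$ function of the (relaxed, real) number of bits with $0<\beta<1$ on all intervals $[\check b_n,\hat b_n]$. For $\mathbf b\in\mathbb R^N$, $\mathbf U\in\mathbb C^{N\times M}$, $\mathbf V\in\mathbb C^{K\times N}$ with rows $\mathbf v_k$, and $\mathbf S\in\mathbb C^{\tau\times K}$ with columns $\mathbf s_k$, put $\mathbf Q_\alpha=\mathrm{diag}(1-\beta(b_n))$, $\mathbf Q=\mathbf Q_\alpha\,\mathrm{diag}(\beta(b_n))$, $\mathbf x_k=\mathbf v_k\mathbf Q_\alpha\mathbf U$, $\mathbf A_k=\mathbf s_k\mathbf x_k\mathbf R_k$ and $$\mathbf B_k=\sum_i \mathbf s_i\mathbf x_k\mathbf R_i\mathbf x_k^H\mathbf s_i^H+\sigma^2\mathbf x_k\mathbf x_k^H\mathbf I_\tau+(\mathbf I_\tau\otimes\mathbf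 v_k\mathbf Q)\,\mathrm{diag}\Big(\sum_i(\mathbf s_i\otimes\mathbf U)\mathbf R_i(\mathbf s_i\otimes\mathbf U)^H+\sigma^2\mathbf I_\tau\otimes\mathbf U\mathbf U^H\Big)(\mathbf I_\tau\otimes\mathbf v_k^H).$$ Problem (P1) is to maximize $f(\mathbf b,\mathbf U,\mathbf V,\mathbf S)=\sum_k\mathrm{tr}(\mathbf A_k^H\mathbf B_k^{-1}\mathbf A_k)$ (a term with $\mathbf v_k=0$ counts as $0$) subject to $\|\mathbf s_k\|^2\le P_k$, $|\mathbf U(n,m)|=1/\sqrt M$, $\check b_n\le b_n\le\hat b_n$, $\sum_n b_n\le N\bar b$. A point is stationary if it is feasible, $f$ is differentiable there, and the derivative of $f$ is nonpositive along every direction of the tangent cone of the feasible set. Let $f_0(\mathbf b,\mathbf U,\mathbf V,\mathbf S,\{\mathbf\Gamma_k\})=\sum_k\mathrm{tr}(2\Re\{\mathbf A_k^H\mathbf\Gamma_k\}-\mathbf\Gamma_k^H\mathbf B_k\mathbf\Gamma_k)$. **Algorithm.** From a feasible point, each iteration performs in this order: (1) $\mathbf\Gamma_k=\mathbf B_k^{-1}\mathbf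 A_k$; (2) $\mathbf b$ is updated by successive concave approximation of $f_0$ started at the current $\mathbf b$ (a positive number of steps, or a limit point of infinitely many), each step maximizing over the bit constraints the surrogate $g(\mathbf b')+\nabla g(\mathbf b')^T(\mathbf b-\mathbf b')-\zeta\|\mathbf b-\mathbf b'\|^2$ of $g=f_0(\cdot,\mathbf U,\mathbf V,\mathbf S,\{\mathbf\Gamma_k\})$; (3) $\mathbf U$ is updated, either to an exact maximizer of $f_0$ under the constant-modulus constraint, or by one sweep over its entries, each set to $\varphi_{nm}/(\sqrt M|\varphi_{nm}|)$, where $f_0=2\Re\{\varphi_{nm}^*\mathbf U(n,m)\}-\mu_{nm}|\mathbf U(n,m)|^2+\mathrm{const}$ in that entry (any admissible value if $\varphi_{nm}=0$); (4) $\mathbf V$ is updated by the first-order condition, the closed form $\mathbf v_k=\mathbf s_k^H\mathbf\Gamma_k\mathbf R_k\mathbf U^H\mathbf Q_\alpha\mathbf W_k^{-1}$, where $\mathbf v_k\mathbf W_k\mathbf v_k^H$ is the quadratic part of $-f_0$ in $\mathbf v_k$; (5) $\mathbf S$ is updated by $\mathbf s_k=(\mathbf E_k+\lambda_k\mathbf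 I)^{-1}\mathbf\Gamma_k\mathbf R_k\mathbf x_k^H$, where $\mathbf s_k^H\mathbf E_k\mathbf s_k$ is the quadratic part of $-f_0$ in $\mathbf s_k$ and $\lambda_k\ge0$ is the multiplier of the power constraint ($\lambda_k=0$ unless $\|\mathbf s_k\|^2=P_k$). In (4) and (5), if an inverse does not exist, any solution of the corresponding linear system is allowed. **Theorem 1.** There is $\zeta_0>0$, depending only on the problem data, such that for every $\zeta\ge\zeta_0$ every sequence of iterates $(\mathbf b^t,\mathbf U^t,\mathbf V^t,\mathbf S^t)$ of the algorithm has the following properties. 1. All iterates are feasible, $f(\mathbf b^t,\mathbf U^t,\mathbf V^t,\mathbf S^t)$ is nondecreasing in $t$ and converges; in particular, for every $\varepsilon_1>0$ the increment of $f$ falls below $\varepsilon_1$ after finitely many iterations. 2. If the iterates converge to a point with $\mathbf v_k\ne0$ for all $k$ (so that all $\mathbf B_k$ are invertible there), that point is a stationary point of (P1). 3. If every $\mathbf U$-update is exact or is a sweep whose coefficients satisfy $|\varphi_{nm}|\ge\delta$, for a $\delta>0$ independent of the iteration, then every limit point of the iterates with $\mathbf v_k\ne0$ for all $k$ is a stationary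 point of (P1). 4. Statements 2 and 3 also hold for the sequence obtained by multiplying each $\mathbf v_k^t$ by an arbitrary scalar $c_k^t\in\mathbb C$ ($f$ does not change under nonzero scalings). If $\mathbf v_k^t\neq0$ for all $k$ and $t$, such scalars can be chosen so that a limit point with all $\mathbf v_k\ne0$ exists. -/

import Mathlib

open scoped Matrix ComplexOrder

namespace PilotDesign

/-- Data of the system: `K` single-antenna users, a base station with `M` antennas and `N` RF
chains. `R k` is the covariance matrix of the channel of user `k`, `σ ^ 2` the noise variance,
`Pmax k` the power budget of user `k`, `bmin n`, `bmax n` and `bavg` the minimum, maximum and average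
numbers of quantization bits, and `β x` the normalized quantization error of an ADC with `x` bits,
as a smooth function of a relaxed (real) number of bits. -/
structure System (K M N : ℕ) where
  R : Fin K → Matrix (Fin M) (Fin M) ℂ
  σ : ℝ
  Pmax : Fin K → ℝ
  bmin : Fin N → ℝ
  bmax : Fin N → ℝ
  bavg : ℝ
  β : ℝ → ℝ
  R_posSemidef : ∀ k, (R k).PosSemidef
  σ_pos : 0 < σ
  Pmax_pos : ∀ k, 0 < Pmax k
  β_contDiff : ContDiff ℝ 2 β
  β_mem : ∀ n, ∀ x ∈ Set.Icc (bmin n) (bmax n), 0 < β x ∧ β x < 1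

/-- The optimization variables `(b, U, V, S)`: relaxed bits `b`, analog combiner `U`, digital
combiners `V k` (rows), pilot sequences `S k` of length `τ`. -/
abbrev Point (K M N τ : ℕ) : Type :=
  (Fin N → ℝ) × (Fin N → Fin M → ℂ) × (Fin K → Fin N → ℂ) × (Fin K → Fin τ → ℂ)

noncomputable section

namespace System

variable {K M N τ : ℕ} (p : System K M N)

/-- The quantization gain matrix `Q_α = diag (1 - β (b n))`. -/
def Qα (b : Fin N → ℝ) : Matrix (Fin N) (Fin N) ℂ :=
  Matrix.diagonal fun n => ((1 - p.β (b n) : ℝ) : ℂ)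

/-- `Q = Q_α Q_β`, with `Q_β = diag (β (b n))`. -/
def Q (b : Fin N → ℝ) : Matrix (Fin N) (Fin N) ℂ :=
  p.Qα b * Matrix.diagonal fun n => ((p.β (b n) : ℝ) : ℂ)

/-- The row vector `x_k = v_k Q_α U`. -/
def x (b : Fin N → ℝ) (U : Fin N → Fin M → ℂ) (V : Fin K → Fin N → ℂ) (k : Fin K) : Fin M → ℂ :=
  V k ᵥ* (p.Qα b * Matrix.of U)

/-- `A_k = s_k x_k R_k`. -/
def A (b : Fin N → ℝ) (U : Fin N → Fin M → ℂ) (V : Fin K → Fin N → ℂ) (S : Fin K → Fin τ → ℂ)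
    (k : Fin K) : Matrix (Fin τ) (Fin M) ℂ :=
  Matrix.vecMulVec (S k) (p.x b U V k ᵥ* p.R k)

/-- The scalar `x_k R_i x_kᴴ`. -/
def xRx (b : Fin N → ℝ) (U : Fin N → Fin M → ℂ) (V : Fin K → Fin N → ℂ) (k i : Fin K) : ℂ :=
  p.x b U V k ⬝ᵥ (p.R i *ᵥ star (p.x b U V k))

/-- The covariance `U R_i Uᴴ` of the channel of user `i` after analog combining. -/
def C (U : Fin N → Fin M → ℂ) (i : Fin K) : Matrix (Fin N) (Fin N) ℂ :=
  Matrix.of U * p.R i * (Matrix.of U)ᴴ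

/-- The scalar `v_k Q diag(X) v_kᴴ`, where `diag(X)` keeps the diagonal of the matrix `X`. -/
def vQv (b : Fin N → ℝ) (V : Fin K → Fin N → ℂ) (k : Fin K) (X : Matrix (Fin N) (Fin N) ℂ) : ℂ :=
  (V k ᵥ* (p.Q b * Matrix.diagonal X.diag)) ⬝ᵥ star (V k)

/-- `B_k = ∑ i, s_i x_k R_i x_kᴴ s_iᴴ + σ² x_k x_kᴴ I
  + (I ⊗ v_k Q) diag(∑ i, (s_i ⊗ U) R_i (s_i ⊗ U)ᴴ + σ² I ⊗ U Uᴴ) (I ⊗ v_kᴴ)`.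
The last term is the diagonal matrix whose `l`-th entry is
`v_k Q diag(∑ i, |s_i(l)|² U R_i Uᴴ + σ² U Uᴴ) v_kᴴ`. -/
def B (b : Fin N → ℝ) (U : Fin N → Fin M → ℂ) (V : Fin K → Fin N → ℂ) (S : Fin K → Fin τ → ℂ)
    (k : Fin K) : Matrix (Fin τ) (Fin τ) ℂ :=
  ∑ i, p.xRx b U V k i • Matrix.vecMulVec (S i) (star (S i))
    + ((p.σ : ℂ) ^ 2 * (p.x b U V k ⬝ᵥ star (p.x b U V k))) • (1 : Matrix (Fin τ) (Fin τ) ℂ)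
    + Matrix.diagonal fun l => p.vQv b V k
        (∑ i, (S i l * star (S i l)) • p.C U i
          + (p.σ : ℂ) ^ 2 • (Matrix.of U * (Matrix.of U)ᴴ))

/-- The objective `f = ∑ k, tr (A_kᴴ B_k⁻¹ A_k)`. -/
def f (b : Fin N → ℝ) (U : Fin N → Fin M → ℂ) (V : Fin K → Fin N → ℂ) (S : Fin K → Fin τ → ℂ) : ℝ :=
  ∑ k, (((p.A b U V S k)ᴴ * (p.B b U V S k)⁻¹ * p.A b U V S k).trace).re

/-- The objective as a function of the point `z = (b, U, V, S)`. -/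
def obj (z : Point K M N τ) : ℝ := p.f z.1 z.2.1 z.2.2.1 z.2.2.2

/-- The transformed objective `f₀ = ∑ k, tr (2 Re (A_kᴴ Γ_k) - Γ_kᴴ B_k Γ_k)`. -/
def f₀ (b : Fin N → ℝ) (U : Fin N → Fin M → ℂ) (V : Fin K → Fin N → ℂ) (S : Fin K → Fin τ → ℂ)
    (Γ : Fin K → Matrix (Fin τ) (Fin M) ℂ) : ℝ :=
  ∑ k, (2 * ((p.A b U V S k)ᴴ * Γ k).trace.re
    - ((Γ k)ᴴ * p.B b U V S k * Γ k).trace.re)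

/-! ### Constraints and stationarity -/

/-- The constraints on the (relaxed) bit allocation. -/
def bitSet : Set (Fin N → ℝ) :=
  {b | (∀ n, p.bmin n ≤ b n ∧ b n ≤ p.bmax n) ∧ ∑ n, b n ≤ N * p.bavg}

/-- The constant-modulus constraint on the analog combiner. -/
def analogSet (N M : ℕ) : Set (Fin N → Fin M → ℂ) :=
  {U | ∀ n m, ‖U n m‖ = 1 / Real.sqrt M}

/-- The power constraints on the pilot sequences. -/
def pilotSet (τ : ℕ) : Set (Fin K → Fin τ → ℂ) :=
  {S | ∀ k, ∑ l, ‖S k l‖ ^ 2 ≤ p.Pmax k}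

/-- The feasible set of the joint design problem. -/
def feasibleSet (τ : ℕ) : Set (Point K M N τ) :=
  {z | z.1 ∈ p.bitSet ∧ z.2.1 ∈ analogSet N M ∧ z.2.2.2 ∈ p.pilotSet τ}

/-- A stationary point of `max obj` over the feasible set: a feasible point at which the objective
is differentiable and its derivative is nonpositive along every direction of the (Bouligand) tangent
cone of the feasible set. -/
def IsStationary (z : Point K M N τ) : Prop :=
  z ∈ p.feasibleSet τ ∧ ∃ f' : Point K M N τ →L[ℝ] ℝ, HasFDerivAt p.obj f' z ∧
    ∀ d ∈ posTangentConeAt (p.feasibleSet τ) z, f' d ≤ 0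

/-! ### The block updates -/

/-- Update of the auxiliary variables: `Γ_k = B_k⁻¹ A_k`. -/
def Γopt (z : Point K M N τ) (k : Fin K) : Matrix (Fin τ) (Fin M) ℂ :=
  (p.B z.1 z.2.1 z.2.2.1 z.2.2.2 k)⁻¹ * p.A z.1 z.2.1 z.2.2.1 z.2.2.2 k

/-- The concave quadratic surrogate, built at `b'`, of a function `g` of the bits:
`g b' + ∇g(b')ᵀ (b - b') - ζ ‖b - b'‖²` (Euclidean norm). -/
def surrogate (ζ : ℝ) (g : (Fin N → ℝ) → ℝ) (b' b : Fin N → ℝ) : ℝ :=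
  g b' + fderiv ℝ g b' (b - b') - ζ * ∑ n, (b n - b' n) ^ 2

/-- One step of successive concave approximation: `b` maximizes the surrogate built at `b'`. -/
def SCAStep (ζ : ℝ) (g : (Fin N → ℝ) → ℝ) (b' b : Fin N → ℝ) : Prop :=
  b ∈ p.bitSet ∧ IsMaxOn (surrogate ζ g b') p.bitSet b

/-- Update of the bits by successive concave approximation started at the current bits `b`: the new
bits `b₁` are the result of some positive number of steps, or a limit point of infinitely many. -/
def BitStep (ζ : ℝ) (U : Fin N → Fin M → ℂ) (V : Fin K → Fin N → ℂ) (S : Fin K → Fin τ → ℂ)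
    (Γ : Fin K → Matrix (Fin τ) (Fin M) ℂ) (b b₁ : Fin N → ℝ) : Prop :=
  ∃ w : ℕ → Fin N → ℝ, w 0 = b ∧
    (∀ j, p.SCAStep ζ (fun b' => p.f₀ b' U V S Γ) (w j) (w (j + 1))) ∧
    ((∃ J, 1 ≤ J ∧ b₁ = w J) ∨ MapClusterPt b₁ Filter.atTop w)

/-- The nonnegative scalar `s_iᴴ Γ_k Γ_kᴴ s_i`. -/
def sGs (S : Fin K → Fin τ → ℂ) (Γ : Fin K → Matrix (Fin τ) (Fin M) ℂ) (k i : Fin K) : ℂ :=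
  star (S i) ⬝ᵥ ((Γ k * (Γ k)ᴴ) *ᵥ S i)

/-- The nonnegative scalar `tr (diag(s_i s_iᴴ) Γ_k Γ_kᴴ)`. -/
def dGG (S : Fin K → Fin τ → ℂ) (Γ : Fin K → Matrix (Fin τ) (Fin M) ℂ) (k i : Fin K) : ℂ :=
  (Matrix.diagonal (fun l => S i l * star (S i l)) * (Γ k * (Γ k)ᴴ)).trace

/-- The linear part `Q_α v_kᴴ s_kᴴ Γ_k R_k` of the gradient of `f₀` in `U`. -/
def Ulin (b : Fin N → ℝ) (V : Fin K → Fin N → ℂ) (S : Fin K → Fin τ → ℂ)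
    (Γ : Fin K → Matrix (Fin τ) (Fin M) ℂ) (k : Fin K) : Matrix (Fin N) (Fin M) ℂ :=
  p.Qα b * Matrix.vecMulVec (star (V k)) (star (S k) ᵥ* (Γ k * p.R k))

/-- The quadratic coefficient
`σ² tr(Γ_k Γ_kᴴ) (Q_α v_kᴴ v_k Q_α + diag(v_kᴴ) diag(v_kᴴ)ᴴ Q)`. -/
def UquadNoise (b : Fin N → ℝ) (V : Fin K → Fin N → ℂ)
    (Γ : Fin K → Matrix (Fin τ) (Fin M) ℂ) (k : Fin K) : Matrix (Fin N) (Fin N) ℂ :=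
  ((p.σ : ℂ) ^ 2 * (Γ k * (Γ k)ᴴ).trace) •
    (p.Qα b * Matrix.vecMulVec (star (V k)) (V k) * p.Qα b
      + Matrix.diagonal (fun n => star (V k n) * V k n) * p.Q b)

/-- The quadratic coefficient
`tr(diag(s_i s_iᴴ) Γ_k Γ_kᴴ) diag(v_kᴴ) diag(v_kᴴ)ᴴ Q + Q_α v_kᴴ s_iᴴ Γ_k Γ_kᴴ s_i v_k Q_α`. -/
def UquadUser (b : Fin N → ℝ) (V : Fin K → Fin N → ℂ) (S : Fin K → Fin τ → ℂ)
    (Γ : Fin K → Matrix (Fin τ) (Fin M) ℂ) (k i : Fin K) : Matrix (Fin N) (Fin N) ℂ :=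
  dGG S Γ k i • (Matrix.diagonal (fun n => star (V k n) * V k n) * p.Q b)
    + sGs S Γ k i • (p.Qα b * Matrix.vecMulVec (star (V k)) (V k) * p.Qα b)

/-- The gradient `∂f₀/∂U*` at `U`. -/
def Φ (b : Fin N → ℝ) (U : Fin N → Fin M → ℂ) (V : Fin K → Fin N → ℂ) (S : Fin K → Fin τ → ℂ)
    (Γ : Fin K → Matrix (Fin τ) (Fin M) ℂ) : Matrix (Fin N) (Fin M) ℂ :=
  ∑ k, p.Ulin b V S Γ k - ∑ k, (p.UquadNoise b V Γ k * Matrix.of U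
    + ∑ i, p.UquadUser b V S Γ k i * Matrix.of U * p.R i)

/-- As a function of the single entry `u = U n m`, `f₀` is `2 Re (φ* u) - μ |u|²` up to a constant,
with `μ` as follows and `φ = Φ n m + μ U n m`. -/
def μ (b : Fin N → ℝ) (V : Fin K → Fin N → ℂ) (S : Fin K → Fin τ → ℂ)
    (Γ : Fin K → Matrix (Fin τ) (Fin M) ℂ) (n : Fin N) (m : Fin M) : ℂ :=
  ∑ k, (p.UquadNoise b V Γ k n n + ∑ i, p.UquadUser b V S Γ k i n n * p.R i m m)

/-- The coefficient `φ_{nm}`. It does not depend on the entry `U n m` itself. -/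
def φ (b : Fin N → ℝ) (U : Fin N → Fin M → ℂ) (V : Fin K → Fin N → ℂ) (S : Fin K → Fin τ → ℂ)
    (Γ : Fin K → Matrix (Fin τ) (Fin M) ℂ) (n : Fin N) (m : Fin M) : ℂ :=
  p.Φ b U V S Γ n m + p.μ b V S Γ n m * U n m

/-- The analog combiner in the course of a sweep from `U` to `U₁`, when it is the turn of the entry
`(n, m)`: the entries before `(n, m)` (row by row) have been updated, the others have not. -/
def sweepAt (U U₁ : Fin N → Fin M → ℂ) (n : Fin N) (m : Fin M) : Fin N → Fin M → ℂ :=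
  fun n' m' => if n' < n ∨ (n' = n ∧ m' < m) then U₁ n' m' else U n' m'

/-- One sweep over the entries of the analog combiner, each being set to `φ / (√M |φ|)` (to any
number of modulus `1 / √M` if `φ = 0`), where all the coefficients `φ` met have modulus at
least `δ`. -/
def AnalogSweep (δ : ℝ) (b : Fin N → ℝ) (V : Fin K → Fin N → ℂ) (S : Fin K → Fin τ → ℂ)
    (Γ : Fin K → Matrix (Fin τ) (Fin M) ℂ) (U U₁ : Fin N → Fin M → ℂ) : Prop :=
  U₁ ∈ analogSet N M ∧ ∀ n m, δ ≤ ‖p.φ b (sweepAt U U₁ n m) V S Γ n m‖ ∧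
    (Real.sqrt M * ‖p.φ b (sweepAt U U₁ n m) V S Γ n m‖ : ℝ) * U₁ n m
      = p.φ b (sweepAt U U₁ n m) V S Γ n m

/-- Exact solution of the analog combiner subproblem. -/
def AnalogExact (b : Fin N → ℝ) (V : Fin K → Fin N → ℂ) (S : Fin K → Fin τ → ℂ)
    (Γ : Fin K → Matrix (Fin τ) (Fin M) ℂ) (U₁ : Fin N → Fin M → ℂ) : Prop :=
  U₁ ∈ analogSet N M ∧ IsMaxOn (fun U' => p.f₀ b U' V S Γ) (analogSet N M) U₁

/-- The matrix of the quadratic form in `v_k`: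
`∑ i, s_iᴴ Γ_k Γ_kᴴ s_i Q_α U R_i Uᴴ Q_α + σ² tr(Γ_k Γ_kᴴ) (Q_α U Uᴴ Q_α + Q diag(U Uᴴ))
  + ∑ i, tr(diag(s_i s_iᴴ) Γ_k Γ_kᴴ) Q diag(U R_i Uᴴ)`. -/
def W (b : Fin N → ℝ) (U : Fin N → Fin M → ℂ) (S : Fin K → Fin τ → ℂ)
    (Γ : Fin K → Matrix (Fin τ) (Fin M) ℂ) (k : Fin K) : Matrix (Fin N) (Fin N) ℂ :=
  ∑ i, sGs S Γ k i • (p.Qα b * p.C U i * p.Qα b)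
    + ((p.σ : ℂ) ^ 2 * (Γ k * (Γ k)ᴴ).trace) •
        (p.Qα b * (Matrix.of U * (Matrix.of U)ᴴ) * p.Qα b
          + p.Q b * Matrix.diagonal (Matrix.of U * (Matrix.of U)ᴴ).diag)
    + ∑ i, dGG S Γ k i • (p.Q b * Matrix.diagonal (p.C U i).diag)

/-- Update of the digital combiners: `v_k = s_kᴴ Γ_k R_k Uᴴ Q_α W_k⁻¹`. The inverse is cleared, so
that the rule also makes sense when `W_k` is singular. -/
def DigitalStep (b : Fin N → ℝ) (U : Fin N → Fin M → ℂ) (S : Fin K → Fin τ → ℂ)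
    (Γ : Fin K → Matrix (Fin τ) (Fin M) ℂ) (V₁ : Fin K → Fin N → ℂ) : Prop :=
  ∀ k, V₁ k ᵥ* p.W b U S Γ k = star (S k) ᵥ* (Γ k * p.R k * (Matrix.of U)ᴴ * p.Qα b)

/-- The matrix of the quadratic form in `s_k`: `∑ i, x_i R_k x_iᴴ Γ_i Γ_iᴴ + T_k`, where `T_k` is the
diagonal matrix with entries `∑ i, (Γ_i Γ_iᴴ)(l, l) v_i Q diag(U R_k Uᴴ) v_iᴴ`. -/
def E (b : Fin N → ℝ) (U : Fin N → Fin M → ℂ) (V : Fin K → Fin N → ℂ)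
    (Γ : Fin K → Matrix (Fin τ) (Fin M) ℂ) (k : Fin K) : Matrix (Fin τ) (Fin τ) ℂ :=
  ∑ i, p.xRx b U V i k • (Γ i * (Γ i)ᴴ)
    + Matrix.diagonal fun l => ∑ i, (Γ i * (Γ i)ᴴ) l l * p.vQv b V i (p.C U k)

/-- Update of the pilots: `s_k = (E_k + λ_k I)⁻¹ Γ_k R_k x_kᴴ` (with the inverse cleared) and a
multiplier `λ_k ≥ 0` that vanishes unless the power constraint of user `k` is active. -/
def PilotStep (b : Fin N → ℝ) (U : Fin N → Fin M → ℂ) (V : Fin K → Fin N → ℂ)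
    (Γ : Fin K → Matrix (Fin τ) (Fin M) ℂ) (S₁ : Fin K → Fin τ → ℂ) : Prop :=
  S₁ ∈ p.pilotSet τ ∧ ∀ k, ∃ lam : ℝ, 0 ≤ lam ∧
    (lam = 0 ∨ ∑ l, ‖S₁ k l‖ ^ 2 = p.Pmax k) ∧
    (p.E b U V Γ k + (lam : ℂ) • (1 : Matrix (Fin τ) (Fin τ) ℂ)) *ᵥ S₁ k
      = Γ k *ᵥ (p.R k *ᵥ star (p.x b U V k))

/-- One iteration of the algorithm, from `z` to `z₁`: auxiliary variables, bits, analog combiner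
(exactly, or by one sweep over its entries), digital combiners, pilots, in this order. -/
def Iteration (ζ δ : ℝ) (z z₁ : Point K M N τ) : Prop :=
  p.BitStep ζ z.2.1 z.2.2.1 z.2.2.2 (p.Γopt z) z.1 z₁.1 ∧
  (p.AnalogExact z₁.1 z.2.2.1 z.2.2.2 (p.Γopt z) z₁.2.1 ∨
    p.AnalogSweep δ z₁.1 z.2.2.1 z.2.2.2 (p.Γopt z) z.2.1 z₁.2.1) ∧
  p.DigitalStep z₁.1 z₁.2.1 z.2.2.2 (p.Γopt z) z₁.2.2.1 ∧
  p.PilotStep z₁.1 z₁.2.1 z₁.2.2.1 (p.Γopt z) z₁.2.2.2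

/-- A run of the algorithm with a feasible initial point. The parameter `ζ` is the constant of the
surrogate; `δ = 0` puts no restriction on the sweeps. -/
def IsRun (ζ δ : ℝ) (z : ℕ → Point K M N τ) : Prop :=
  z 0 ∈ p.feasibleSet τ ∧ ∀ t, p.Iteration ζ δ (z t) (z (t + 1))

end System

/-- Multiplication of each digital combiner `v_k` by a scalar `c_k`. -/
def rescale {K M N τ : ℕ} (c : Fin K → ℂ) (z : Point K M N τ) : Point K M N τ :=
  (z.1, z.2.1, fun k => c k • z.2.2.1 k, z.2.2.2)

end

end PilotDesign

/-! Ascent. For fixed variables, completing the square in `Γ` gives `f - f₀ = ∑ tr ((B_k⁻¹A_k -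
Γ_k)ᴴ B_k (B_k⁻¹A_k - Γ_k))` (`oterm_sub_fterm`). On the feasible set the quantization noise alone
forces `B_k ≥ σ² q_k I` with `q_k > 0` as soon as `v_k ≠ 0` (`B_lower_bound`,
`qpow_pos_of_feasible`), and a user with `v_k = 0` contributes nothing to either side. So `f` is the
maximum of `f₀` over `Γ`, and an iteration that starts at the maximizing `Γ` and lowers `f₀` in no
block cannot lower `f`. The digital and pilot updates solve the optimality conditions of concave
quadratic problems, an entry update maximizes an affine function on a circle, and the bit surrogate
minorizes `f₀` once `ζ` exceeds a second-order Taylor constant.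

Uniformity. Replacing `v_k` by `c v_k` and `Γ_k` by `Γ_k / c̄` leaves `f₀` unchanged. Every feasible
point with its optimal `Γ` can therefore be moved into one fixed ball (`exists_normalization`),
which yields both the upper bound on `f` and a Taylor constant, hence `ζ₀`, depending only on the
data.

Stationarity. Let rescaled iterates `y` converge to `w` along an ultrafilter. The values of `f₀`
between the updates are squeezed to the limit of `f`, so the gap `f - f₀` vanishes and the auxiliary
variables tend to the optimal ones at `w` (`tendsto_auxiliary`). The gap is quadratic in the
residual `A_k - B_k Γ_k`, so `f` and `f₀` have the same derivative at `w` (`hasFDerivAt_obj`), and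
it suffices to show that `w` is optimal for `f₀` block by block (`isStationary_of_blocks`).
Optimality in `U`, `V`, `S` comes from the iteration that ends at `y`, optimality in `b` from the
one that starts there.

The difficulty is that the `U`-condition involves the old `V` and `S`, and the `V`-condition the old
`S`, whose limits may differ from those of the new ones. For `V`, the gain bounds the change times
the size of `Γ`: in the limit a combiner moves only where `Γ_k = 0`, and there it is irrelevant
(`exists_renormalization`). For `S`, the old and new limits both maximize a concave quadratic, hence
differ by a kernel vector, and this makes the derivatives in all other blocks agree
(`hasFDerivAt_f₀_sub_pilot`). In a sweep the change of `U` vanishes either because `δ > 0` and the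
gain controls it, or because the iterates converge. -/

namespace PilotDesign
open Matrix
namespace System

variable {K M N τ : ℕ} (p : System K M N)

/-! ### Expansion of `f₀` into scalar forms, and positivity of `B_k` -/

section Algebra

theorem trace_mul_self_conjTranspose {m n : Type*} [Fintype m] [Fintype n]
    (D : Matrix m n ℂ) : (D * Dᴴ).trace = ((∑ l, ∑ j, ‖D l j‖ ^ 2 : ℝ) : ℂ) := by
  simp [Matrix.trace, Matrix.mul_apply, Complex.mul_conj, Complex.normSq_eq_norm_sq]

theorem trace_vecMulVec_mul {m : Type*} [Fintype m] (a b : m → ℂ)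
    (X : Matrix m m ℂ) : (vecMulVec a b * X).trace = b ⬝ᵥ (X *ᵥ a) := by
  rw [vecMulVec_mul, trace_vecMulVec, dotProduct_comm, dotProduct_mulVec]

variable (b : Fin N → ℝ) (U : Fin N → Fin M → ℂ) (V : Fin K → Fin N → ℂ) (S : Fin K → Fin τ → ℂ)
  (Γ : Fin K → Matrix (Fin τ) (Fin M) ℂ) (k i : Fin K)

/-- The contribution of user `k` to `f₀`. -/
noncomputable def fterm : ℝ :=
  2 * ((p.A b U V S k)ᴴ * Γ k).trace.re - ((Γ k)ᴴ * p.B b U V S k * Γ k).trace.re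

theorem f₀_eq_sum_fterm : p.f₀ b U V S Γ = ∑ k, p.fterm b U V S Γ k := rfl

theorem trace_A_mul : ((p.A b U V S k)ᴴ * Γ k).trace
    = star (S k) ⬝ᵥ (Γ k *ᵥ (p.R k *ᵥ star (p.x b U V k))) := by
  rw [A, conjTranspose_vecMulVec, vecMulVec_mul, trace_vecMulVec, star_vecMul,
    (p.R_posSemidef k).isHermitian.eq, dotProduct_comm, dotProduct_mulVec, ← dotProduct_mulVec, ← dotProduct_mulVec]

theorem vQv_eq_sum (X : Matrix (Fin N) (Fin N) ℂ) :
    p.vQv b V k X = ∑ n, ((1 - p.β (b n) : ℝ) : ℂ) * (p.β (b n) : ℝ) * X n n * ‖V k n‖ ^ 2 := by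
  simp only [vQv, Q, Qα, diagonal_mul_diagonal, vecMul_diagonal, dotProduct, diag_apply,
    Pi.star_apply, RCLike.star_def]
  refine Finset.sum_congr rfl fun n _ => ?_
  rw [← Complex.mul_conj']
  ring

theorem vQv_add (X Y : Matrix (Fin N) (Fin N) ℂ) :
    p.vQv b V k (X + Y) = p.vQv b V k X + p.vQv b V k Y := by
  simp only [vQv_eq_sum, ← Finset.sum_add_distrib, Matrix.add_apply]
  exact Finset.sum_congr rfl fun n _ => by ring

theorem vQv_smul (c : ℂ) (X : Matrix (Fin N) (Fin N) ℂ) :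
    p.vQv b V k (c • X) = c * p.vQv b V k X := by
  simp only [vQv_eq_sum, Finset.mul_sum, Matrix.smul_apply, smul_eq_mul]
  exact Finset.sum_congr rfl fun n _ => by ring

theorem vQv_sum {ι : Type*} (s : Finset ι) (X : ι → Matrix (Fin N) (Fin N) ℂ) :
    p.vQv b V k (∑ j ∈ s, X j) = ∑ j ∈ s, p.vQv b V k (X j) := by
  simp only [vQv_eq_sum, Matrix.sum_apply, Finset.mul_sum, Finset.sum_mul]
  exact Finset.sum_comm

/-- The quadratic part of `fterm`, for an arbitrary matrix in place of `Γ k * (Γ k)ᴴ`. -/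
theorem trace_B_mul (X : Matrix (Fin τ) (Fin τ) ℂ) : (p.B b U V S k * X).trace
    = ∑ i, p.xRx b U V k i * (star (S i) ⬝ᵥ (X *ᵥ S i))
      + (p.σ : ℂ) ^ 2 * X.trace * (p.x b U V k ⬝ᵥ star (p.x b U V k)
        + p.vQv b V k (Matrix.of U * (Matrix.of U)ᴴ))
      + ∑ i, (∑ l, S i l * star (S i l) * X l l) * p.vQv b V k (p.C U i) := by
  have h3 : (Matrix.diagonal (fun l => p.vQv b V k
        (∑ i, (S i l * star (S i l)) • p.C U i
          + (p.σ : ℂ) ^ 2 • (Matrix.of U * (Matrix.of U)ᴴ))) * X).trace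
      = ∑ i, (∑ l, S i l * star (S i l) * X l l) * p.vQv b V k (p.C U i)
        + (p.σ : ℂ) ^ 2 * X.trace * p.vQv b V k (Matrix.of U * (Matrix.of U)ᴴ) := by
    simp only [Matrix.trace, diag_apply, diagonal_mul, vQv_add, vQv_sum, vQv_smul, add_mul,
      Finset.sum_add_distrib, Finset.sum_mul, Finset.mul_sum]
    congr 1
    · rw [Finset.sum_comm]
      exact Finset.sum_congr rfl fun _ _ => Finset.sum_congr rfl fun _ _ => by ring
    · exact Finset.sum_congr rfl fun _ _ => by ring
  rw [B, add_mul, add_mul, trace_add, trace_add, h3, Finset.sum_mul, trace_sum]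
  simp only [smul_mul_assoc, trace_smul, one_mul, trace_vecMulVec_mul, smul_eq_mul]
  ring

theorem trace_quad (D : Matrix (Fin τ) (Fin M) ℂ) :
    (Dᴴ * p.B b U V S k * D).trace = (p.B b U V S k * (D * Dᴴ)).trace := by
  rw [Matrix.mul_assoc, trace_mul_comm, Matrix.mul_assoc]

theorem dGG_eq_sum : dGG S Γ k i = ∑ l, S i l * star (S i l) * (Γ k * (Γ k)ᴴ) l l := by
  simp [dGG, Matrix.trace, diagonal_mul]

/-- The common source of the three quadratic representations of `f₀`, in `v_k`, in `S` and in `U`: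
each of them regroups these scalars. -/
theorem fterm_eq : p.fterm b U V S Γ k =
    2 * (star (S k) ⬝ᵥ (Γ k *ᵥ (p.R k *ᵥ star (p.x b U V k)))).re
      - (∑ i, p.xRx b U V k i * sGs S Γ k i
      + (p.σ : ℂ) ^ 2 * (Γ k * (Γ k)ᴴ).trace * (p.x b U V k ⬝ᵥ star (p.x b U V k)
        + p.vQv b V k (Matrix.of U * (Matrix.of U)ᴴ))
      + ∑ i, dGG S Γ k i * p.vQv b V k (p.C U i)).re := by
  rw [fterm, trace_A_mul, trace_quad, trace_B_mul]
  simp only [dGG_eq_sum, sGs]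

/-! ### Positivity -/

theorem xRx_nonneg : 0 ≤ p.xRx b U V k i := by
  simpa [xRx] using (p.R_posSemidef i).dotProduct_mulVec_nonneg (star (p.x b U V k))

theorem sGs_eq : sGs S Γ k i = star ((Γ k)ᴴ *ᵥ S i) ⬝ᵥ ((Γ k)ᴴ *ᵥ S i) := by
  rw [sGs, ← mulVec_mulVec, star_mulVec, conjTranspose_conjTranspose, dotProduct_mulVec]

theorem sGs_nonneg : 0 ≤ sGs S Γ k i := by
  rw [sGs_eq]; exact dotProduct_star_self_nonneg _

theorem gram_diag_nonneg {m n : Type*} [Fintype n] (D : Matrix m n ℂ) (l : m) :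
    0 ≤ (D * Dᴴ) l l := by
  simp only [Matrix.mul_apply, conjTranspose_apply]
  exact Finset.sum_nonneg fun j _ => mul_star_self_nonneg _

theorem dGG_nonneg : 0 ≤ dGG S Γ k i := by
  rw [dGG_eq_sum]
  exact Finset.sum_nonneg fun l _ => mul_nonneg (mul_star_self_nonneg _) (gram_diag_nonneg _ _)

theorem C_posSemidef : (p.C U i).PosSemidef :=
  (p.R_posSemidef i).mul_mul_conjTranspose_same _

theorem vQv_nonneg (hb : ∀ n, 0 ≤ p.β (b n) ∧ p.β (b n) ≤ 1) {X : Matrix (Fin N) (Fin N) ℂ}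
    (hX : ∀ n, 0 ≤ X n n) : 0 ≤ p.vQv b V k X := by
  rw [vQv_eq_sum]
  refine Finset.sum_nonneg fun n _ => ?_
  have h1 : (0 : ℂ) ≤ ((1 - p.β (b n) : ℝ) : ℂ) := by
    exact_mod_cast sub_nonneg.2 (hb n).2
  have h2 : (0 : ℂ) ≤ (p.β (b n) : ℝ) := by exact_mod_cast (hb n).1
  have h3 : (0 : ℂ) ≤ (‖V k n‖ : ℂ) ^ 2 := by exact_mod_cast sq_nonneg ‖V k n‖
  exact mul_nonneg (mul_nonneg (mul_nonneg h1 h2) (hX n)) h3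

/-- The quantization noise power `∑ n, Q n n |v_k n|² ‖U n‖²`, a lower bound of `B_k / σ²`. -/
noncomputable def qpow : ℝ :=
  ∑ n, (1 - p.β (b n)) * p.β (b n) * (∑ m, ‖U n m‖ ^ 2) * ‖V k n‖ ^ 2

theorem vQv_gram : p.vQv b V k (Matrix.of U * (Matrix.of U)ᴴ) = (p.qpow b U V k : ℝ) := by
  simp [vQv_eq_sum, qpow, Matrix.mul_apply, Complex.mul_conj, Complex.normSq_eq_norm_sq]

/-- All the other terms of `B_k` are positive semidefinite and are dropped, including `σ² x_k x_kᴴ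
I`, since `x_k` can vanish for `v_k ≠ 0`. The quantization noise cannot vanish then, as long as the
rows of `U` are nonzero and `0 < β < 1`. -/
theorem B_lower_bound (hb : ∀ n, 0 ≤ p.β (b n) ∧ p.β (b n) ≤ 1) (D : Matrix (Fin τ) (Fin M) ℂ) :
    p.σ ^ 2 * p.qpow b U V k * ∑ l, ∑ m, ‖D l m‖ ^ 2 ≤ (Dᴴ * p.B b U V S k * D).trace.re := by
  rw [trace_quad, trace_B_mul, trace_mul_self_conjTranspose, vQv_gram]
  have h1 : 0 ≤ ∑ i, p.xRx b U V k i * (star (S i) ⬝ᵥ ((D * Dᴴ) *ᵥ S i)) :=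
    Finset.sum_nonneg fun i _ => mul_nonneg (p.xRx_nonneg b U V k i)
      ((posSemidef_self_mul_conjTranspose D).dotProduct_mulVec_nonneg _)
  have h2 : 0 ≤ ∑ i, (∑ l, S i l * star (S i l) * (D * Dᴴ) l l) * p.vQv b V k (p.C U i) :=
    Finset.sum_nonneg fun i _ => mul_nonneg
      (Finset.sum_nonneg fun l _ => mul_nonneg (mul_star_self_nonneg _) (gram_diag_nonneg _ _))
      (p.vQv_nonneg b V k hb fun n => (p.C_posSemidef U i).diag_nonneg)
  have h3 : 0 ≤ p.x b U V k ⬝ᵥ star (p.x b U V k) := dotProduct_self_star_nonneg _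
  have h3' := (Complex.le_def.1 h3).1
  have h3'' : (p.x b U V k ⬝ᵥ star (p.x b U V k)).im = 0 := (Complex.le_def.1 h3).2.symm
  have h1' := (Complex.le_def.1 h1).1
  have h2' := (Complex.le_def.1 h2).1
  have e : (p.σ : ℂ) ^ 2 = ((p.σ ^ 2 : ℝ) : ℂ) := by push_cast; rfl
  rw [e, ← Complex.ofReal_mul, Complex.add_re, Complex.add_re, Complex.re_ofReal_mul,
    Complex.add_re, Complex.ofReal_re]
  simp only [Complex.zero_re] at h1' h2' h3'
  have h4 : 0 ≤ p.σ ^ 2 * (∑ l, ∑ m, ‖D l m‖ ^ 2) * (p.x b U V k ⬝ᵥ star (p.x b U V k)).re := by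
    positivity
  nlinarith

theorem B_isHermitian : (p.B b U V S k).IsHermitian := by
  have hx : ∀ i, star (p.xRx b U V k i) = p.xRx b U V k i := fun i =>
    (IsSelfAdjoint.of_nonneg (p.xRx_nonneg b U V k i)).star_eq
  refine (IsHermitian.add ?_ ?_).add ?_
  · simp [IsHermitian, conjTranspose_sum, conjTranspose_smul, conjTranspose_vecMulVec, hx]
  · rw [IsHermitian, conjTranspose_smul, conjTranspose_one]
    congr 1
    have h := (IsSelfAdjoint.of_nonneg
      (dotProduct_self_star_nonneg (p.x b U V k))).star_eq
    simp only [star_mul', star_pow, h]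
    simp
  · refine isHermitian_diagonal_of_self_adjoint _ ?_
    ext l
    simp only [Pi.star_apply, vQv_eq_sum, star_sum]
    refine Finset.sum_congr rfl fun n _ => ?_
    have h1 : star ((∑ i, (S i l * star (S i l)) • p.C U i
          + (p.σ : ℂ) ^ 2 • (Matrix.of U * (Matrix.of U)ᴴ)) n n) = (∑ i, (S i l * star (S i l)) • p.C U i
          + (p.σ : ℂ) ^ 2 • (Matrix.of U * (Matrix.of U)ᴴ)) n n := by
      refine (IsSelfAdjoint.of_nonneg ?_).star_eq
      simp only [Matrix.add_apply, Matrix.sum_apply, Matrix.smul_apply, smul_eq_mul]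
      refine add_nonneg (Finset.sum_nonneg fun i _ => mul_nonneg (mul_star_self_nonneg _)
        (p.C_posSemidef U i).diag_nonneg) (mul_nonneg ?_ (gram_diag_nonneg _ _))
      exact_mod_cast sq_nonneg p.σ
    simp only [star_mul', h1, star_pow]
    simp

end Algebra
end System
end PilotDesign

/-! ### Scale invariance, and `f₀` as a concave quadratic in each of `V`, `S`, `U` -/

namespace PilotDesign
open Matrix
namespace System

variable {K M N τ : ℕ} (p : System K M N)

section Forms

variable (b : Fin N → ℝ) (U : Fin N → Fin M → ℂ) (V : Fin K → Fin N → ℂ) (S : Fin K → Fin τ → ℂ)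
  (Γ : Fin K → Matrix (Fin τ) (Fin M) ℂ) (k i : Fin K)

/-! ### Dependence on the digital combiners and scale invariance -/

variable {V Γ k} in
theorem fterm_congr {V' : Fin K → Fin N → ℂ} {Γ' : Fin K → Matrix (Fin τ) (Fin M) ℂ}
    (hV : V k = V' k) (hΓ : Γ k = Γ' k) : p.fterm b U V S Γ k = p.fterm b U V' S Γ' k := by
  simp only [fterm, A, B, xRx, x, vQv, hV, hΓ]

theorem x_smul (c : Fin K → ℂ) : p.x b U (fun k => c k • V k) k = c k • p.x b U V k := by
  simp [x, smul_vecMul]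

theorem xRx_smul (c : Fin K → ℂ) : p.xRx b U (fun k => c k • V k) k i
    = (c k * star (c k)) * p.xRx b U V k i := by
  simp [xRx, x_smul, mulVec_smul]; ring

theorem vQv_smul_left (c : Fin K → ℂ) (X : Matrix (Fin N) (Fin N) ℂ) :
    p.vQv b (fun k => c k • V k) k X = (c k * star (c k)) * p.vQv b V k X := by
  simp [vQv, smul_vecMul]; ring

theorem A_smul (c : Fin K → ℂ) : p.A b U (fun k => c k • V k) S k = c k • p.A b U V S k := by
  simp [A, x_smul, smul_vecMul, vecMulVec_smul]

theorem B_smul (c : Fin K → ℂ) :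
    p.B b U (fun k => c k • V k) S k = (c k * star (c k)) • p.B b U V S k := by
  simp only [B, xRx_smul, x_smul, vQv_smul_left, smul_add, Finset.smul_sum, smul_smul]
  congr 1
  · congr 2
    simp; ring
  · ext i j; simp [diagonal_apply]

/-- `A_k` scales by `c` and `B_k` by `|c|²`, so `Γ_k` must scale like `B_k⁻¹ A_k`, that is, by `1 /
c̄`. -/
theorem fterm_smul {c : Fin K → ℂ} (hc : c k ≠ 0) :
    p.fterm b U (fun k => c k • V k) S (fun k => (star (c k))⁻¹ • Γ k) k
      = p.fterm b U V S Γ k := by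
  have hc' : star (c k) ≠ 0 := by simpa using hc
  simp only [fterm, A_smul, B_smul, conjTranspose_smul, Matrix.smul_mul, Matrix.mul_smul, smul_smul]
  congr 3
  · rw [inv_mul_cancel₀ hc', one_smul]
  · rw [show (star (c k))⁻¹ * (c k * star (c k) * star (star (c k))⁻¹) = 1 by
      simp only [star_inv₀, star_star]; field_simp, one_smul]

theorem f₀_smul {c : Fin K → ℂ} (hc : ∀ k, c k ≠ 0) :
    p.f₀ b U (fun k => c k • V k) S (fun k => (star (c k))⁻¹ • Γ k) = p.f₀ b U V S Γ :=
  Finset.sum_congr rfl fun k _ => p.fterm_smul b U V S Γ k (hc k)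

variable {k} in
theorem x_eq_zero (hV : V k = 0) : p.x b U V k = 0 := by simp [x, hV]

variable {k} in
theorem A_eq_zero (h : V k = 0 ∨ M = 0) : p.A b U V S k = 0 := by
  rcases h with h | rfl
  · ext; simp [A, p.x_eq_zero b U V h, vecMulVec_apply]
  · exact Subsingleton.elim _ _

variable {k} in
theorem fterm_eq_zero_of_combiner (h : V k = 0 ∨ M = 0) : p.fterm b U V S Γ k = 0 := by
  rcases h with h | rfl
  · have hB : p.B b U V S k = 0 := by
      simp [B, xRx, vQv, p.x_eq_zero b U V h, h]
    simp [fterm, p.A_eq_zero b U V S (Or.inl h), hB]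
  · simp [fterm, Matrix.trace]

variable {k} in
theorem fterm_eq_zero_of_auxiliary (h : Γ k = 0) : p.fterm b U V S Γ k = 0 := by
  simp [fterm, h]

variable {V Γ} in
-- A combiner whose auxiliary matrix vanishes has no influence on `f₀`. This is what makes an
-- uncontrolled limit of such a combiner harmless.
theorem f₀_congr {V' : Fin K → Fin N → ℂ} (h : ∀ k, Γ k = 0 ∨ V k = V' k) :
    p.f₀ b U V S Γ = p.f₀ b U V' S Γ := by
  refine Finset.sum_congr rfl fun k _ => ?_
  change p.fterm b U V S Γ k = p.fterm b U V' S Γ k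
  rcases h k with h | h
  · rw [fterm_eq_zero_of_auxiliary _ _ _ _ _ _ h, fterm_eq_zero_of_auxiliary _ _ _ _ _ _ h]
  · exact p.fterm_congr b U S h rfl

/-! ### Quadratic forms -/

theorem re_star_dotProduct_comm {n : Type*} [Fintype n] {H : Matrix n n ℂ} (hH : H.IsHermitian)
    (y z : n → ℂ) : (star y ⬝ᵥ (H *ᵥ z)).re = (star z ⬝ᵥ (H *ᵥ y)).re := by
  have : star y ⬝ᵥ (H *ᵥ z) = star (star z ⬝ᵥ (H *ᵥ y)) := by
    rw [← star_dotProduct_star, star_star, star_mulVec, hH.eq, dotProduct_mulVec]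
  rw [this]; simp

/-- The linear coefficient is written as `H y₁`, that is, `y₁` solves the normal equation. No
inverse of `H` occurs, so singular systems are covered. -/
theorem quad_gap {n : Type*} [Fintype n] {H : Matrix n n ℂ} (hH : H.IsHermitian)
    (y₁ y : n → ℂ) :
    (2 * (star y₁ ⬝ᵥ (H *ᵥ y₁)).re - (star y₁ ⬝ᵥ (H *ᵥ y₁)).re)
      - (2 * (star y ⬝ᵥ (H *ᵥ y₁)).re - (star y ⬝ᵥ (H *ᵥ y)).re)
      = (star (y₁ - y) ⬝ᵥ (H *ᵥ (y₁ - y))).re := by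
  simp only [mulVec_sub, star_sub, sub_dotProduct, dotProduct_sub, Complex.sub_re]
  rw [re_star_dotProduct_comm hH y₁ y]; ring

/-- Strict concavity up to the kernel of `H`: if `y` and `z` are both maximal on a midpoint-convex
set and `H ≥ 0`, the last term has to vanish. -/
theorem quad_midpoint {n : Type*} [Fintype n] {H : Matrix n n ℂ} (hH : H.IsHermitian)
    (h y z : n → ℂ) :
    2 * (star ((1 / 2 : ℂ) • (y + z)) ⬝ᵥ h).re
        - (star ((1 / 2 : ℂ) • (y + z)) ⬝ᵥ (H *ᵥ ((1 / 2 : ℂ) • (y + z)))).re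
      = (1 / 2) * (2 * (star y ⬝ᵥ h).re - (star y ⬝ᵥ (H *ᵥ y)).re)
        + (1 / 2) * (2 * (star z ⬝ᵥ h).re - (star z ⬝ᵥ (H *ᵥ z)).re)
        + (1 / 4) * (star (y - z) ⬝ᵥ (H *ᵥ (y - z))).re := by
  have e : star (1 / 2 : ℂ) = ((1 / 2 : ℝ) : ℂ) := by simp
  have e' : (1 / 2 : ℂ) = ((1 / 2 : ℝ) : ℂ) := by simp
  rw [star_smul, e, e']
  simp only [mulVec_sub, star_sub, sub_dotProduct, dotProduct_sub, Complex.sub_re, mulVec_add,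
    star_add, add_dotProduct, dotProduct_add, Complex.add_re, smul_dotProduct, dotProduct_smul,
    mulVec_smul, smul_eq_mul, Complex.re_ofReal_mul]
  rw [re_star_dotProduct_comm hH y z]; ring

theorem Qα_isHermitian : (p.Qα b).IsHermitian := by
  refine isHermitian_diagonal_of_self_adjoint _ ?_
  ext n; simp

theorem star_x : star (p.x b U V k) = ((Matrix.of U)ᴴ * p.Qα b) *ᵥ star (V k) := by
  rw [x, star_vecMul, conjTranspose_mul, (p.Qα_isHermitian b).eq]

theorem linear_combiner : star (S k) ⬝ᵥ (Γ k *ᵥ (p.R k *ᵥ star (p.x b U V k)))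
    = (star (S k) ᵥ* (Γ k * p.R k * (Matrix.of U)ᴴ * p.Qα b)) ⬝ᵥ star (V k) := by
  rw [star_x, mulVec_mulVec, mulVec_mulVec, dotProduct_mulVec]
  simp only [Matrix.mul_assoc]

theorem fterm_eq_combiner : p.fterm b U V S Γ k =
    2 * ((star (S k) ᵥ* (Γ k * p.R k * (Matrix.of U)ᴴ * p.Qα b)) ⬝ᵥ star (V k)).re
      - ((V k ᵥ* p.W b U S Γ k) ⬝ᵥ star (V k)).re := by
  rw [fterm_eq, linear_combiner]
  have h1 : ∀ i, p.xRx b U V k i = (V k ᵥ* (p.Qα b * p.C U i * p.Qα b)) ⬝ᵥ star (V k) := by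
    intro i
    rw [xRx, star_x, mulVec_mulVec, dotProduct_mulVec, x, vecMul_vecMul, C]
    simp only [Matrix.mul_assoc]
  have h2 : p.x b U V k ⬝ᵥ star (p.x b U V k)
      = (V k ᵥ* (p.Qα b * (Matrix.of U * (Matrix.of U)ᴴ) * p.Qα b)) ⬝ᵥ star (V k) := by
    rw [star_x, dotProduct_mulVec, x, vecMul_vecMul]
    simp only [Matrix.mul_assoc]
  congr 2
  simp only [h1, h2, vQv, W, vecMul_add, add_dotProduct, vecMul_smul, smul_dotProduct,
    vecMul_sum, sum_dotProduct, smul_eq_mul]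
  congr 2
  refine Finset.sum_congr rfl fun i _ => mul_comm _ _

theorem E_form : star (S i) ⬝ᵥ (p.E b U V Γ i *ᵥ S i)
    = ∑ k, p.xRx b U V k i * sGs S Γ k i + ∑ k, dGG S Γ k i * p.vQv b V k (p.C U i) := by
  simp only [E, add_mulVec, dotProduct_add, sum_mulVec, dotProduct_sum, smul_mulVec,
    dotProduct_smul, smul_eq_mul, sGs]
  congr 1
  simp only [dotProduct, mulVec_diagonal, dGG_eq_sum, Finset.sum_mul, Finset.mul_sum]
  rw [Finset.sum_comm]
  refine Finset.sum_congr rfl fun _ _ => Finset.sum_congr rfl fun _ _ => ?_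
  simp only [Pi.star_apply]; ring

/-- The pilot `s_i` enters `B_k` for every `k`. Exchanging the two sums collects everything
quadratic in `s_i` into `E_i`, after which `f₀` separates over the pilots. -/
theorem f₀_eq_pilot : p.f₀ b U V S Γ =
    ∑ k, (2 * (star (S k) ⬝ᵥ (Γ k *ᵥ (p.R k *ᵥ star (p.x b U V k)))).re
      - (star (S k) ⬝ᵥ (p.E b U V Γ k *ᵥ S k)).re)
    - ∑ k, ((p.σ : ℂ) ^ 2 * (Γ k * (Γ k)ᴴ).trace * (p.x b U V k ⬝ᵥ star (p.x b U V k)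
        + p.vQv b V k (Matrix.of U * (Matrix.of U)ᴴ))).re := by
  rw [f₀_eq_sum_fterm]
  simp only [fterm_eq, E_form, Complex.add_re, Complex.re_sum, Finset.sum_sub_distrib,
    Finset.sum_add_distrib]
  rw [Finset.sum_comm (f := fun k i => (p.xRx b U V i k * sGs S Γ i k).re),
    Finset.sum_comm (f := fun k i => (dGG S Γ i k * p.vQv b V i (p.C U k)).re)]
  ring

/-! ### Dependence on the analog combiner -/

/-- The sesquilinear form of the quadratic part of `f₀` in the analog combiner. -/
noncomputable def Uform (X Y : Matrix (Fin N) (Fin M) ℂ) : ℂ :=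
  ∑ k, ((Xᴴ * (p.UquadNoise b V Γ k * Y)).trace
    + ∑ i, (Xᴴ * (p.UquadUser b V S Γ k i * Y * p.R i)).trace)

theorem trace_rank_one (X : Matrix (Fin N) (Fin M) ℂ) (Y : Matrix (Fin M) (Fin N) ℂ) :
    (Y * (p.Qα b * vecMulVec (star (V k)) (V k) * p.Qα b * X)).trace
    = (V k ᵥ* (p.Qα b * X)) ⬝ᵥ ((Y * p.Qα b) *ᵥ star (V k)) := by
  rw [show Y * (p.Qα b * vecMulVec (star (V k)) (V k) * p.Qα b * X)
    = (Y * p.Qα b) * (vecMulVec (star (V k)) (V k) * (p.Qα b * X)) by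
      simp only [Matrix.mul_assoc], vecMulVec_mul, mul_vecMulVec, trace_vecMulVec,
      dotProduct_comm]

theorem trace_noise_diag (X : Matrix (Fin N) (Fin N) ℂ) :
    ((Matrix.diagonal (fun n => star (V k n) * V k n) * p.Q b) * X).trace = p.vQv b V k X := by
  simp only [vQv, Q, Qα, diagonal_mul_diagonal, vecMul_diagonal, dotProduct, Matrix.trace,
    diag_apply, diagonal_mul, Pi.star_apply]
  exact Finset.sum_congr rfl fun n _ => by ring

theorem xRx_eq_trace : p.xRx b U V k i = ((Matrix.of U)ᴴ *
    (p.Qα b * vecMulVec (star (V k)) (V k) * p.Qα b * Matrix.of U * p.R i)).trace := by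
  rw [Matrix.mul_assoc _ (Matrix.of U), trace_rank_one, xRx, star_x, ← Matrix.mul_assoc,
    ← vecMul_vecMul, x, dotProduct_mulVec]

theorem f₀_eq_analog : p.f₀ b U V S Γ =
    2 * ((Matrix.of U)ᴴ * ∑ k, p.Ulin b V S Γ k).trace.re
      - (p.Uform b V S Γ (Matrix.of U) (Matrix.of U)).re := by
  have h1 : ∀ k, star (S k) ⬝ᵥ (Γ k *ᵥ (p.R k *ᵥ star (p.x b U V k)))
      = ((Matrix.of U)ᴴ * p.Ulin b V S Γ k).trace := by
    intro k
    rw [Ulin, ← Matrix.mul_assoc, mul_vecMulVec, trace_vecMulVec, star_x, mulVec_mulVec,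
      dotProduct_mulVec, dotProduct_comm]
  have h2 : ∀ k, p.x b U V k ⬝ᵥ star (p.x b U V k) = ((Matrix.of U)ᴴ *
    (p.Qα b * vecMulVec (star (V k)) (V k) * p.Qα b * Matrix.of U)).trace := by
    intro k
    rw [trace_rank_one, star_x, x]
  have h3 : ∀ k (X : Matrix (Fin M) (Fin N) ℂ), p.vQv b V k (Matrix.of U * X)
      = (X * ((Matrix.diagonal (fun n => star (V k n) * V k n) * p.Q b) * Matrix.of U)).trace := by
    intro k X
    rw [trace_mul_comm, Matrix.mul_assoc, trace_noise_diag]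
  have h4 : ∀ k i, p.vQv b V k (p.C U i) = ((Matrix.of U)ᴴ * ((Matrix.diagonal
      (fun n => star (V k n) * V k n) * p.Q b) * Matrix.of U * p.R i)).trace := by
    intro k i
    rw [C, Matrix.mul_assoc, h3, Matrix.mul_assoc (p.R i), trace_mul_comm (p.R i)]
    simp only [Matrix.mul_assoc]
  rw [f₀_eq_sum_fterm]
  simp only [fterm_eq, Finset.sum_sub_distrib, h1, Matrix.mul_sum, trace_sum, Complex.re_sum,
    Finset.mul_sum, Uform]
  congr 1
  refine Finset.sum_congr rfl fun k _ => ?_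
  congr 1
  simp only [h2, h3, h4, xRx_eq_trace, UquadNoise, UquadUser, Matrix.add_mul, Matrix.mul_add,
    Matrix.smul_mul, Matrix.mul_smul, trace_add, trace_smul, smul_eq_mul, Finset.sum_add_distrib]
  simp only [mul_comm (sGs _ _ _ _)]
  ring

theorem UquadNoise_isHermitian : (p.UquadNoise b V Γ k).IsHermitian := by
  have h : p.Qα b * vecMulVec (star (V k)) (V k) * p.Qα b
      + Matrix.diagonal (fun n => star (V k n) * V k n) * p.Q b
      = (p.Qα b * vecMulVec (star (V k)) (V k) * p.Qα b
      + Matrix.diagonal (fun n => star (V k n) * V k n) * p.Q b)ᴴ := by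
    simp only [conjTranspose_add, conjTranspose_mul, (p.Qα_isHermitian b).eq,
      conjTranspose_vecMulVec, star_star, Q, diagonal_conjTranspose, Matrix.mul_assoc]
    congr 1
    simp only [Qα, diagonal_mul_diagonal]
    congr 1; ext n; simp; ring
  rw [IsHermitian, UquadNoise, conjTranspose_smul, ← h, trace_mul_self_conjTranspose]
  simp

theorem UquadUser_isHermitian : (p.UquadUser b V S Γ k i).IsHermitian := by
  have h1 : star (dGG S Γ k i) = dGG S Γ k i :=
    (IsSelfAdjoint.of_nonneg (dGG_nonneg S Γ k i)).star_eq
  have h2 : star (sGs S Γ k i) = sGs S Γ k i :=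
    (IsSelfAdjoint.of_nonneg (sGs_nonneg S Γ k i)).star_eq
  simp only [IsHermitian, UquadUser, conjTranspose_add, conjTranspose_smul, h1, h2,
    conjTranspose_mul, (p.Qα_isHermitian b).eq,
      conjTranspose_vecMulVec, star_star, Q, diagonal_conjTranspose, Matrix.mul_assoc]
  congr 2
  simp only [Qα, diagonal_mul_diagonal]
  congr 1; ext n; simp; ring

/-- Hermitian symmetry makes the two cross terms of the expansion in `U` have equal real parts. -/
theorem Uform_comm (X Y : Matrix (Fin N) (Fin M) ℂ) :
    p.Uform b V S Γ Y X = star (p.Uform b V S Γ X Y) := by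
  simp only [Uform, star_sum, star_add, ← trace_conjTranspose, conjTranspose_mul,
    conjTranspose_conjTranspose, (p.UquadNoise_isHermitian b V Γ _).eq,
    (p.UquadUser_isHermitian b V S Γ _ _).eq, (p.R_posSemidef _).isHermitian.eq, Matrix.mul_assoc]
  refine Finset.sum_congr rfl fun k _ => ?_
  congr 1
  refine Finset.sum_congr rfl fun i _ => ?_
  rw [trace_mul_comm (p.R i)]
  simp only [Matrix.mul_assoc]

theorem trace_mul_Φ (X : Matrix (Fin N) (Fin M) ℂ) :
    (Xᴴ * p.Φ b U V S Γ).trace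
      = (Xᴴ * ∑ k, p.Ulin b V S Γ k).trace - p.Uform b V S Γ X (Matrix.of U) := by
  simp only [Φ, Matrix.mul_sub, trace_sub, Uform, Matrix.mul_sum, trace_sum, Matrix.mul_add,
    trace_add]

theorem f₀_analog_add (D : Fin N → Fin M → ℂ) : p.f₀ b (U + D) V S Γ = p.f₀ b U V S Γ
    + 2 * ((Matrix.of D)ᴴ * p.Φ b U V S Γ).trace.re
    - (p.Uform b V S Γ (Matrix.of D) (Matrix.of D)).re := by
  rw [trace_mul_Φ, f₀_eq_analog, f₀_eq_analog]
  have hadd : Matrix.of (U + D) = Matrix.of U + Matrix.of D := rfl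
  have hl : ∀ X Y Z : Matrix (Fin N) (Fin M) ℂ, p.Uform b V S Γ (X + Y) Z
      = p.Uform b V S Γ X Z + p.Uform b V S Γ Y Z := by
    intro X Y Z
    simp only [Uform, conjTranspose_add, Matrix.add_mul, trace_add, Finset.sum_add_distrib]
    ring
  have hr : ∀ X Y Z : Matrix (Fin N) (Fin M) ℂ, p.Uform b V S Γ Z (X + Y)
      = p.Uform b V S Γ Z X + p.Uform b V S Γ Z Y := by
    intro X Y Z
    simp only [Uform, Matrix.mul_add, Matrix.add_mul, trace_add, Finset.sum_add_distrib]
    ring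
  rw [hadd, conjTranspose_add, Matrix.add_mul, trace_add, hl, hr, hr,
    p.Uform_comm b V S Γ (Matrix.of D) (Matrix.of U)]
  simp only [Complex.add_re, Complex.sub_re, RCLike.star_def, Complex.conj_re]
  ring

end Forms
end System
end PilotDesign

/-! ### Effect of the analog, digital and pilot updates on `f₀` -/

namespace PilotDesign
open Matrix
namespace System

variable {K M N τ : ℕ} (p : System K M N)

section Steps

variable (b : Fin N → ℝ) (U : Fin N → Fin M → ℂ) (V : Fin K → Fin N → ℂ) (S : Fin K → Fin τ → ℂ)
  (Γ : Fin K → Matrix (Fin τ) (Fin M) ℂ) (k i : Fin K)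

/-! ### Analog combiner -/

theorem trace_single_conjTranspose_mul (n : Fin N) (m : Fin M) (d : ℂ)
    (X : Matrix (Fin N) (Fin M) ℂ) : ((Matrix.single n m d)ᴴ * X).trace = star d * X n m := by
  rw [conjTranspose_single, trace_single_mul, smul_eq_mul]

theorem Uform_single (n : Fin N) (m : Fin M) (d : ℂ) :
    p.Uform b V S Γ (Matrix.single n m d) (Matrix.single n m d)
      = p.μ b V S Γ n m * (star d * d) := by
  have h1 : ∀ X : Matrix (Fin N) (Fin N) ℂ, (X * Matrix.single n m d) n m = X n n * d := by
    intro X; simp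
  have h2 : ∀ (X : Matrix (Fin N) (Fin N) ℂ) (Y : Matrix (Fin M) (Fin M) ℂ),
      (X * Matrix.single n m d * Y) n m = X n n * d * Y m m := by
    intro X Y
    simp [Matrix.mul_apply, Matrix.single_apply, ite_and]
  simp only [Uform, trace_single_conjTranspose_mul, h1, h2, μ, Finset.sum_mul, add_mul]
  refine Finset.sum_congr rfl fun k _ => ?_
  congr 1
  · ring
  · exact Finset.sum_congr rfl fun i _ => by ring

theorem star_μ (n : Fin N) (m : Fin M) : star (p.μ b V S Γ n m) = p.μ b V S Γ n m := by
  have h := p.Uform_comm b V S Γ (Matrix.single n m 1) (Matrix.single n m 1)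
  rw [Uform_single] at h
  simpa using h.symm

/-- `U` with the entry `(n, m)` replaced by `u`. -/
def setEntry (U : Fin N → Fin M → ℂ) (n : Fin N) (m : Fin M) (u : ℂ) : Fin N → Fin M → ℂ :=
  Function.update U n (Function.update (U n) m u)

theorem setEntry_apply (n : Fin N) (m : Fin M) (u : ℂ) (n' : Fin N) (m' : Fin M) :
    setEntry U n m u n' m' = if n' = n ∧ m' = m then u else U n' m' := by
  unfold setEntry
  by_cases h : n' = n
  · subst h
    by_cases h' : m' = m
    · subst h'; simp
    · simp [h']
  · simp [h]

/-- For equal moduli the displacement `d = u - U n m` satisfies `|d|² = -2 Re (d̄ U n m)`. The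
quadratic term `-μ |d|²` thereby becomes linear and turns the gradient `Φ` into `φ`. -/
theorem f₀_setEntry (n : Fin N) (m : Fin M) (u : ℂ) (hu : ‖u‖ = ‖U n m‖) :
    p.f₀ b (setEntry U n m u) V S Γ
      = p.f₀ b U V S Γ + 2 * (star (p.φ b U V S Γ n m) * (u - U n m)).re := by
  have e : setEntry U n m u = U + (fun n' m' => Matrix.single n m (u - U n m) n' m') := by
    ext n' m'
    rw [setEntry_apply]
    by_cases h : n' = n ∧ m' = m
    · obtain ⟨rfl, rfl⟩ := h; simp
    · rw [if_neg h]
      have : ¬ (n = n' ∧ m = m') := fun h' => h ⟨h'.1.symm, h'.2.symm⟩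
      simp [Matrix.single_apply, this]
  have e' : (Matrix.of fun n' m' => Matrix.single n m (u - U n m) n' m')
      = Matrix.single n m (u - U n m) := rfl
  rw [e, f₀_analog_add, e', Uform_single, trace_single_conjTranspose_mul, φ]
  have hμ : (p.μ b V S Γ n m).im = 0 := by
    have := congrArg Complex.im (p.star_μ b V S Γ n m)
    simp at this; linarith
  have hn : u.re ^ 2 + u.im ^ 2 = (U n m).re ^ 2 + (U n m).im ^ 2 := by
    have h1 := Complex.normSq_eq_norm_sq u
    have h2 := Complex.normSq_eq_norm_sq (U n m)
    rw [Complex.normSq_apply] at h1 h2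
    rw [hu] at h1
    linarith
  simp only [Complex.mul_re, Complex.mul_im, Complex.sub_re, Complex.sub_im, Complex.add_re,
    Complex.add_im, RCLike.star_def, Complex.conj_re, Complex.conj_im, hμ]
  linear_combination (p.μ b V S Γ n m).re * hn * (-1)

/-! ### Digital combiner -/

theorem smul_isHermitian {n : Type*} {c : ℂ} (hc : 0 ≤ c) {X : Matrix n n ℂ} (hX : X.IsHermitian) :
    (c • X).IsHermitian := by
  rw [IsHermitian, conjTranspose_smul, hX.eq, (IsSelfAdjoint.of_nonneg hc).star_eq]

theorem gram_trace_nonneg {m n : Type*} [Fintype m] [Fintype n] (D : Matrix m n ℂ) :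
    0 ≤ (D * Dᴴ).trace :=
  Finset.sum_nonneg fun l _ => gram_diag_nonneg D l

theorem sigma_sq_nonneg : (0 : ℂ) ≤ (p.σ : ℂ) ^ 2 := by exact_mod_cast sq_nonneg p.σ

theorem sum_isHermitian {ι n : Type*} (s : Finset ι) {X : ι → Matrix n n ℂ}
    (h : ∀ j, (X j).IsHermitian) : (∑ j ∈ s, X j).IsHermitian := by
  rw [IsHermitian, conjTranspose_sum]
  exact Finset.sum_congr rfl fun j _ => (h j).eq

theorem Q_mul_diagonal_isHermitian {X : Matrix (Fin N) (Fin N) ℂ} (hX : X.IsHermitian) :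
    (p.Q b * Matrix.diagonal X.diag).IsHermitian := by
  rw [Q, Qα, diagonal_mul_diagonal, diagonal_mul_diagonal]
  refine isHermitian_diagonal_of_self_adjoint _ ?_
  ext n
  have := hX.apply n n
  simp at this ⊢
  simp [this]

theorem W_isHermitian : (p.W b U S Γ k).IsHermitian := by
  have hα : ∀ {X : Matrix (Fin N) (Fin N) ℂ}, X.IsHermitian →
      (p.Qα b * X * p.Qα b).IsHermitian := by
    intro X hX
    rw [IsHermitian, conjTranspose_mul, conjTranspose_mul, hX.eq, (p.Qα_isHermitian b).eq,
      Matrix.mul_assoc]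
  have hU : (Matrix.of U * (Matrix.of U)ᴴ).IsHermitian := isHermitian_mul_conjTranspose_self _
  refine IsHermitian.add (IsHermitian.add ?_ ?_) ?_
  · exact sum_isHermitian _ fun i =>
      smul_isHermitian (sGs_nonneg S Γ k i) (hα (p.C_posSemidef U i).isHermitian)
  · exact smul_isHermitian (mul_nonneg p.sigma_sq_nonneg (gram_trace_nonneg _))
      ((hα hU).add (p.Q_mul_diagonal_isHermitian b hU))
  · exact sum_isHermitian _ fun i => smul_isHermitian (dGG_nonneg S Γ k i)
      (p.Q_mul_diagonal_isHermitian b (p.C_posSemidef U i).isHermitian)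

/-- The form of `W_k` at `v_k` is `tr (Γ_kᴴ B_k Γ_k)`, so the bound on `B_k` transfers to it. -/
theorem W_form_lower_bound (hb : ∀ n, 0 ≤ p.β (b n) ∧ p.β (b n) ≤ 1) :
    p.σ ^ 2 * p.qpow b U V k * ∑ l, ∑ m, ‖Γ k l m‖ ^ 2
      ≤ ((V k ᵥ* p.W b U S Γ k) ⬝ᵥ star (V k)).re := by
  have h1 := p.fterm_eq_combiner b U V S Γ k
  rw [fterm, trace_A_mul, linear_combiner] at h1
  have h2 := p.B_lower_bound b U V S k hb (Γ k)
  linarith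

/-- The gain is the form of `W_k` at the displacement of `v_k`. It is kept in quantitative form,
weighted by the size of `Γ_k`, because a vanishing gain must later force the change of the combiners
to vanish. -/
theorem f₀_digitalStep {V₁ : Fin K → Fin N → ℂ} (hb : ∀ n, 0 ≤ p.β (b n) ∧ p.β (b n) ≤ 1)
    (h : p.DigitalStep b U S Γ V₁) :
    p.f₀ b U V S Γ + ∑ k, p.σ ^ 2 * p.qpow b U (V₁ - V) k * ∑ l, ∑ m, ‖Γ k l m‖ ^ 2
      ≤ p.f₀ b U V₁ S Γ := by
  rw [f₀_eq_sum_fterm, f₀_eq_sum_fterm, ← Finset.sum_add_distrib]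
  refine Finset.sum_le_sum fun k _ => ?_
  have hlow := p.W_form_lower_bound b U (V₁ - V) S Γ k hb
  rw [fterm_eq_combiner, fterm_eq_combiner, ← h k]
  have hH := p.W_isHermitian b U S Γ k
  have key := quad_gap hH (star (V₁ k)) (star (V k))
  rw [← star_sub] at key
  simp only [star_star, dotProduct_mulVec] at key
  rw [← dotProduct_mulVec (V k) _ (star (V₁ k))] at key
  have hc : (V k ⬝ᵥ (p.W b U S Γ k *ᵥ star (V₁ k))).re
      = ((V₁ k ᵥ* p.W b U S Γ k) ⬝ᵥ star (V k)).re := by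
    have := re_star_dotProduct_comm hH (star (V k)) (star (V₁ k))
    rw [star_star, star_star] at this
    rw [this, dotProduct_mulVec]
  rw [hc] at key
  have e : (V₁ - V) k = V₁ k - V k := rfl
  rw [e] at hlow
  linarith

/-! ### Pilots -/

theorem E_isHermitian (hb : ∀ n, 0 ≤ p.β (b n) ∧ p.β (b n) ≤ 1) : (p.E b U V Γ k).IsHermitian := by
  refine IsHermitian.add ?_ ?_
  · exact sum_isHermitian _ fun i => smul_isHermitian (p.xRx_nonneg b U V i k)
      (isHermitian_mul_conjTranspose_self _)
  · refine isHermitian_diagonal_of_self_adjoint _ ?_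
    ext l
    refine (IsSelfAdjoint.of_nonneg ?_).star_eq
    exact Finset.sum_nonneg fun i _ => mul_nonneg (gram_diag_nonneg _ _)
      (p.vQv_nonneg b V i hb fun n => (p.C_posSemidef U k).diag_nonneg)

theorem E_form_nonneg (hb : ∀ n, 0 ≤ p.β (b n) ∧ p.β (b n) ≤ 1) :
    0 ≤ star (S i) ⬝ᵥ (p.E b U V Γ i *ᵥ S i) := by
  rw [E_form]
  exact add_nonneg
    (Finset.sum_nonneg fun k _ => mul_nonneg (p.xRx_nonneg b U V k i) (sGs_nonneg S Γ k i))
    (Finset.sum_nonneg fun k _ => mul_nonneg (dGG_nonneg S Γ k i)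
      (p.vQv_nonneg b V k hb fun n => (p.C_posSemidef U i).diag_nonneg))

theorem re_star_dotProduct_self {n : Type*} [Fintype n] (y : n → ℂ) :
    (star y ⬝ᵥ y).re = ∑ l, ‖y l‖ ^ 2 := by
  simp [dotProduct, Complex.conj_mul']
  norm_cast

/-- Sufficiency of the KKT conditions: the gain is the form of `E_k` at the displacement plus `λ
(2‖s₁‖² - 2 Re⟨s, s₁⟩) ≥ λ (‖s₁‖² - ‖s‖²)`, and complementary slackness makes the last expression
nonnegative. -/
theorem f₀_le_pilotStep {S₁ : Fin K → Fin τ → ℂ} (hb : ∀ n, 0 ≤ p.β (b n) ∧ p.β (b n) ≤ 1)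
    (h : p.PilotStep b U V Γ S₁) (hS : S ∈ p.pilotSet τ) :
    p.f₀ b U V S Γ ≤ p.f₀ b U V S₁ Γ := by
  rw [f₀_eq_pilot, f₀_eq_pilot]
  refine sub_le_sub_right (Finset.sum_le_sum fun k _ => ?_) _
  obtain ⟨lam, hlam, hact, heq⟩ := h.2 k
  have hH := p.E_isHermitian b U V Γ k hb
  have key := quad_gap hH (S₁ k) (S k)
  have hnn := (Complex.le_def.1 (p.E_form_nonneg b U V (S₁ - S) Γ k hb)).1
  rw [Pi.sub_apply, Complex.zero_re, ← key] at hnn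
  rw [← heq]
  simp only [add_mulVec, smul_mulVec, one_mulVec, dotProduct_add, dotProduct_smul, smul_eq_mul,
    Complex.add_re, Complex.re_ofReal_mul]
  have hd := re_star_dotProduct_self (S₁ k - S k)
  have h0 : 0 ≤ ∑ l, ‖(S₁ k - S k) l‖ ^ 2 := by positivity
  rw [← hd] at h0
  simp only [star_sub, sub_dotProduct, dotProduct_sub, Complex.sub_re] at h0
  have hcomm : (star (S₁ k) ⬝ᵥ S k).re = (star (S k) ⬝ᵥ S₁ k).re := by
    have := re_star_dotProduct_comm (isHermitian_one (n := Fin τ) (α := ℂ)) (S₁ k) (S k)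
    simpa using this
  rw [hcomm, re_star_dotProduct_self, re_star_dotProduct_self] at h0
  rw [re_star_dotProduct_self]
  rcases hact with h | h
  · subst h; linarith
  · have := hS k
    nlinarith

/-! ### The objective -/

end Steps
end System
end PilotDesign

/-! ### `f` as the maximum of `f₀` over the auxiliary variables -/

namespace PilotDesign
open Matrix
namespace System

variable {K M N τ : ℕ} (p : System K M N)

section Objective

variable (b : Fin N → ℝ) (U : Fin N → Fin M → ℂ) (V : Fin K → Fin N → ℂ) (S : Fin K → Fin τ → ℂ)
  (G : Fin K → Matrix (Fin τ) (Fin M) ℂ) (k : Fin K)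

theorem isUnit_det_B (hb : ∀ n, 0 ≤ p.β (b n) ∧ p.β (b n) ≤ 1) (hq : 0 < p.qpow b U V k) :
    IsUnit (p.B b U V S k).det := by
  rw [isUnit_iff_ne_zero]
  intro h
  obtain ⟨y, hy, hB⟩ := Matrix.exists_mulVec_eq_zero_iff.2 h
  apply hy
  have hM : Nonempty (Fin M) := by
    by_contra hM
    rw [not_nonempty_iff] at hM
    simp [qpow] at hq
  obtain ⟨m⟩ := hM
  -- The lower bound is stated for `τ × M` matrices, so the kernel vector `y` is repeated in `M`
  -- columns. There is at least one column because `qpow` would be zero for `M = 0`.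
  have h1 := p.B_lower_bound b U V S k hb (vecMulVec y (fun _ : Fin M => (1 : ℂ)))
  rw [Matrix.mul_assoc, mul_vecMulVec, hB] at h1
  have h2 : (vecMulVec 0 fun _ : Fin M => (1 : ℂ)) = (0 : Matrix (Fin τ) (Fin M) ℂ) := by
    ext; simp [vecMulVec_apply]
  rw [h2, Matrix.mul_zero, trace_zero, Complex.zero_re] at h1
  have h0 : ∑ l, ∑ m, ‖(vecMulVec y (fun _ : Fin M => (1 : ℂ))) l m‖ ^ 2 ≤ 0 := by
    by_contra hpos
    push Not at hpos
    have := mul_pos (mul_pos (pow_pos p.σ_pos 2) hq) hpos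
    linarith
  ext l
  have h3 := (Finset.sum_eq_zero_iff_of_nonneg fun l _ => by positivity).1
    (le_antisymm h0 (by positivity)) l (Finset.mem_univ l)
  have h4 := (Finset.sum_eq_zero_iff_of_nonneg fun l _ => by positivity).1 h3 m (Finset.mem_univ m)
  simpa [vecMulVec_apply] using h4

/-- The contribution of user `k` to the objective. -/
noncomputable def oterm : ℝ :=
  (((p.A b U V S k)ᴴ * (p.B b U V S k)⁻¹ * p.A b U V S k).trace).re

theorem f_eq_sum_oterm : p.f b U V S = ∑ k, p.oterm b U V S k := rfl

/-- Completion of the square in `Γ_k`. -/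
theorem oterm_sub_fterm (hB : IsUnit (p.B b U V S k).det) :
    p.oterm b U V S k - p.fterm b U V S G k
      = ((((p.B b U V S k)⁻¹ * p.A b U V S k - G k)ᴴ * p.B b U V S k
        * ((p.B b U V S k)⁻¹ * p.A b U V S k - G k)).trace).re := by
  have hH := p.B_isHermitian b U V S k
  have hH' : ((p.B b U V S k)⁻¹)ᴴ = (p.B b U V S k)⁻¹ := hH.inv.eq
  rw [oterm, fterm]
  generalize p.B b U V S k = B at *
  generalize p.A b U V S k = A at *
  have e1 : (B⁻¹ * A - G k)ᴴ * B * (B⁻¹ * A - G k)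
      = Aᴴ * B⁻¹ * A - Aᴴ * G k - (G k)ᴴ * A + (G k)ᴴ * B * G k := by
    rw [conjTranspose_sub, conjTranspose_mul, hH', Matrix.sub_mul, Matrix.sub_mul, Matrix.mul_sub,
      Matrix.mul_sub, Matrix.nonsing_inv_mul_cancel_right _ _ hB, Matrix.mul_assoc (G k)ᴴ B (B⁻¹ * A),
      Matrix.mul_nonsing_inv_cancel_left _ _ hB, ← Matrix.mul_assoc]
    abel
  have e2 : ((G k)ᴴ * A).trace.re = (Aᴴ * G k).trace.re := by
    have : (G k)ᴴ * A = (Aᴴ * G k)ᴴ := by rw [conjTranspose_mul, conjTranspose_conjTranspose]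
    rw [this, trace_conjTranspose]; simp
  rw [e1]
  simp only [trace_add, trace_sub, Complex.add_re, Complex.sub_re, e2]
  ring

theorem re_trace_conjTranspose_mul_le {m n : Type*} [Fintype m] [Fintype n] (D X : Matrix m n ℂ)
    {c : ℝ} (hc : 0 < c) : (Dᴴ * X).trace.re
      ≤ c / 2 * ∑ l, ∑ j, ‖D l j‖ ^ 2 + 1 / (2 * c) * ∑ l, ∑ j, ‖X l j‖ ^ 2 := by
  simp only [Matrix.trace, diag_apply, Matrix.mul_apply, conjTranspose_apply, Complex.re_sum,
    Finset.mul_sum, ← Finset.sum_add_distrib]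
  rw [Finset.sum_comm]
  refine Finset.sum_le_sum fun l _ => Finset.sum_le_sum fun j _ => ?_
  have h1 : (star (D l j) * X l j).re ≤ ‖D l j‖ * ‖X l j‖ :=
    (Complex.re_le_norm _).trans (by simp)
  have h2 : c / 2 * ‖D l j‖ ^ 2 + 1 / (2 * c) * ‖X l j‖ ^ 2 - ‖D l j‖ * ‖X l j‖
      = (c * ‖D l j‖ - ‖X l j‖) ^ 2 / (2 * c) := by field_simp; ring
  have h3 : 0 ≤ (c * ‖D l j‖ - ‖X l j‖) ^ 2 / (2 * c) := by positivity
  linarith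

/-- The gap between the objective and its minorant, bounded by the residual `A_k - B_k G_k`. -/
theorem oterm_gap (hb : ∀ n, 0 ≤ p.β (b n) ∧ p.β (b n) ≤ 1) (hq : 0 < p.qpow b U V k) :
    (p.σ ^ 2 * p.qpow b U V k
        * ∑ l, ∑ m, ‖((p.B b U V S k)⁻¹ * p.A b U V S k - G k) l m‖ ^ 2
      ≤ p.oterm b U V S k - p.fterm b U V S G k) ∧
    p.oterm b U V S k - p.fterm b U V S G k
      ≤ 1 / (p.σ ^ 2 * p.qpow b U V k)
        * ∑ l, ∑ m, ‖(p.A b U V S k - p.B b U V S k * G k) l m‖ ^ 2 := by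
  have hB := p.isUnit_det_B b U V S k hb hq
  rw [oterm_sub_fterm _ _ _ _ _ _ _ hB]
  have hc : 0 < p.σ ^ 2 * p.qpow b U V k := mul_pos (pow_pos p.σ_pos 2) hq
  set D := (p.B b U V S k)⁻¹ * p.A b U V S k - G k with hD
  have hBD : p.B b U V S k * D = p.A b U V S k - p.B b U V S k * G k := by
    rw [hD, Matrix.mul_sub, Matrix.mul_nonsing_inv_cancel_left _ _ hB]
  have h1 := p.B_lower_bound b U V S k hb D
  refine ⟨h1, ?_⟩
  -- Young's inequality with the weight `c = σ² q_k`: by `h1`, the part `c/2 ‖D‖²` is at most half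
  -- of `tr (Dᴴ B_k D)` and is absorbed on the left.
  have h2 := re_trace_conjTranspose_mul_le D (p.B b U V S k * D) hc
  rw [← Matrix.mul_assoc] at h2
  rw [hBD] at h2
  have h3 : 1 / (2 * (p.σ ^ 2 * p.qpow b U V k)) = 1 / 2 * (1 / (p.σ ^ 2 * p.qpow b U V k)) := by
    field_simp
  rw [h3] at h2
  nlinarith

variable {b U V k} in
theorem qpow_pos (hb : ∀ n, 0 < p.β (b n) ∧ p.β (b n) < 1) (hU : ∀ n, 0 < ∑ m, ‖U n m‖ ^ 2)
    (hV : V k ≠ 0) : 0 < p.qpow b U V k := by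
  obtain ⟨n, hn⟩ := Function.ne_iff.1 hV
  refine Finset.sum_pos' (fun n _ => ?_) ⟨n, Finset.mem_univ n, ?_⟩
  · have h1 := (hb n).1
    have h2 : 0 < 1 - p.β (b n) := sub_pos.2 (hb n).2
    positivity
  · have h1 := (hb n).1
    have h2 : 0 < 1 - p.β (b n) := sub_pos.2 (hb n).2
    have h3 := hU n
    have h4 : 0 < ‖V k n‖ := norm_pos_iff.2 hn
    positivity

theorem analogSet_row {U : Fin N → Fin M → ℂ} (hU : U ∈ analogSet N M) (hM : M ≠ 0) (n : Fin N) :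
    ∑ m, ‖U n m‖ ^ 2 = 1 := by
  have hM' : (0 : ℝ) < M := by exact_mod_cast Nat.pos_of_ne_zero hM
  simp only [hU n, div_pow, Real.sq_sqrt hM'.le]
  simp
  field_simp

theorem bitSet_β {b : Fin N → ℝ} (hb : b ∈ p.bitSet) (n : Fin N) :
    0 < p.β (b n) ∧ p.β (b n) < 1 := p.β_mem n (b n) (hb.1 n)

theorem bitSet_β' {b : Fin N → ℝ} (hb : b ∈ p.bitSet) (n : Fin N) :
    0 ≤ p.β (b n) ∧ p.β (b n) ≤ 1 := ⟨(p.bitSet_β hb n).1.le, (p.bitSet_β hb n).2.le⟩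

variable {b U V k} in
theorem qpow_pos_of_feasible (hb : b ∈ p.bitSet) (hU : U ∈ analogSet N M) (hM : M ≠ 0)
    (hV : V k ≠ 0) : 0 < p.qpow b U V k :=
  p.qpow_pos (p.bitSet_β hb) (fun n => by rw [analogSet_row hU hM]; norm_num) hV

theorem oterm_eq_zero (h : V k = 0 ∨ M = 0) : p.oterm b U V S k = 0 := by
  rw [oterm, p.A_eq_zero b U V S h]; simp

variable {b U} in
theorem f₀_le_obj (hb : b ∈ p.bitSet) (hU : U ∈ analogSet N M) :
    p.f₀ b U V S G ≤ p.f b U V S := by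
  refine Finset.sum_le_sum fun k _ => ?_
  change p.fterm b U V S G k ≤ p.oterm b U V S k
  by_cases h : V k = 0 ∨ M = 0
  · rw [p.fterm_eq_zero_of_combiner _ _ _ _ _ h, p.oterm_eq_zero _ _ _ _ _ h]
  · push Not at h
    have hq := p.qpow_pos_of_feasible hb hU h.2 h.1
    have := (p.oterm_gap b U V S G k (p.bitSet_β' hb) hq).1
    have h2 : 0 ≤ p.σ ^ 2 * p.qpow b U V k
        * ∑ l, ∑ m, ‖((p.B b U V S k)⁻¹ * p.A b U V S k - G k) l m‖ ^ 2 := by positivity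
    linarith

variable {b U} in
-- A user with `v_k = 0` has a singular `B_k`, but contributes zero on both sides, so no assumption
-- on the combiners is needed.
theorem f₀_Γopt (hb : b ∈ p.bitSet) (hU : U ∈ analogSet N M) :
    p.f₀ b U V S (p.Γopt (b, U, V, S)) = p.f b U V S := by
  refine Finset.sum_congr rfl fun k _ => ?_
  change p.fterm b U V S _ k = p.oterm b U V S k
  by_cases h : V k = 0 ∨ M = 0
  · rw [p.fterm_eq_zero_of_combiner _ _ _ _ _ h, p.oterm_eq_zero _ _ _ _ _ h]
  · push Not at h
    have hq := p.qpow_pos_of_feasible hb hU h.2 h.1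
    have h1 := p.oterm_sub_fterm b U V S (p.Γopt (b, U, V, S)) k
      (p.isUnit_det_B b U V S k (p.bitSet_β' hb) hq)
    simp only [Γopt, sub_self, Matrix.mul_zero, trace_zero, Complex.zero_re] at h1
    exact (sub_eq_zero.1 h1).symm

end Objective
end System
end PilotDesign

/-! ### Real `C²` smoothness of `f₀` in all variables jointly -/

namespace PilotDesign
open Matrix
namespace System

variable {K M N τ : ℕ} (p : System K M N)

section Smoothness

/-- The space of the optimization variables together with the auxiliary variables. -/
abbrev JointPoint (K M N τ : ℕ) : Type := Point K M N τ × (Fin K → Fin τ → Fin M → ℂ)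

variable {E : Type*} [NormedAddCommGroup E] [NormedSpace ℝ E]

@[fun_prop]
theorem contDiff_star_comp {f : E → ℂ} (hf : ContDiff ℝ 2 f) :
    ContDiff ℝ 2 fun e => star (f e) :=
  Complex.conjCLE.contDiff.comp hf

@[fun_prop]
theorem contDiff_re_comp {f : E → ℂ} (hf : ContDiff ℝ 2 f) :
    ContDiff ℝ 2 fun e => (f e).re :=
  Complex.reCLM.contDiff.comp hf

@[fun_prop]
theorem contDiff_β_comp {f : E → ℝ} (hf : ContDiff ℝ 2 f) :
    ContDiff ℝ 2 fun e => ((p.β (f e) : ℝ) : ℂ) :=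
  Complex.ofRealCLM.contDiff.comp (p.β_contDiff.comp hf)

variable {b : E → Fin N → ℝ} {U : E → Fin N → Fin M → ℂ} {V : E → Fin K → Fin N → ℂ}
  {S : E → Fin K → Fin τ → ℂ} {G : E → Fin K → Matrix (Fin τ) (Fin M) ℂ}

theorem contDiff_x (hb : ContDiff ℝ 2 b) (hU : ContDiff ℝ 2 U) (hV : ContDiff ℝ 2 V) (k : Fin K)
    (m : Fin M) : ContDiff ℝ 2 fun e => p.x (b e) (U e) (V e) k m := by
  simp only [x, Qα, vecMul, dotProduct, diagonal_mul, of_apply]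
  push_cast
  fun_prop

theorem contDiff_xRx (hb : ContDiff ℝ 2 b) (hU : ContDiff ℝ 2 U) (hV : ContDiff ℝ 2 V)
    (k i : Fin K) : ContDiff ℝ 2 fun e => p.xRx (b e) (U e) (V e) k i := by
  have h := p.contDiff_x hb hU hV k
  simp only [xRx, dotProduct, mulVec, Pi.star_apply]
  fun_prop

theorem contDiff_vQv (hb : ContDiff ℝ 2 b) (hV : ContDiff ℝ 2 V) (k : Fin K)
    {X : E → Matrix (Fin N) (Fin N) ℂ} (hX : ∀ n, ContDiff ℝ 2 fun e => X e n n) :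
    ContDiff ℝ 2 fun e => p.vQv (b e) (V e) k (X e) := by
  simp only [vQv, Q, Qα, diagonal_mul_diagonal, vecMul_diagonal, dotProduct, diag_apply,
    Pi.star_apply]
  push_cast
  fun_prop

theorem contDiff_C (hU : ContDiff ℝ 2 U) (i : Fin K) (n : Fin N) :
    ContDiff ℝ 2 fun e => p.C (U e) i n n := by
  simp only [C, Matrix.mul_apply, of_apply, conjTranspose_apply]
  fun_prop

theorem contDiff_gram (hU : ContDiff ℝ 2 U) (n : Fin N) :
    ContDiff ℝ 2 fun e => (Matrix.of (U e) * (Matrix.of (U e))ᴴ) n n := by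
  simp only [Matrix.mul_apply, of_apply, conjTranspose_apply]
  fun_prop

theorem contDiff_A (hb : ContDiff ℝ 2 b) (hU : ContDiff ℝ 2 U) (hV : ContDiff ℝ 2 V)
    (hS : ContDiff ℝ 2 S) (k : Fin K) (l : Fin τ) (m : Fin M) :
    ContDiff ℝ 2 fun e => p.A (b e) (U e) (V e) (S e) k l m := by
  have h := p.contDiff_x hb hU hV k
  simp only [A, vecMulVec_apply, vecMul, dotProduct]
  fun_prop

theorem contDiff_B (hb : ContDiff ℝ 2 b) (hU : ContDiff ℝ 2 U) (hV : ContDiff ℝ 2 V)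
    (hS : ContDiff ℝ 2 S) (k : Fin K) (l l' : Fin τ) :
    ContDiff ℝ 2 fun e => p.B (b e) (U e) (V e) (S e) k l l' := by
  have h := p.contDiff_x hb hU hV k
  have h1 := p.contDiff_xRx hb hU hV k
  have h2 := p.contDiff_C hU
  have h3 := contDiff_gram hU
  have h4 : ∀ l, ContDiff ℝ 2 fun e => p.vQv (b e) (V e) k
      (∑ i, (S e i l * star (S e i l)) • p.C (U e) i
          + (p.σ : ℂ) ^ 2 • (Matrix.of (U e) * (Matrix.of (U e))ᴴ)) := by
    intro l
    refine p.contDiff_vQv hb hV k fun n => ?_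
    simp only [Matrix.add_apply, Matrix.sum_apply, Matrix.smul_apply, smul_eq_mul]
    exact (ContDiff.sum fun i _ => ContDiff.mul (by fun_prop) (h2 i n)).add
      (contDiff_const.mul (h3 n))
  simp only [B, Matrix.add_apply, Matrix.sum_apply, Matrix.smul_apply, smul_eq_mul]
  refine (ContDiff.add (ContDiff.sum fun i _ => (h1 i).mul ?_) (ContDiff.mul ?_ contDiff_const)).add ?_
  · simp only [vecMulVec_apply, Pi.star_apply]; fun_prop
  · simp only [dotProduct, Pi.star_apply]; fun_prop
  · by_cases hl : l = l'
    · subst hl; simpa only [diagonal_apply_eq] using h4 l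
    · simpa only [diagonal_apply_ne _ hl] using contDiff_const

theorem contDiff_f₀_comp (hb : ContDiff ℝ 2 b) (hU : ContDiff ℝ 2 U) (hV : ContDiff ℝ 2 V)
    (hS : ContDiff ℝ 2 S) (hG : ∀ k l m, ContDiff ℝ 2 fun e => G e k l m) :
    ContDiff ℝ 2 fun e => p.f₀ (b e) (U e) (V e) (S e) (G e) := by
  have h1 := p.contDiff_A hb hU hV hS
  have h2 := p.contDiff_B hb hU hV hS
  simp only [f₀, Matrix.trace, diag_apply, Matrix.mul_apply, conjTranspose_apply]
  fun_prop

/-- `f₀` as a function of all variables. -/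
noncomputable def f₀joint (ξ : JointPoint K M N τ) : ℝ :=
  p.f₀ ξ.1.1 ξ.1.2.1 ξ.1.2.2.1 ξ.1.2.2.2 ξ.2

theorem contDiff_f₀joint : ContDiff ℝ 2 (p.f₀joint (τ := τ)) :=
  p.contDiff_f₀_comp (by fun_prop) (by fun_prop) (by fun_prop) (by fun_prop)
    fun k l m => by fun_prop

end Smoothness
end System
end PilotDesign

/-! ### Compactness: normalization, boundedness of `f`, and the constant `ζ₀` -/

namespace PilotDesign
open Matrix Filter Topology

/-- Second-order Taylor bound for a `C²` function on a ball. -/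
theorem exists_taylor_bound {E : Type*} [NormedAddCommGroup E] [NormedSpace ℝ E]
    [FiniteDimensional ℝ E] {F : E → ℝ} (hF : ContDiff ℝ 2 F) (r : ℝ) :
    ∃ L : ℝ, 0 ≤ L ∧ ∀ x ∈ Metric.closedBall (0 : E) r, ∀ y ∈ Metric.closedBall (0 : E) r,
      |F y - F x - fderiv ℝ F x (y - x)| ≤ L * ‖y - x‖ ^ 2 := by
  have hF1 : ContDiff ℝ 1 (fderiv ℝ F) := hF.fderiv_right (by norm_num)
  have hF2 : Continuous (fderiv ℝ (fderiv ℝ F)) := hF1.continuous_fderiv (by norm_num)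
  obtain ⟨C, hC⟩ := IsCompact.exists_bound_of_continuousOn
    (f := fderiv ℝ (fderiv ℝ F)) (isCompact_closedBall (0 : E) r) hF2.continuousOn
  -- The bound `C` may be negative if the ball is empty.
  refine ⟨max C 0, le_max_right _ _, fun x hx y hy => ?_⟩
  have hlip : ∀ z ∈ Metric.closedBall (0 : E) r,
      ‖fderiv ℝ F z - fderiv ℝ F x‖ ≤ max C 0 * ‖z - x‖ := fun z hz =>
    (convex_closedBall (0 : E) r).norm_image_sub_le_of_norm_fderiv_le
      (fun u _ => hF1.differentiable (by norm_num) u)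
      (fun u hu => (hC u hu).trans (le_max_left _ _)) hx hz
  have hseg : segment ℝ x y ⊆ Metric.closedBall (0 : E) r :=
    (convex_closedBall (0 : E) r).segment_subset hx hy
  have := (convex_segment (𝕜 := ℝ) x y).norm_image_sub_le_of_norm_fderiv_le'
    (f := F) (φ := fderiv ℝ F x) (C := max C 0 * ‖y - x‖)
    (fun u _ => hF.differentiable (by norm_num) u)
    (fun u hu => (hlip u (hseg hu)).trans (mul_le_mul_of_nonneg_left ?_ (le_max_right _ _)))
    (left_mem_segment ℝ x y) (right_mem_segment ℝ x y)
  · rw [Real.norm_eq_abs] at this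
    rw [sq, ← mul_assoc]; exact this
  · obtain ⟨s, t, hs, ht, hst, rfl⟩ := hu
    have : s • x + t • y - x = t • (y - x) := by
      rw [← eq_sub_iff_add_eq] at hst; subst hst; module
    rw [this, norm_smul, Real.norm_of_nonneg ht]
    exact mul_le_of_le_one_left (norm_nonneg _) (by linarith)

namespace System

variable {K M N τ : ℕ} (p : System K M N)

section Compactness

theorem isCompact_bitSet : IsCompact p.bitSet := by
  have : p.bitSet = Set.Icc p.bmin p.bmax ∩ {b | ∑ n, b n ≤ N * p.bavg} := by
    ext b
    simp only [bitSet, Set.mem_ofPred_eq, Set.mem_inter_iff, Set.mem_Icc, Pi.le_def, forall_and]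
  rw [this]
  exact isCompact_Icc.inter_right (isClosed_le (by fun_prop) continuous_const)

theorem isCompact_analogSet : IsCompact (analogSet N M) := by
  refine Metric.isCompact_of_isClosed_isBounded ?_ ?_
  · simp only [analogSet, Set.ofPred_forall]
    exact isClosed_iInter fun n => isClosed_iInter fun m =>
      isClosed_eq (by fun_prop) continuous_const
  · refine Metric.isBounded_iff_subset_closedBall 0 |>.2 ⟨1 / Real.sqrt M, fun U hU => ?_⟩
    rw [mem_closedBall_zero_iff]
    refine (pi_norm_le_iff_of_nonneg (by positivity)).2 fun n =>
      (pi_norm_le_iff_of_nonneg (by positivity)).2 fun m => (hU n m).le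

theorem isCompact_pilotSet : IsCompact (p.pilotSet τ) := by
  refine Metric.isCompact_of_isClosed_isBounded ?_ ?_
  · simp only [pilotSet, Set.ofPred_forall]
    exact isClosed_iInter fun k => isClosed_le (by fun_prop) continuous_const
  · refine Metric.isBounded_iff_subset_closedBall 0 |>.2 ⟨∑ k, Real.sqrt (p.Pmax k), fun S hS => ?_⟩
    rw [mem_closedBall_zero_iff]
    refine (pi_norm_le_iff_of_nonneg (by positivity)).2 fun k =>
      (pi_norm_le_iff_of_nonneg (by positivity)).2 fun l => ?_
    have h1 : ‖S k l‖ ^ 2 ≤ p.Pmax k :=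
      (Finset.single_le_sum (f := fun l => ‖S k l‖ ^ 2) (fun l _ => by positivity)
        (Finset.mem_univ l)).trans (hS k)
    exact (Real.le_sqrt_of_sq_le h1).trans
      (Finset.single_le_sum (f := fun k => Real.sqrt (p.Pmax k))
        (fun k _ => Real.sqrt_nonneg _) (Finset.mem_univ k))

theorem convex_pilotSet_midpoint {S S' : Fin K → Fin τ → ℂ} (hS : S ∈ p.pilotSet τ)
    (hS' : S' ∈ p.pilotSet τ) : (fun k => (1 / 2 : ℂ) • (S k + S' k)) ∈ p.pilotSet τ := by
  intro k
  have h : ∀ l, ‖((1 / 2 : ℂ) • (S k + S' k)) l‖ ^ 2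
      ≤ 1 / 2 * ‖S k l‖ ^ 2 + 1 / 2 * ‖S' k l‖ ^ 2 := by
    intro l
    have h1 : ‖((1 / 2 : ℂ) • (S k + S' k)) l‖ ≤ 1 / 2 * (‖S k l‖ + ‖S' k l‖) := by
      simp only [Pi.smul_apply, Pi.add_apply, smul_eq_mul, norm_mul]
      rw [show ‖(1 / 2 : ℂ)‖ = 1 / 2 by simp]
      exact mul_le_mul_of_nonneg_left (norm_add_le _ _) (by norm_num)
    have h2 := norm_nonneg (((1 / 2 : ℂ) • (S k + S' k)) l)
    nlinarith [sq_nonneg (‖S k l‖ - ‖S' k l‖)]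
  refine (Finset.sum_le_sum fun l _ => h l).trans ?_
  rw [Finset.sum_add_distrib, ← Finset.mul_sum, ← Finset.mul_sum]
  have := hS k
  have := hS' k
  linarith

/-- The points of the feasible set whose digital combiner `k` has norm one and whose other digital
combiners have norm at most one. -/
def normalizedSet (τ : ℕ) (k : Fin K) : Set (Point K M N τ) :=
  p.bitSet ×ˢ analogSet N M ×ˢ (Metric.closedBall 0 1 ∩ {V | ‖V k‖ = 1}) ×ˢ p.pilotSet τ

theorem isCompact_normalizedSet (k : Fin K) : IsCompact (p.normalizedSet τ k) :=
  p.isCompact_bitSet.prod (isCompact_analogSet.prod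
    (((isCompact_closedBall _ _).inter_right
      (isClosed_eq (by fun_prop) continuous_const)).prod p.isCompact_pilotSet))

theorem continuous_qpow (k : Fin K) :
    Continuous fun z : Point K M N τ => p.qpow z.1 z.2.1 z.2.2.1 k := by
  have hβ : ∀ n, Continuous fun z : Point K M N τ => p.β (z.1 n) := fun n =>
    p.β_contDiff.continuous.comp (by fun_prop)
  unfold qpow
  exact continuous_finsetSum _ fun n _ => (((continuous_const.sub (hβ n)).mul (hβ n)).mul
    (by fun_prop)).mul (by fun_prop)

theorem continuous_B (k : Fin K) :
    Continuous fun z : Point K M N τ => p.B z.1 z.2.1 z.2.2.1 z.2.2.2 k :=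
  continuous_matrix fun l l' => (p.contDiff_B (b := fun z : Point K M N τ => z.1)
    (U := fun z => z.2.1) (V := fun z => z.2.2.1) (S := fun z => z.2.2.2)
    (by fun_prop) (by fun_prop) (by fun_prop) (by fun_prop) k l l').continuous

theorem continuous_A (k : Fin K) :
    Continuous fun z : Point K M N τ => p.A z.1 z.2.1 z.2.2.1 z.2.2.2 k :=
  continuous_matrix fun l m => (p.contDiff_A (b := fun z : Point K M N τ => z.1)
    (U := fun z => z.2.1) (V := fun z => z.2.2.1) (S := fun z => z.2.2.2)
    (by fun_prop) (by fun_prop) (by fun_prop) (by fun_prop) k l m).continuous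

theorem continuousAt_inv_mul {X m n : Type*} [TopologicalSpace X] [Fintype m] [DecidableEq m]
    {B : X → Matrix m m ℂ} {A : X → Matrix m n ℂ} (hB : Continuous B) (hA : Continuous A) {w : X}
    (h : IsUnit (B w).det) : ContinuousAt (fun z => (B z)⁻¹ * A z) w := by
  have h0 : ContinuousAt (fun z => (B z)⁻¹) w := by
    simp only [Matrix.inv_def, Ring.inverse_eq_inv']
    have h1 : ContinuousAt (fun z => (B z).det⁻¹) w := hB.matrix_det.continuousAt.inv₀ h.ne_zero
    have h2 : ContinuousAt (fun z => (B z).adjugate) w := hB.matrix_adjugate.continuousAt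
    exact h1.smul h2
  refine continuousAt_pi.2 fun i => continuousAt_pi.2 fun j => ?_
  simp only [Matrix.mul_apply]
  exact tendsto_finsetSum _ fun l _ => ((continuousAt_pi.1 (continuousAt_pi.1 h0 i) l).mul
    (hA.matrix_elem l j).continuousAt)

theorem continuousAt_Γopt {w : Point K M N τ} {k : Fin K}
    (hB : IsUnit (p.B w.1 w.2.1 w.2.2.1 w.2.2.2 k).det) :
    ContinuousAt (fun z : Point K M N τ => p.Γopt z k) w :=
  continuousAt_inv_mul (p.continuous_B k) (p.continuous_A k) hB

theorem isUnit_B_of_feasible {b : Fin N → ℝ} {U : Fin N → Fin M → ℂ} {V : Fin K → Fin N → ℂ}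
    (S : Fin K → Fin τ → ℂ) {k : Fin K}
    (hb : b ∈ p.bitSet) (hU : U ∈ analogSet N M) (hM : M ≠ 0)
    (hV : V k ≠ 0) : IsUnit (p.B b U V S k).det :=
  p.isUnit_det_B b U V S k (p.bitSet_β' hb) (p.qpow_pos_of_feasible hb hU hM hV)

theorem Γopt_rescale {c : Fin K → ℂ} {k : Fin K} (hc : c k ≠ 0) (z : Point K M N τ) :
    p.Γopt (rescale c z) k = (star (c k))⁻¹ • p.Γopt z k := by
  have hc' : star (c k) ≠ 0 := by simpa using hc
  have hd : c k * star (c k) ≠ 0 := mul_ne_zero hc hc'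
  simp only [Γopt, rescale, A_smul, B_smul]
  generalize p.B z.1 z.2.1 z.2.2.1 z.2.2.2 k = B
  generalize p.A z.1 z.2.1 z.2.2.1 z.2.2.2 k = A
  by_cases hB : IsUnit B.det
  · have := Matrix.inv_smul' (A := B) (Units.mk0 _ hd) hB
    rw [Units.smul_def, Units.smul_def, Units.val_mk0, Units.val_inv_eq_inv_val, Units.val_mk0] at this
    rw [this, Matrix.smul_mul, Matrix.mul_smul, smul_smul]
    congr 1
    field_simp
  -- A singular `B_k` stays singular after scaling, and both inverses are zero by convention.
  · have hB' : ¬ IsUnit ((c k * star (c k)) • B).det := by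
      rw [isUnit_iff_ne_zero, not_not] at hB ⊢
      rw [det_smul, hB, mul_zero]
    rw [nonsing_inv_apply_not_isUnit _ hB, nonsing_inv_apply_not_isUnit _ hB']
    simp

theorem f₀_eq_zero (b : Fin N → ℝ) (U : Fin N → Fin M → ℂ) (V : Fin K → Fin N → ℂ)
    (S : Fin K → Fin τ → ℂ) (G : Fin K → Matrix (Fin τ) (Fin M) ℂ) (hM : M = 0) :
    p.f₀ b U V S G = 0 :=
  Finset.sum_eq_zero fun _ _ => p.fterm_eq_zero_of_combiner b U V S G (Or.inr hM)

/-- Up to the scale invariance of `f₀`, feasible points and their optimal auxiliary variables stay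
in a bounded set. -/
theorem exists_normalization (τ : ℕ) : ∃ r : ℝ, ∀ z ∈ p.feasibleSet τ, ∃ V G,
    (∀ b ∈ p.bitSet, (((b, z.2.1, V, z.2.2.2), G) : JointPoint K M N τ)
      ∈ Metric.closedBall (0 : JointPoint K M N τ) r) ∧
    ∀ b U S, p.f₀ b U V S G = p.f₀ b U z.2.2.1 S (p.Γopt z) := by
  by_cases hM : M = 0
  · subst hM
    obtain ⟨r, hr⟩ := (p.isCompact_bitSet.prod (isCompact_analogSet.prod
      (isCompact_singleton (x := (0 : Fin K → Fin N → ℂ)) |>.prod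
        (p.isCompact_pilotSet (τ := τ))))).isBounded.subset_closedBall 0
    refine ⟨max r 0, fun z hz => ⟨0, 0, fun b hb => ?_, fun b U S => ?_⟩⟩
    · have := hr (show (b, z.2.1, (0 : Fin K → Fin N → ℂ), z.2.2.2) ∈ _ from
        ⟨hb, hz.2.1, rfl, hz.2.2⟩)
      rw [mem_closedBall_zero_iff] at this ⊢
      rw [Prod.norm_def, norm_zero]
      exact max_le_max this le_rfl
    · exact (p.f₀_eq_zero b U 0 S 0 rfl).trans (p.f₀_eq_zero b U _ S _ rfl).symm
  -- On the normalized set `v_k` has norm one, so `B_k` is invertible and `Γ_k = B_k⁻¹ A_k` depends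
  -- continuously on the point. Compactness bounds its entries.
  have hbd : ∀ k l m, ∃ C, ∀ z ∈ p.normalizedSet τ k, ‖p.Γopt z k l m‖ ≤ C := by
    intro k l m
    refine (p.isCompact_normalizedSet k).exists_bound_of_continuousOn fun z hz => ?_
    have hV : z.2.2.1 k ≠ 0 := by
      intro h
      have := hz.2.2.1.2
      simp [h] at this
    have := p.continuousAt_Γopt (p.isUnit_B_of_feasible z.2.2.2 hz.1 hz.2.1 hM hV)
    exact ((continuous_apply_apply l m).continuousAt.comp this).continuousWithinAt
  choose C hC using hbd
  obtain ⟨r, hr⟩ := (p.isCompact_bitSet.prod (isCompact_analogSet.prod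
      ((isCompact_closedBall (0 : Fin K → Fin N → ℂ) 1) |>.prod
        (p.isCompact_pilotSet (τ := τ))))).isBounded.subset_closedBall 0
  refine ⟨max r (∑ k, ∑ l, ∑ m, max (C k l m) 0), fun z hz => ?_⟩
  let c : Fin K → ℂ := fun k => if z.2.2.1 k = 0 then 1 else ((‖z.2.2.1 k‖⁻¹ : ℝ) : ℂ)
  have hc : ∀ k, c k ≠ 0 := by
    intro k
    by_cases h : z.2.2.1 k = 0 <;> simp [c, h]
  have hn : ∀ k, z.2.2.1 k ≠ 0 → ‖c k • z.2.2.1 k‖ = 1 := by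
    intro k h
    simp only [c, h, if_false, norm_smul, Complex.norm_real, norm_inv, norm_norm]
    exact inv_mul_cancel₀ (norm_ne_zero_iff.2 h)
  have hn' : ∀ k, ‖c k • z.2.2.1 k‖ ≤ 1 := by
    intro k
    by_cases h : z.2.2.1 k = 0
    · simp [h]
    · exact (hn k h).le
  have hball : (fun k => c k • z.2.2.1 k) ∈ Metric.closedBall (0 : Fin K → Fin N → ℂ) 1 := by
    rw [mem_closedBall_zero_iff]
    exact (pi_norm_le_iff_of_nonneg zero_le_one).2 hn'
  have hterm : ∀ k l m, 0 ≤ max (C k l m) 0 := fun _ _ _ => le_max_right _ _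
  have hsum : ∀ k l m, max (C k l m) 0 ≤ ∑ k, ∑ l, ∑ m, max (C k l m) 0 := by
    intro k l m
    refine le_trans ?_ (Finset.single_le_sum (f := fun k => ∑ l, ∑ m, max (C k l m) 0)
      (fun k _ => Finset.sum_nonneg fun l _ => Finset.sum_nonneg fun m _ => hterm k l m)
      (Finset.mem_univ k))
    refine le_trans ?_ (Finset.single_le_sum (f := fun l => ∑ m, max (C k l m) 0)
      (fun l _ => Finset.sum_nonneg fun m _ => hterm k l m) (Finset.mem_univ l))
    exact Finset.single_le_sum (f := fun m => max (C k l m) 0) (fun m _ => hterm k l m)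
      (Finset.mem_univ m)
  refine ⟨fun k => c k • z.2.2.1 k, fun k => p.Γopt (rescale c z) k, fun b hb => ?_,
    fun b U S => ?_⟩
  · have h1 := hr (show (b, z.2.1, (fun k => c k • z.2.2.1 k), z.2.2.2) ∈ _ from
        ⟨hb, hz.2.1, hball, hz.2.2⟩)
    rw [mem_closedBall_zero_iff] at h1 ⊢
    rw [Prod.norm_def]
    refine max_le_max h1 ?_
    have h0 : 0 ≤ ∑ k, ∑ l, ∑ m, max (C k l m) 0 := Finset.sum_nonneg fun k _ =>
      Finset.sum_nonneg fun l _ => Finset.sum_nonneg fun m _ => hterm k l m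
    refine (pi_norm_le_iff_of_nonneg h0).2 fun k => (pi_norm_le_iff_of_nonneg h0).2 fun l =>
      (pi_norm_le_iff_of_nonneg h0).2 fun m => ?_
    by_cases h : z.2.2.1 k = 0
    -- A zero combiner cannot be normalized, but then `A_k = 0` and its auxiliary matrix is zero as
    -- well.
    · have : p.Γopt (rescale c z) k = 0 := by
        rw [Γopt, p.A_eq_zero _ _ _ _ (Or.inl (by simp [rescale, h])), Matrix.mul_zero]
      change ‖p.Γopt (rescale c z) k l m‖ ≤ _
      rw [this]; simpa using h0
    · exact (hC k l m (rescale c z) ⟨hz.1, hz.2.1, ⟨hball, hn k h⟩, hz.2.2⟩).trans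
        ((le_max_left _ _).trans (hsum k l m))
  · rw [← p.f₀_smul b U z.2.2.1 S (p.Γopt z) hc]
    congr 1
    ext1 k
    exact p.Γopt_rescale (hc k) z

theorem obj_eq_f₀ {z : Point K M N τ} (hz : z ∈ p.feasibleSet τ) :
    p.f₀ z.1 z.2.1 z.2.2.1 z.2.2.2 (p.Γopt z) = p.obj z :=
  p.f₀_Γopt z.2.2.1 z.2.2.2 hz.1 hz.2.1

theorem exists_f₀joint_le (τ : ℕ) (r : ℝ) :
    ∃ C, ∀ ξ ∈ Metric.closedBall (0 : JointPoint K M N τ) r, p.f₀joint ξ ≤ C := by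
  have h1 : IsCompact (Metric.closedBall (0 : JointPoint K M N τ) r) := isCompact_closedBall _ _
  have h2 : Continuous (p.f₀joint (τ := τ)) := p.contDiff_f₀joint.continuous
  obtain ⟨C, hC⟩ := h1.bddAbove_image h2.continuousOn
  exact ⟨C, fun ξ hξ => hC ⟨ξ, hξ, rfl⟩⟩

theorem f₀joint_eq_obj {z : Point K M N τ} (hz : z ∈ p.feasibleSet τ)
    {V : Fin K → Fin N → ℂ} {G : Fin K → Fin τ → Fin M → ℂ}
    (h : ∀ b U S, p.f₀ b U V S G = p.f₀ b U z.2.2.1 S (p.Γopt z)) :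
    p.f₀joint ((z.1, z.2.1, V, z.2.2.2), G) = p.obj z := by
  rw [← p.obj_eq_f₀ hz]
  exact h _ _ _

/-- The value of `f` at a feasible point is a value of `f₀` on the normalizing ball, where the
continuous function `f₀` is bounded. -/
theorem exists_obj_le (τ : ℕ) : ∃ C : ℝ, ∀ z ∈ p.feasibleSet τ, p.obj z ≤ C := by
  obtain ⟨r, hr⟩ := p.exists_normalization τ
  obtain ⟨C, hC⟩ := p.exists_f₀joint_le τ r
  refine ⟨C, fun z hz => ?_⟩
  obtain ⟨V, G, h1, h2⟩ := hr z hz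
  rw [← p.f₀joint_eq_obj hz h2]
  exact hC _ (h1 z.1 hz.1)

/-- Expressing the gradient in the bits through the joint derivative makes it subject to the uniform
Taylor bound, and jointly continuous when limits are taken. -/
theorem hasFDerivAt_bits (b : Fin N → ℝ) (U : Fin N → Fin M → ℂ) (V : Fin K → Fin N → ℂ)
    (S : Fin K → Fin τ → ℂ) (G : Fin K → Fin τ → Fin M → ℂ) :
    HasFDerivAt (fun b' => p.f₀ b' U V S G)
      ((fderiv ℝ (p.f₀joint (τ := τ)) ((b, U, V, S), G)).comp
        ((ContinuousLinearMap.inl ℝ _ _).comp (ContinuousLinearMap.inl ℝ _ _))) b := by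
  have h1 : HasFDerivAt (p.f₀joint (τ := τ)) _ ((b, U, V, S), G) :=
    (p.contDiff_f₀joint.differentiable (by norm_num) _).hasFDerivAt
  have h2 := (hasFDerivAt_prodMk_left (𝕜 := ℝ) ((b, U, V, S) : Point K M N τ) G).comp b
    (hasFDerivAt_prodMk_left (𝕜 := ℝ) b (U, V, S))
  exact h1.comp b h2

/-- The concave surrogates minorize, uniformly over the feasible set. -/
theorem exists_surrogate_le (τ : ℕ) : ∃ L : ℝ, 0 ≤ L ∧ ∀ z ∈ p.feasibleSet τ,
    ∀ b ∈ p.bitSet, ∀ b' ∈ p.bitSet,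
      surrogate L (fun b => p.f₀ b z.2.1 z.2.2.1 z.2.2.2 (p.Γopt z)) b' b
        ≤ p.f₀ b z.2.1 z.2.2.1 z.2.2.2 (p.Γopt z) := by
  obtain ⟨r, hr⟩ := p.exists_normalization τ
  obtain ⟨L, hL0, hL⟩ := exists_taylor_bound (p.contDiff_f₀joint (τ := τ)) r
  refine ⟨L, hL0, fun z hz b hb b' hb' => ?_⟩
  obtain ⟨V, G, h1, h2⟩ := hr z hz
  have h3 := hL _ (h1 b' hb') _ (h1 b hb)
  simp only [← h2, surrogate]
  rw [(p.hasFDerivAt_bits b' z.2.1 V z.2.2.2 G).fderiv]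
  have e : ((b, z.2.1, V, z.2.2.2), G) - ((b', z.2.1, V, z.2.2.2), G)
      = (((b - b', 0, 0, 0), 0) : JointPoint K M N τ) := by
    simp only [Prod.mk_sub_mk, sub_self]; rfl
  rw [e] at h3
  have h4 : ‖(((b - b', 0, 0, 0), 0) : JointPoint K M N τ)‖ = ‖b - b'‖ := by
    simp [Prod.norm_def]
  -- The Taylor bound is in the supremum norm of the product space, the surrogate uses the larger
  -- Euclidean norm.
  have h5 : ‖b - b'‖ ^ 2 ≤ ∑ n, (b n - b' n) ^ 2 := by
    rw [← Real.le_sqrt (norm_nonneg _) (Finset.sum_nonneg fun n _ => sq_nonneg _)]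
    refine (pi_norm_le_iff_of_nonneg (Real.sqrt_nonneg _)).2 fun n => ?_
    refine Real.le_sqrt_of_sq_le ?_
    rw [Real.norm_eq_abs, sq_abs]
    exact Finset.single_le_sum (f := fun n => (b n - b' n) ^ 2) (fun n _ => sq_nonneg _)
      (Finset.mem_univ n)
  rw [h4] at h3
  have h6 := mul_le_mul_of_nonneg_left h5 hL0
  have h7 := (abs_le.1 h3).1
  change _ ≤ p.f₀joint ((b, z.2.1, V, z.2.2.2), G) 
  change p.f₀joint ((b', z.2.1, V, z.2.2.2), G) + fderiv ℝ p.f₀joint ((b', z.2.1, V, z.2.2.2), G)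
    ((b - b', 0, 0, 0), 0) - _ ≤ _
  linarith

end Compactness
end System
end PilotDesign

/-! ### Ascent along a sweep, along the bit update, and along a whole iteration -/

namespace PilotDesign
open Matrix Filter Topology
namespace System

variable {K M N τ : ℕ} (p : System K M N)

section Sweep

variable (b : Fin N → ℝ) (V : Fin K → Fin N → ℂ) (S : Fin K → Fin τ → ℂ)
  (Γ : Fin K → Matrix (Fin τ) (Fin M) ℂ)

theorem two_mul_re_star_mul_sub {a c : ℂ} (h : ‖a‖ = ‖c‖) :
    2 * (star a * (a - c)).re = ‖a - c‖ ^ 2 := by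
  have h1 := Complex.normSq_eq_norm_sq a
  have h2 := Complex.normSq_eq_norm_sq c
  rw [← Complex.normSq_eq_norm_sq]
  rw [h, ← h2] at h1
  simp only [Complex.normSq_apply, RCLike.star_def, Complex.mul_re, Complex.conj_re,
    Complex.conj_im, Complex.sub_re, Complex.sub_im] at h1 ⊢
  linear_combination h1

/-- The gain of an entry update over any other admissible value of the entry. -/
theorem f₀_setEntry_gain {T : Fin N → Fin M → ℂ} {n : Fin N} {m : Fin M} {u₁ u : ℂ}
    (hT : ‖T n m‖ = 1 / Real.sqrt M) (hu₁ : ‖u₁‖ = 1 / Real.sqrt M) (hu : ‖u‖ = 1 / Real.sqrt M)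
    (h : (Real.sqrt M * ‖p.φ b T V S Γ n m‖ : ℝ) * u₁ = p.φ b T V S Γ n m) :
    p.f₀ b (setEntry T n m u) V S Γ + Real.sqrt M * ‖p.φ b T V S Γ n m‖ * ‖u₁ - u‖ ^ 2
      = p.f₀ b (setEntry T n m u₁) V S Γ := by
  rw [p.f₀_setEntry b T V S Γ n m u (by rw [hu, hT]),
    p.f₀_setEntry b T V S Γ n m u₁ (by rw [hu₁, hT])]
  have h2 := two_mul_re_star_mul_sub (hu₁.trans hu.symm)
  have h3 : (star (p.φ b T V S Γ n m) * (u₁ - u)).re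
      = Real.sqrt M * ‖p.φ b T V S Γ n m‖ * (star u₁ * (u₁ - u)).re := by
    conv_lhs => rw [← h]
    rw [star_mul', ← Complex.re_ofReal_mul, mul_assoc]
    simp
  have h4 : (star (p.φ b T V S Γ n m) * (u₁ - T n m)).re
      = (star (p.φ b T V S Γ n m) * (u₁ - u)).re
        + (star (p.φ b T V S Γ n m) * (u - T n m)).re := by
    rw [← Complex.add_re]; congr 1; ring
  rw [h4, h3, ← h2]; ring

/-- The analog combiner in a sweep from `U` to `U₁` after `j` entries have been updated. -/
def sweepStage (U U₁ : Fin N → Fin M → ℂ) (j : ℕ) : Fin N → Fin M → ℂ :=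
  fun n m => if (n : ℕ) * M + m < j then U₁ n m else U n m

/-- The entry `(n, m)` has position `n * M + m` in the sweep, and the order of positions is
lexicographic. This turns the sweep into a sequence indexed by `ℕ`. -/
theorem sweep_position_lt {n n' : Fin N} {m m' : Fin M} :
    (n' : ℕ) * M + m' < n * M + m ↔ n' < n ∨ (n' = n ∧ m' < m) := by
  rcases lt_trichotomy n' n with h | h | h
  · have : ((n' : ℕ) + 1) * M ≤ n * M := Nat.mul_le_mul_right _ h
    rw [add_mul, one_mul] at this
    have := m'.2
    simp only [h, true_or, iff_true]; omega
  · subst h; simp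
  · have : ((n : ℕ) + 1) * M ≤ n' * M := Nat.mul_le_mul_right _ h
    rw [add_mul, one_mul] at this
    have := m.2
    simp only [not_lt.2 h.le, h.ne', false_and, or_false, iff_false]
    omega

theorem sweepAt_eq_sweepStage (U U₁ : Fin N → Fin M → ℂ) (n : Fin N) (m : Fin M) :
    sweepAt U U₁ n m = sweepStage U U₁ (n * M + m) := by
  ext n' m'
  simp only [sweepAt, sweepStage, sweep_position_lt]

theorem sweepStage_succ (U U₁ : Fin N → Fin M → ℂ) (n : Fin N) (m : Fin M) :
    sweepStage U U₁ (n * M + m + 1) = setEntry (sweepAt U U₁ n m) n m (U₁ n m) := by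
  ext n' m'
  rw [setEntry_apply]
  simp only [sweepStage, sweepAt, Nat.lt_succ_iff_lt_or_eq, sweep_position_lt]
  by_cases h : n' = n ∧ m' = m
  · obtain ⟨rfl, rfl⟩ := h; simp
  · have h' : ¬ ((n' : ℕ) * M + m' = n * M + m) := by
      intro he
      have h1 : ¬ (n' < n ∨ (n' = n ∧ m' < m)) := sweep_position_lt.not.1 he.not_lt
      have h2 : ¬ (n < n' ∨ (n = n' ∧ m < m')) := sweep_position_lt.not.1 he.not_gt
      push Not at h1 h2
      have h3 : n' = n := le_antisymm h2.1 h1.1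
      exact h ⟨h3, le_antisymm (h2.2 h3.symm) (h1.2 h3)⟩
    simp only [h', or_false, h, if_false]

theorem sweepAt_mem {U U₁ : Fin N → Fin M → ℂ} (hU : U ∈ analogSet N M) (hU₁ : U₁ ∈ analogSet N M)
    (n : Fin N) (m : Fin M) : sweepAt U U₁ n m ∈ analogSet N M := by
  intro n' m'
  unfold sweepAt
  split_ifs
  exacts [hU₁ _ _, hU _ _]

theorem setEntry_self (T : Fin N → Fin M → ℂ) (n : Fin N) (m : Fin M) :
    setEntry T n m (T n m) = T := by
  simp [setEntry]

/-- A sweep maximizes over each entry in turn, and its gain bounds the change of each entry. -/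
theorem AnalogSweep.gain {δ : ℝ} {U U₁ : Fin N → Fin M → ℂ} (hδ : 0 ≤ δ)
    (hU : U ∈ analogSet N M) (h : p.AnalogSweep δ b V S Γ U U₁) :
    p.f₀ b U V S Γ ≤ p.f₀ b U₁ V S Γ ∧
    (∀ n m u, ‖u‖ = 1 / Real.sqrt M → p.f₀ b (setEntry (sweepAt U U₁ n m) n m u) V S Γ
      ≤ p.f₀ b (setEntry (sweepAt U U₁ n m) n m (U₁ n m)) V S Γ) ∧
    ∀ n m, Real.sqrt M * δ * ‖U₁ n m - U n m‖ ^ 2 ≤ p.f₀ b U₁ V S Γ - p.f₀ b U V S Γ := by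
  have hgain : ∀ n m u, ‖u‖ = 1 / Real.sqrt M →
      p.f₀ b (setEntry (sweepAt U U₁ n m) n m u) V S Γ + Real.sqrt M * δ * ‖U₁ n m - u‖ ^ 2
      ≤ p.f₀ b (setEntry (sweepAt U U₁ n m) n m (U₁ n m)) V S Γ := by
    intro n m u hu
    rw [← p.f₀_setEntry_gain b V S Γ (sweepAt_mem hU h.1 n m n m) (h.1 n m) hu (h.2 n m).2]
    have := (h.2 n m).1
    gcongr
  have hstep : ∀ (n : Fin N) (m : Fin M), p.f₀ b (sweepStage U U₁ (n * M + m)) V S Γ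
      + Real.sqrt M * δ * ‖U₁ n m - U n m‖ ^ 2
      ≤ p.f₀ b (sweepStage U U₁ (n * M + m + 1)) V S Γ := by
    intro n m
    have h1 := hgain n m (U n m) (hU n m)
    have h2 : sweepAt U U₁ n m n m = U n m := by simp [sweepAt]
    rw [← h2, setEntry_self, h2] at h1
    rw [sweepStage_succ, ← sweepAt_eq_sweepStage]
    exact h1
  have hnn : ∀ n m, 0 ≤ Real.sqrt M * δ * ‖U₁ n m - U n m‖ ^ 2 := fun n m => by positivity
  have hlt : ∀ (n : Fin N) (m : Fin M), (n : ℕ) * M + m < N * M := by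
    intro n m
    have : ((n : ℕ) + 1) * M ≤ N * M := Nat.mul_le_mul_right _ n.2
    rw [add_mul, one_mul] at this
    have := m.2
    omega
  have hmono : Monotone fun j => p.f₀ b (sweepStage U U₁ j) V S Γ := by
    refine monotone_nat_of_le_succ fun j => ?_
    by_cases hj : j < N * M
    · have hM : 0 < M := by
        rcases Nat.eq_zero_or_pos M with h0 | h0
        · subst h0; simp at hj
        · exact h0
      -- The entry at position `j` is recovered by division with remainder by `M`. From `N * M` on
      -- the stages are constant.
      have h1 := hstep ⟨j / M, (Nat.div_lt_iff_lt_mul hM).2 hj⟩ ⟨j % M, Nat.mod_lt _ hM⟩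
      have h2 : j / M * M + j % M = j := Nat.div_add_mod' j M
      simp only [h2] at h1
      exact (le_add_of_nonneg_right (hnn _ _)).trans h1
    · have : sweepStage U U₁ (j + 1) = sweepStage U U₁ j := by
        ext n m
        have := hlt n m
        simp only [sweepStage]
        rw [if_pos (by omega), if_pos (by omega)]
      rw [this]
  have h0 : sweepStage U U₁ 0 = U := by ext n m; simp [sweepStage]
  have h1 : sweepStage U U₁ (N * M) = U₁ := by ext n m; simp [sweepStage, hlt]
  refine ⟨?_, fun n m u hu => ?_, fun n m => ?_⟩
  · have := hmono (Nat.zero_le (N * M))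
    simpa only [h0, h1] using this
  · have h2 := hgain n m u hu
    have : 0 ≤ Real.sqrt M * δ * ‖U₁ n m - u‖ ^ 2 := by positivity
    linarith
  · have h2 := hstep n m
    have h3 := hmono (Nat.zero_le (n * M + m))
    have h4 := hmono (Nat.succ_le_of_lt (hlt n m))
    simp only [h0, h1, Nat.succ_eq_add_one] at h3 h4
    linarith

end Sweep

section BlockAscent

/-- What an iteration from `z` to `z₁` with auxiliary variables `Γ` achieves, in terms of `f₀`. -/
structure BlockAscent (ζ δ : ℝ) (z z₁ : Point K M N τ) (Γ : Fin K → Matrix (Fin τ) (Fin M) ℂ) :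
    Prop where
  bits : ∀ b ∈ p.bitSet, surrogate ζ (fun b => p.f₀ b z.2.1 z.2.2.1 z.2.2.2 Γ) z.1 b
    ≤ p.f₀ z₁.1 z.2.1 z.2.2.1 z.2.2.2 Γ
  analog_le : p.f₀ z₁.1 z.2.1 z.2.2.1 z.2.2.2 Γ ≤ p.f₀ z₁.1 z₁.2.1 z.2.2.1 z.2.2.2 Γ
  analog : (∀ U ∈ analogSet N M,
      p.f₀ z₁.1 U z.2.2.1 z.2.2.2 Γ ≤ p.f₀ z₁.1 z₁.2.1 z.2.2.1 z.2.2.2 Γ) ∨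
    ((∀ n m u, ‖u‖ = 1 / Real.sqrt M →
      p.f₀ z₁.1 (setEntry (sweepAt z.2.1 z₁.2.1 n m) n m u) z.2.2.1 z.2.2.2 Γ
        ≤ p.f₀ z₁.1 (setEntry (sweepAt z.2.1 z₁.2.1 n m) n m (z₁.2.1 n m)) z.2.2.1 z.2.2.2 Γ) ∧
    ∀ n m, Real.sqrt M * δ * ‖z₁.2.1 n m - z.2.1 n m‖ ^ 2
      ≤ p.f₀ z₁.1 z₁.2.1 z.2.2.1 z.2.2.2 Γ - p.f₀ z₁.1 z.2.1 z.2.2.1 z.2.2.2 Γ)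
  digital : ∀ V, p.f₀ z₁.1 z₁.2.1 V z.2.2.2 Γ
      + ∑ k, p.σ ^ 2 * p.qpow z₁.1 z₁.2.1 (z₁.2.2.1 - V) k * ∑ l, ∑ m, ‖Γ k l m‖ ^ 2
      ≤ p.f₀ z₁.1 z₁.2.1 z₁.2.2.1 z.2.2.2 Γ
  pilot : ∀ S ∈ p.pilotSet τ, p.f₀ z₁.1 z₁.2.1 z₁.2.2.1 S Γ
    ≤ p.f₀ z₁.1 z₁.2.1 z₁.2.2.1 z₁.2.2.2 Γ

theorem surrogate_self (ζ : ℝ) (g : (Fin N → ℝ) → ℝ) (b : Fin N → ℝ) : surrogate ζ g b b = g b := by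
  simp [surrogate]

theorem surrogate_anti {ζ ζ' : ℝ} (h : ζ ≤ ζ') (g : (Fin N → ℝ) → ℝ) (b' b : Fin N → ℝ) :
    surrogate ζ' g b' b ≤ surrogate ζ g b' b := by
  unfold surrogate
  have : 0 ≤ ∑ n, (b n - b' n) ^ 2 := Finset.sum_nonneg fun n _ => sq_nonneg _
  gcongr

theorem BitStep.mem {ζ : ℝ} {U : Fin N → Fin M → ℂ} {V : Fin K → Fin N → ℂ}
    {S : Fin K → Fin τ → ℂ} {Γ : Fin K → Matrix (Fin τ) (Fin M) ℂ} {b b₁ : Fin N → ℝ}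
    (h : p.BitStep ζ U V S Γ b b₁) : b₁ ∈ p.bitSet := by
  obtain ⟨w, -, hw, ⟨J, hJ, rfl⟩ | hcl⟩ := h
  · obtain ⟨j, rfl⟩ := Nat.exists_eq_add_of_le hJ
    rw [add_comm]; exact (hw j).1
  · obtain ⟨F, hF, ht⟩ := mapClusterPt_iff_ultrafilter.1 hcl
    refine p.isCompact_bitSet.isClosed.mem_of_tendsto ht
      (Eventually.filter_mono hF ?_)
    -- The starting value `w 0` is not assumed to satisfy the bit constraints here; all later terms
    -- satisfy them.
    filter_upwards [eventually_ge_atTop 1] with j hj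
    obtain ⟨i, rfl⟩ := Nat.exists_eq_add_of_le hj
    rw [add_comm]; exact (hw i).1

/-- Only the first approximation step is exploited: it beats the surrogate built at the current
bits. Later steps merely do not decrease `f₀`, and continuity carries the bound over to a limit
point of the steps. -/
theorem BitStep.surrogate_le {ζ : ℝ} {U : Fin N → Fin M → ℂ} {V : Fin K → Fin N → ℂ}
    {S : Fin K → Fin τ → ℂ} {Γ : Fin K → Matrix (Fin τ) (Fin M) ℂ} {b b₁ : Fin N → ℝ}
    (hb : b ∈ p.bitSet) (h : p.BitStep ζ U V S Γ b b₁)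
    (hζ : ∀ b ∈ p.bitSet, ∀ b' ∈ p.bitSet,
      surrogate ζ (fun b => p.f₀ b U V S Γ) b' b ≤ p.f₀ b U V S Γ) :
    ∀ b' ∈ p.bitSet, surrogate ζ (fun b => p.f₀ b U V S Γ) b b' ≤ p.f₀ b₁ U V S Γ := by
  obtain ⟨w, rfl, hw, hfin⟩ := h
  have hmem : ∀ j, w j ∈ p.bitSet := fun j => by
    cases j with
    | zero => exact hb
    | succ j => exact (hw j).1
  have hle : ∀ j, ∀ b' ∈ p.bitSet, surrogate ζ (fun b => p.f₀ b U V S Γ) (w j) b'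
      ≤ p.f₀ (w (j + 1)) U V S Γ := fun j b' hb' =>
    ((hw j).2 hb').trans (hζ _ (hmem (j + 1)) _ (hmem j))
  have hmono : Monotone fun j => p.f₀ (w j) U V S Γ := monotone_nat_of_le_succ fun j => by
    have := hle j (w j) (hmem j)
    rwa [surrogate_self] at this
  intro b' hb'
  refine (hle 0 b' hb').trans ?_
  rcases hfin with ⟨J, hJ, rfl⟩ | hcl
  · exact hmono hJ
  · obtain ⟨F, hF, ht⟩ := mapClusterPt_iff_ultrafilter.1 hcl
    have hc : Continuous fun b => p.f₀ b U V S Γ :=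
      (p.contDiff_f₀_comp (b := fun b : Fin N → ℝ => b) (U := fun _ => U) (V := fun _ => V)
        (S := fun _ => S) (G := fun _ => Γ) contDiff_id contDiff_const contDiff_const
        contDiff_const fun _ _ _ => contDiff_const).continuous
    refine ge_of_tendsto ((hc.tendsto b₁).comp ht) (Eventually.filter_mono hF ?_)
    filter_upwards [eventually_ge_atTop 1] with j hj using hmono hj

theorem Iteration.feasible {ζ δ : ℝ} {z z₁ : Point K M N τ} (h : p.Iteration ζ δ z z₁) :
    z₁ ∈ p.feasibleSet τ :=
  ⟨BitStep.mem p h.1, h.2.1.elim (fun h => h.1) (fun h => h.1), h.2.2.2.1⟩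

theorem Iteration.blockAscent {ζ δ : ℝ} (hδ : 0 ≤ δ) {z z₁ : Point K M N τ}
    (hz : z ∈ p.feasibleSet τ) (h : p.Iteration ζ δ z z₁)
    (hζ : ∀ b ∈ p.bitSet, ∀ b' ∈ p.bitSet,
      surrogate ζ (fun b => p.f₀ b z.2.1 z.2.2.1 z.2.2.2 (p.Γopt z)) b' b
        ≤ p.f₀ b z.2.1 z.2.2.1 z.2.2.2 (p.Γopt z)) :
    p.BlockAscent ζ δ z z₁ (p.Γopt z) := by
  have hz₁ := Iteration.feasible p h
  have hβ := p.bitSet_β' hz₁.1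
  obtain ⟨h1, h2, h3, h4⟩ := h
  refine ⟨BitStep.surrogate_le p hz.1 h1 hζ, ?_, ?_, fun V => p.f₀_digitalStep _ _ V _ _ hβ h3,
    fun S hS => p.f₀_le_pilotStep _ _ _ S _ hβ h4 hS⟩
  · rcases h2 with h2 | h2
    · exact h2.2 hz.2.1
    · exact (AnalogSweep.gain p _ _ _ _ hδ hz.2.1 h2).1
  · exact h2.imp (fun h U hU => h.2 hU) (fun h => (AnalogSweep.gain p _ _ _ _ hδ hz.2.1 h).2)

theorem qpow_smul (b : Fin N → ℝ) (U : Fin N → Fin M → ℂ) (V : Fin K → Fin N → ℂ) (k : Fin K)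
    (c : Fin K → ℂ) : p.qpow b U (fun k => c k • V k) k = ‖c k‖ ^ 2 * p.qpow b U V k := by
  simp only [qpow, Finset.mul_sum, Pi.smul_apply, smul_eq_mul, norm_mul, mul_pow]
  exact Finset.sum_congr rfl fun n _ => by ring

/-- Scale invariance of `f₀` transports every clause. In the digital gain, `qpow` acquires the
factor `|c_k|²` and `‖Γ_k‖²` the inverse factor. -/
theorem BlockAscent.rescale {ζ δ : ℝ} {z z₁ : Point K M N τ}
    {Γ : Fin K → Matrix (Fin τ) (Fin M) ℂ} (h : p.BlockAscent ζ δ z z₁ Γ) {c : Fin K → ℂ}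
    (hc : ∀ k, c k ≠ 0) : p.BlockAscent ζ δ (rescale c z) (rescale c z₁)
      (fun k => (star (c k))⁻¹ • Γ k) := by
  have hs := fun b U V S => p.f₀_smul (τ := τ) b U V S Γ hc
  refine ⟨?_, ?_, ?_, fun V => ?_, ?_⟩ <;> simp only [PilotDesign.rescale, hs]
  · exact h.bits
  · exact h.analog_le
  · exact h.analog
  · have h1 := h.digital (fun k => (c k)⁻¹ • V k)
    have e1 : V = fun k => c k • ((c k)⁻¹ • V k) := by
      ext1 k; rw [smul_smul, mul_inv_cancel₀ (hc k), one_smul]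
    have e2 : (fun k => c k • z₁.2.2.1 k) - V
        = fun k => c k • (z₁.2.2.1 - fun k => (c k)⁻¹ • V k) k := by
      ext1 k
      simp only [Pi.sub_apply, smul_sub, smul_smul, mul_inv_cancel₀ (hc k), one_smul]
    rw [e2]
    conv_lhs => enter [1]; rw [e1, hs]
    refine le_trans (le_of_eq ?_) h1
    congr 1
    refine Finset.sum_congr rfl fun k _ => ?_
    rw [qpow_smul]
    simp only [Matrix.smul_apply, smul_eq_mul, norm_mul, norm_inv, norm_star, mul_pow,
      ← Finset.mul_sum]
    have := norm_ne_zero_iff.2 (hc k)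
    field_simp
  · exact h.pilot

end BlockAscent
end System
end PilotDesign

/-! ### The derivative of `f`, and independence of the choice of optimal pilots -/

namespace PilotDesign
open Matrix Filter Topology Asymptotics
namespace System

variable {K M N τ : ℕ} (p : System K M N)

section Derivative

/-- Differentiability of `f` at `w` involves infeasible neighbours too. The strict bounds on `β`
persist near `w`, so positivity is still available there. -/
theorem eventually_β_mem {w : Point K M N τ} (hw : w.1 ∈ p.bitSet) :
    ∀ᶠ z in 𝓝 w, ∀ n, 0 ≤ p.β (z.1 n) ∧ p.β (z.1 n) ≤ 1 := by
  rw [eventually_all]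
  intro n
  have hc : ContinuousAt (fun z : Point K M N τ => p.β (z.1 n)) w :=
    (p.β_contDiff.continuous.comp (by fun_prop)).continuousAt
  filter_upwards [hc.eventually (Ioo_mem_nhds (p.bitSet_β hw n).1 (p.bitSet_β hw n).2)] with z hz
  exact ⟨hz.1.le, hz.2.le⟩

theorem contDiff_residual (G : Fin K → Matrix (Fin τ) (Fin M) ℂ) (k : Fin K) (l : Fin τ)
    (m : Fin M) : ContDiff ℝ 2 fun z : Point K M N τ =>
      (p.A z.1 z.2.1 z.2.2.1 z.2.2.2 k - p.B z.1 z.2.1 z.2.2.1 z.2.2.2 k * G k) l m := by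
  have h1 := p.contDiff_A (b := fun z : Point K M N τ => z.1)
    (U := fun z => z.2.1) (V := fun z => z.2.2.1) (S := fun z => z.2.2.2)
    (by fun_prop) (by fun_prop) (by fun_prop) (by fun_prop) k l m
  have h2 := fun l' => p.contDiff_B (b := fun z : Point K M N τ => z.1)
    (U := fun z => z.2.1) (V := fun z => z.2.2.1) (S := fun z => z.2.2.2)
    (by fun_prop) (by fun_prop) (by fun_prop) (by fun_prop) k l l'
  simp only [Matrix.sub_apply, Matrix.mul_apply]
  exact h1.sub (ContDiff.sum fun l' _ => (h2 l').mul contDiff_const)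

/-- The residual `A_k - B_k Γ_k`, with `Γ_k` frozen at its optimal value for `w`, is smooth and
vanishes at `w`, hence is `O(z - w)`. The gap is at most its square divided by `σ² q_k`, and `q_k`
stays away from zero near `w`. -/
theorem oterm_sub_fterm_isLittleO {w : Point K M N τ} (hw : w ∈ p.feasibleSet τ) (hM : M ≠ 0)
    {k : Fin K} (hV : w.2.2.1 k ≠ 0) :
    (fun z : Point K M N τ => p.oterm z.1 z.2.1 z.2.2.1 z.2.2.2 k
      - p.fterm z.1 z.2.1 z.2.2.1 z.2.2.2 (p.Γopt w) k) =o[𝓝 w] fun z => z - w := by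
  have hq := p.qpow_pos_of_feasible hw.1 hw.2.1 hM hV
  have hqc := (p.continuous_qpow (τ := τ) (M := M) k).continuousAt (x := w)
  have hr : ∀ l m, (fun z : Point K M N τ => (p.A z.1 z.2.1 z.2.2.1 z.2.2.2 k
      - p.B z.1 z.2.1 z.2.2.1 z.2.2.2 k * p.Γopt w k) l m) =O[𝓝 w] fun z => z - w := by
    intro l m
    have h1 := ((p.contDiff_residual (p.Γopt w) k l m).differentiable (by norm_num) w).isBigO_sub
    have h2 : p.A w.1 w.2.1 w.2.2.1 w.2.2.2 k - p.B w.1 w.2.1 w.2.2.1 w.2.2.2 k * p.Γopt w k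
        = 0 := by
      rw [Γopt, Matrix.mul_nonsing_inv_cancel_left _ _
        (p.isUnit_B_of_feasible w.2.2.2 hw.1 hw.2.1 hM hV), sub_self]
    simpa only [h2, Matrix.zero_apply, sub_zero] using h1
  have hr0 : (fun z : Point K M N τ => z - w) =o[𝓝 w] fun _ => (1 : ℝ) := by
    rw [isLittleO_one_iff]
    have : Tendsto (fun z : Point K M N τ => z - w) (𝓝 w) (𝓝 (w - w)) :=
      (continuous_id.sub continuous_const).tendsto w
    simpa using this
  have hsq : ∀ l m, (fun z : Point K M N τ => ‖(p.A z.1 z.2.1 z.2.2.1 z.2.2.2 k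
      - p.B z.1 z.2.1 z.2.2.1 z.2.2.2 k * p.Γopt w k) l m‖ ^ 2) =o[𝓝 w] fun z => z - w := by
    intro l m
    have h1 := ((hr l m).norm_norm).mul_isLittleO ((hr l m).trans_isLittleO hr0).norm_left
    simp only [mul_one, ← sq] at h1
    exact h1.of_norm_right
  have hfin : (fun z : Point K M N τ => 1 / (p.σ ^ 2 * p.qpow z.1 z.2.1 z.2.2.1 k)
      * ∑ l, ∑ m, ‖(p.A z.1 z.2.1 z.2.2.1 z.2.2.2 k
      - p.B z.1 z.2.1 z.2.2.1 z.2.2.2 k * p.Γopt w k) l m‖ ^ 2) =o[𝓝 w] fun z => z - w := by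
    have h1 : ContinuousAt (fun z : Point K M N τ =>
        1 / (p.σ ^ 2 * p.qpow z.1 z.2.1 z.2.2.1 k)) w :=
      continuousAt_const.div (continuousAt_const.mul hqc)
        (mul_pos (pow_pos p.σ_pos 2) hq).ne'
    have h2 := (h1.tendsto.isBigO_one ℝ).mul_isLittleO
      (IsLittleO.norm_right (IsLittleO.fun_sum (s := Finset.univ) fun l _ =>
        IsLittleO.fun_sum (s := Finset.univ) fun m _ => hsq l m))
    simp only [one_mul] at h2
    exact h2.of_norm_right
  refine IsBigO.trans_isLittleO (IsBigO.of_bound 1 ?_) hfin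
  filter_upwards [p.eventually_β_mem hw.1, hqc.eventually (lt_mem_nhds hq)] with z hz hz'
  have h := p.oterm_gap z.1 z.2.1 z.2.2.1 z.2.2.2 (p.Γopt w) k hz hz'
  have h1 : 0 ≤ p.σ ^ 2 * p.qpow z.1 z.2.1 z.2.2.1 k
        * ∑ l, ∑ m, ‖((p.B z.1 z.2.1 z.2.2.1 z.2.2.2 k)⁻¹ * p.A z.1 z.2.1 z.2.2.1 z.2.2.2 k
          - p.Γopt w k) l m‖ ^ 2 := by positivity
  rw [one_mul, Real.norm_of_nonneg (h1.trans h.1)]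
  exact h.2.trans (le_abs_self _)

/-- The objective is differentiable where all digital combiners are nonzero, with the derivative
of `f₀` for the optimal auxiliary variables. -/
theorem hasFDerivAt_obj {w : Point K M N τ} (hw : w ∈ p.feasibleSet τ) (hM : M ≠ 0)
    (hV : ∀ k, w.2.2.1 k ≠ 0) {F' : Point K M N τ →L[ℝ] ℝ}
    (hF : HasFDerivAt (fun z : Point K M N τ => p.f₀ z.1 z.2.1 z.2.2.1 z.2.2.2 (p.Γopt w)) F' w) :
    HasFDerivAt p.obj F' w := by
  have h0 : HasFDerivAt (fun z : Point K M N τ => p.obj z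
      - p.f₀ z.1 z.2.1 z.2.2.1 z.2.2.2 (p.Γopt w)) (0 : Point K M N τ →L[ℝ] ℝ) w := by
    refine HasFDerivAt.of_isLittleO ?_
    simp only [p.obj_eq_f₀ hw, sub_self, sub_zero, _root_.zero_apply]
    have := IsLittleO.fun_sum (s := Finset.univ) fun k _ =>
      p.oterm_sub_fterm_isLittleO hw hM (hV k)
    refine this.congr_left fun z => ?_
    rw [Finset.sum_sub_distrib, ← f₀_eq_sum_fterm, ← f_eq_sum_oterm, obj]
  simpa using h0.fun_add hF

end Derivative

section Pilots

variable {b : Fin N → ℝ} {U : Fin N → Fin M → ℂ} {V : Fin K → Fin N → ℂ}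
  {G : Fin K → Matrix (Fin τ) (Fin M) ℂ} {S S' : Fin K → Fin τ → ℂ}

/-- Two optimal pilots differ by a vector in the kernel of the quadratic form of `f₀`. -/
theorem pilot_maximizers_kernel (hb : b ∈ p.bitSet) (hS : S ∈ p.pilotSet τ)
    (hS' : S' ∈ p.pilotSet τ) (hmax : ∀ T ∈ p.pilotSet τ, p.f₀ b U V T G ≤ p.f₀ b U V S G)
    (heq : p.f₀ b U V S' G = p.f₀ b U V S G) (k i : Fin K) :
    p.xRx b U V k i * sGs (S - S') G k i = 0 ∧ dGG (S - S') G k i * p.vQv b V k (p.C U i) = 0 := by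
  have hβ := p.bitSet_β' hb
  have hmid := hmax _ (p.convex_pilotSet_midpoint hS hS')
  -- The midpoint of two optimal pilots is feasible, so it cannot beat them; `quad_midpoint` then
  -- bounds the form of `E` at the difference from above by zero.
  have hsum : ∑ i, (star ((S - S') i) ⬝ᵥ (p.E b U V G i *ᵥ (S - S') i)).re ≤ 0 := by
    rw [f₀_eq_pilot, f₀_eq_pilot] at hmid heq
    simp only [quad_midpoint (p.E_isHermitian b U V G _ hβ), Finset.sum_add_distrib,
      ← Finset.mul_sum] at hmid
    simp only [Pi.sub_apply]
    linarith
  have hnn : ∀ i, 0 ≤ star ((S - S') i) ⬝ᵥ (p.E b U V G i *ᵥ (S - S') i) := fun i =>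
    p.E_form_nonneg b U V (S - S') G i hβ
  have hre := (Finset.sum_eq_zero_iff_of_nonneg fun i _ => (Complex.le_def.1 (hnn i)).1).1
    (le_antisymm hsum (Finset.sum_nonneg fun i _ => (Complex.le_def.1 (hnn i)).1)) i
    (Finset.mem_univ i)
  have hz : star ((S - S') i) ⬝ᵥ (p.E b U V G i *ᵥ (S - S') i) = 0 :=
    Complex.ext hre (Complex.le_def.1 (hnn i)).2.symm
  have h1 : ∀ k, 0 ≤ p.xRx b U V k i * sGs (S - S') G k i := fun k =>
    mul_nonneg (p.xRx_nonneg b U V k i) (sGs_nonneg _ G k i)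
  have h2 : ∀ k, 0 ≤ dGG (S - S') G k i * p.vQv b V k (p.C U i) := fun k =>
    mul_nonneg (dGG_nonneg _ G k i)
      (p.vQv_nonneg b V k hβ fun n => (p.C_posSemidef U i).diag_nonneg)
  rw [E_form, add_eq_zero_iff_of_nonneg (Finset.sum_nonneg fun k _ => h1 k)
    (Finset.sum_nonneg fun k _ => h2 k), Finset.sum_eq_zero_iff_of_nonneg fun k _ => h1 k,
    Finset.sum_eq_zero_iff_of_nonneg fun k _ => h2 k] at hz
  exact ⟨hz.1 k (Finset.mem_univ k), hz.2 k (Finset.mem_univ k)⟩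

theorem mulVec_eq_zero_of_sGs {d : Fin K → Fin τ → ℂ} {k i : Fin K} (h : sGs d G k i = 0) :
    (G k)ᴴ *ᵥ d i = 0 := by
  rw [sGs_eq] at h
  exact dotProduct_star_self_eq_zero.1 h

theorem sGs_congr {k i : Fin K} (h : sGs (S - S') G k i = 0) : sGs S G k i = sGs S' G k i := by
  have h1 := mulVec_eq_zero_of_sGs h
  rw [Pi.sub_apply, mulVec_sub, sub_eq_zero] at h1
  rw [sGs_eq, sGs_eq, h1]

theorem dGG_congr {k i : Fin K} (h : dGG (S - S') G k i = 0) : dGG S G k i = dGG S' G k i := by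
  rw [dGG_eq_sum, Finset.sum_eq_zero_iff_of_nonneg fun l _ =>
    mul_nonneg (mul_star_self_nonneg _) (gram_diag_nonneg _ _)] at h
  rw [dGG_eq_sum, dGG_eq_sum]
  refine Finset.sum_congr rfl fun l hl => ?_
  rcases mul_eq_zero.1 (h l hl) with h | h
  · have : S i l = S' i l := by
      rw [← sub_eq_zero]
      exact (mul_eq_zero.1 h).elim id star_eq_zero.1
    rw [this]
  · rw [h, mul_zero, mul_zero]

theorem hasFDerivAt_zero_of_nonneg {E : Type*} [NormedAddCommGroup E] [NormedSpace ℝ E]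
    {f : E → ℝ} {w : E} (hf : DifferentiableAt ℝ f w) (h : ∀ᶠ z in 𝓝 w, 0 ≤ f z)
    (hw : f w = 0) : HasFDerivAt f (0 : E →L[ℝ] ℝ) w := by
  have hmin : IsLocalMin f w := by
    filter_upwards [h] with z hz using hw ▸ hz
  rw [← hmin.fderiv_eq_zero]
  exact hf.hasFDerivAt

/-- The derivative of `f₀` in the other variables is the same at two optimal pilots. -/
theorem hasFDerivAt_f₀_sub_pilot {w : Point K M N τ} (hb : w.1 ∈ p.bitSet)
    (hG : ∀ k, p.xRx w.1 w.2.1 w.2.2.1 k k = 0 → G k = 0)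
    (hS : S ∈ p.pilotSet τ) (hS' : S' ∈ p.pilotSet τ)
    (hmax : ∀ T ∈ p.pilotSet τ, p.f₀ w.1 w.2.1 w.2.2.1 T G ≤ p.f₀ w.1 w.2.1 w.2.2.1 S G)
    (heq : p.f₀ w.1 w.2.1 w.2.2.1 S' G = p.f₀ w.1 w.2.1 w.2.2.1 S G) :
    HasFDerivAt (fun z : Point K M N τ => p.f₀ z.1 z.2.1 z.2.2.1 S G - p.f₀ z.1 z.2.1 z.2.2.1 S' G)
      (0 : Point K M N τ →L[ℝ] ℝ) w := by
  have hker := p.pilot_maximizers_kernel hb hS hS' hmax heq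
  have him : ∀ {c : ℂ}, 0 ≤ c → c.im = 0 := fun h => (Complex.le_def.1 h).2.symm
  -- Each summand is a constant times a function of `z` that is nonnegative near `w`. By the kernel
  -- condition either the constant is zero, or the function vanishes at `w`, is minimal there, and
  -- so has derivative zero.
  have hform : ∀ z : Point K M N τ, p.f₀ z.1 z.2.1 z.2.2.1 S G - p.f₀ z.1 z.2.1 z.2.2.1 S' G
      = -∑ k, (∑ i, (sGs S G k i - sGs S' G k i).re * (p.xRx z.1 z.2.1 z.2.2.1 k i).re
        + ∑ i, (dGG S G k i - dGG S' G k i).re * (p.vQv z.1 z.2.2.1 k (p.C z.2.1 i)).re) := by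
    intro z
    rw [f₀_eq_sum_fterm, f₀_eq_sum_fterm, ← Finset.sum_sub_distrib, ← Finset.sum_neg_distrib]
    refine Finset.sum_congr rfl fun k _ => ?_
    -- The linear terms agree identically in `z`: either `G_kᴴ` takes the same value at both pilots,
    -- or `x_k R_k x_kᴴ = 0` at `w` and `G_k = 0` by hypothesis.
    have hlin : star (S k) ⬝ᵥ (G k *ᵥ (p.R k *ᵥ star (p.x z.1 z.2.1 z.2.2.1 k)))
        = star (S' k) ⬝ᵥ (G k *ᵥ (p.R k *ᵥ star (p.x z.1 z.2.1 z.2.2.1 k))) := by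
      rcases mul_eq_zero.1 (hker k k).1 with h | h
      · simp [hG k h]
      · have h1 := mulVec_eq_zero_of_sGs h
        rw [Pi.sub_apply, mulVec_sub, sub_eq_zero] at h1
        have h2 := congrArg star h1
        rw [star_mulVec, star_mulVec, conjTranspose_conjTranspose] at h2
        rw [dotProduct_mulVec, h2, ← dotProduct_mulVec]
    rw [fterm_eq, fterm_eq, hlin]
    simp only [Complex.add_re, Complex.re_sum, Complex.mul_re, him (sGs_nonneg _ _ _ _),
      him (dGG_nonneg _ _ _ _), Complex.sub_re, sub_mul, Finset.sum_sub_distrib, mul_zero, zero_mul,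
      sub_zero, mul_comm (Complex.re (sGs _ _ _ _))]
    ring
  simp only [hform]
  have h1 : ∀ k i, HasFDerivAt (fun z : Point K M N τ =>
      (sGs S G k i - sGs S' G k i).re * (p.xRx z.1 z.2.1 z.2.2.1 k i).re)
      (0 : Point K M N τ →L[ℝ] ℝ) w := by
    intro k i
    rcases mul_eq_zero.1 (hker k i).1 with h | h
    · have hd : ContDiff ℝ 2 fun z : Point K M N τ => (p.xRx z.1 z.2.1 z.2.2.1 k i).re :=
        contDiff_re_comp (p.contDiff_xRx (b := fun z : Point K M N τ => z.1)
          (U := fun z => z.2.1) (V := fun z => z.2.2.1) (by fun_prop) (by fun_prop)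
          (by fun_prop) k i)
      have h2 := hasFDerivAt_zero_of_nonneg (hd.differentiable (by norm_num) w)
        (Eventually.of_forall fun z => (Complex.le_def.1 (p.xRx_nonneg _ _ _ k i)).1) (by rw [h]; rfl)
      simpa using h2.const_mul (sGs S G k i - sGs S' G k i).re
    · rw [sGs_congr h]
      simpa using hasFDerivAt_const (0 : ℝ) w
  have h2 : ∀ k i, HasFDerivAt (fun z : Point K M N τ =>
      (dGG S G k i - dGG S' G k i).re * (p.vQv z.1 z.2.2.1 k (p.C z.2.1 i)).re)
      (0 : Point K M N τ →L[ℝ] ℝ) w := by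
    intro k i
    rcases mul_eq_zero.1 (hker k i).2 with h | h
    · rw [dGG_congr h]
      simpa using hasFDerivAt_const (0 : ℝ) w
    · have hC := p.contDiff_C (U := fun z : Point K M N τ => z.2.1) (by fun_prop) i
      have hd : ContDiff ℝ 2 fun z : Point K M N τ => (p.vQv z.1 z.2.2.1 k (p.C z.2.1 i)).re :=
        contDiff_re_comp (p.contDiff_vQv (b := fun z : Point K M N τ => z.1)
          (V := fun z => z.2.2.1) (by fun_prop) (by fun_prop) k hC)
      have h2 := hasFDerivAt_zero_of_nonneg (hd.differentiable (by norm_num) w)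
        ((p.eventually_β_mem hb).mono fun z hz => (Complex.le_def.1 (p.vQv_nonneg _ _ k hz
          fun n => (p.C_posSemidef _ i).diag_nonneg)).1) (by rw [h]; rfl)
      simpa using h2.const_mul (dGG S G k i - dGG S' G k i).re
  have h3 := HasFDerivAt.fun_neg (HasFDerivAt.fun_sum (u := Finset.univ) fun k _ =>
    (HasFDerivAt.fun_sum (u := Finset.univ) fun i _ => h1 k i).fun_add
      (HasFDerivAt.fun_sum (u := Finset.univ) fun i _ => h2 k i))
  simpa using h3

/-- For `R_k ≥ 0` the equality `x_k R_k x_kᴴ = 0` forces `x_k R_k = 0`, hence `A_k = 0`. This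
supplies the hypothesis on `G` in `hasFDerivAt_f₀_sub_pilot`. -/
theorem Γopt_eq_zero_of_xRx {w : Point K M N τ} {k : Fin K}
    (h : p.xRx w.1 w.2.1 w.2.2.1 k k = 0) : p.Γopt w k = 0 := by
  have h1 := ((p.R_posSemidef k).dotProduct_mulVec_zero_iff (star (p.x w.1 w.2.1 w.2.2.1 k))).1
    (by rw [star_star]; exact h)
  have h2 : p.x w.1 w.2.1 w.2.2.1 k ᵥ* p.R k = 0 := by
    have := congrArg star h1
    rwa [star_mulVec, star_star, (p.R_posSemidef k).isHermitian.eq, star_zero] at this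
  have h3 : p.A w.1 w.2.1 w.2.2.1 w.2.2.2 k = 0 := by
    ext l m
    simp [A, h2, vecMulVec_apply]
  rw [Γopt, h3, Matrix.mul_zero]

end Pilots

end System
end PilotDesign

/-! ### From block optimality to stationarity -/

namespace PilotDesign
open Matrix Filter Topology Asymptotics

theorem hasFDerivAt_comp_sub {E F : Type*} [NormedAddCommGroup E] [NormedSpace ℝ E]
    [NormedAddCommGroup F] [NormedSpace ℝ F] (T : E →L[ℝ] F) (w : E) :
    HasFDerivAt (fun z => T (z - w)) T w := by
  simpa only [map_sub] using (T.hasFDerivAt (x := w)).sub_const (T w)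

/-- First-order necessary condition along a linear map of the displacement. -/
theorem fderiv_nonpos_of_forall_le {E : Type*} [NormedAddCommGroup E] [NormedSpace ℝ E]
    {F : E → ℝ} {F' : E →L[ℝ] ℝ} {w d : E} {s : Set E} (hF : HasFDerivAt F F' w) (T : E →L[ℝ] E)
    (hmax : ∀ z ∈ s, F (w + T (z - w)) ≤ F w) (hd : d ∈ posTangentConeAt s w) : F' (T d) ≤ 0 := by
  have h1 : HasFDerivAt (fun z => w + T (z - w)) T w := (hasFDerivAt_comp_sub T w).const_add w
  have h2 : HasFDerivAt (fun z => F (w + T (z - w))) (F'.comp T) w := by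
    refine HasFDerivAt.comp w (g := F) ?_ h1
    simpa using hF
  have h3 : IsLocalMaxOn (fun z => F (w + T (z - w))) s w := by
    refine IsMaxOn.localize fun z hz => ?_
    simpa using hmax z hz
  exact h3.hasFDerivWithinAt_nonpos (f' := F'.comp T) h2.hasFDerivWithinAt hd

namespace System

variable {K M N τ : ℕ} (p : System K M N)

section Stationarity

/-- The projection of a displacement to its bits. -/
noncomputable def projBits : Point K M N τ →L[ℝ] Point K M N τ :=
  LinearMap.toContinuousLinearMap
    { toFun := fun d => (d.1, 0, 0, 0)
      map_add' := fun x y => by ext <;> simp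
      map_smul' := fun c x => by ext <;> simp }

/-- The projection of a displacement to an entry of its analog combiner. -/
noncomputable def projEntry (n : Fin N) (m : Fin M) : Point K M N τ →L[ℝ] Point K M N τ :=
  LinearMap.toContinuousLinearMap
    { toFun := fun d => (0, Pi.single n (Pi.single m (d.2.1 n m)), 0, 0)
      map_add' := fun x y => by simp [Pi.single_add]
      map_smul' := fun c x => by simp [← Pi.single_smul] }

/-- The projection of a displacement to its digital combiners. -/
noncomputable def projDigital : Point K M N τ →L[ℝ] Point K M N τ :=
  LinearMap.toContinuousLinearMap
    { toFun := fun d => (0, 0, d.2.2.1, 0)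
      map_add' := fun x y => by ext <;> simp
      map_smul' := fun c x => by ext <;> simp }

/-- The projection of a displacement to its pilots. -/
noncomputable def projPilot : Point K M N τ →L[ℝ] Point K M N τ :=
  LinearMap.toContinuousLinearMap
    { toFun := fun d => (0, 0, 0, d.2.2.2)
      map_add' := fun x y => by ext <;> simp
      map_smul' := fun c x => by ext <;> simp }

theorem sum_projEntry (d : Point K M N τ) :
    ∑ n, ∑ m, projEntry n m d = ((0, d.2.1, 0, 0) : Point K M N τ) := by
  change ∑ n, ∑ m, ((0, Pi.single n (Pi.single m (d.2.1 n m)), 0, 0) : Point K M N τ) = _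
  refine Prod.ext ?_ (Prod.ext ?_ (Prod.ext ?_ ?_))
  · simp [Prod.fst_sum]
  · simp only [Prod.snd_sum, Prod.fst_sum]
    ext n' m'
    simp [Finset.sum_apply, Pi.single_apply, ite_apply]
  · simp [Prod.snd_sum]
  · simp [Prod.snd_sum]

theorem contDiff_f₀_point (G : Fin K → Matrix (Fin τ) (Fin M) ℂ) :
    ContDiff ℝ 2 fun z : Point K M N τ => p.f₀ z.1 z.2.1 z.2.2.1 z.2.2.2 G :=
  p.contDiff_f₀_comp (b := fun z : Point K M N τ => z.1)
    (U := fun z => z.2.1) (V := fun z => z.2.2.1) (S := fun z => z.2.2.2) (G := fun _ => G)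
    (by fun_prop) (by fun_prop) (by fun_prop) (by fun_prop) fun _ _ _ => contDiff_const

theorem contDiff_f₀_fixed_pilot (S : Fin K → Fin τ → ℂ) (G : Fin K → Matrix (Fin τ) (Fin M) ℂ) :
    ContDiff ℝ 2 fun z : Point K M N τ => p.f₀ z.1 z.2.1 z.2.2.1 S G :=
  p.contDiff_f₀_comp (b := fun z : Point K M N τ => z.1)
    (U := fun z => z.2.1) (V := fun z => z.2.2.1) (S := fun _ => S) (G := fun _ => G)
    (by fun_prop) (by fun_prop) (by fun_prop) contDiff_const fun _ _ _ => contDiff_const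

theorem add_single_eq_setEntry (U : Fin N → Fin M → ℂ) (n : Fin N) (m : Fin M) (u : ℂ) :
    U + Pi.single n (Pi.single m (u - U n m)) = setEntry U n m u := by
  ext n' m'
  rw [setEntry_apply]
  by_cases h : n' = n
  · subst h
    by_cases h' : m' = m
    · subst h'; simp
    · simp [h']
  · simp [h]

/-- The derivative of the surrogate at its centre is that of the function. -/
theorem fderiv_bits_nonpos {w d : Point K M N τ} {G : Fin K → Matrix (Fin τ) (Fin M) ℂ} {ζ : ℝ}
    {F' : Point K M N τ →L[ℝ] ℝ}
    (hF : HasFDerivAt (fun z : Point K M N τ => p.f₀ z.1 z.2.1 z.2.2.1 z.2.2.2 G) F' w)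
    (h : ∀ b ∈ p.bitSet, surrogate ζ (fun b => p.f₀ b w.2.1 w.2.2.1 w.2.2.2 G) w.1 b
      ≤ p.f₀ w.1 w.2.1 w.2.2.1 w.2.2.2 G)
    (hd : d ∈ posTangentConeAt (p.feasibleSet τ) w) : F' (projBits d) ≤ 0 := by
  have hg : HasFDerivAt (fun b => p.f₀ b w.2.1 w.2.2.1 w.2.2.2 G)
      (F'.comp (ContinuousLinearMap.inl ℝ _ _)) w.1 :=
    HasFDerivAt.comp w.1 (f := fun b => (b, w.2)) (g := fun z : Point K M N τ =>
      p.f₀ z.1 z.2.1 z.2.2.1 z.2.2.2 G) hF (hasFDerivAt_prodMk_left w.1 w.2)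
  -- The proximal term is minimal at its centre, so it does not contribute to the derivative.
  have hsq : HasFDerivAt (fun z : Point K M N τ => ∑ n, (z.1 n - w.1 n) ^ 2)
      (0 : Point K M N τ →L[ℝ] ℝ) w :=
    hasFDerivAt_zero_of_nonneg (by fun_prop)
      (Eventually.of_forall fun z => Finset.sum_nonneg fun n _ => sq_nonneg _) (by simp)
  have hlin : HasFDerivAt (fun z : Point K M N τ => F' (projBits (z - w))) (F'.comp projBits) w :=
    hasFDerivAt_comp_sub (F'.comp projBits) w
  have hs : HasFDerivAt (fun z : Point K M N τ =>
      surrogate ζ (fun b => p.f₀ b w.2.1 w.2.2.1 w.2.2.2 G) w.1 z.1) (F'.comp projBits) w := by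
    have h1 := (hlin.const_add (p.f₀ w.1 w.2.1 w.2.2.1 w.2.2.2 G)).fun_sub (hsq.const_mul ζ)
    simp only [smul_zero, sub_zero] at h1
    refine h1.congr_of_eventuallyEq (Eventually.of_forall fun z => ?_)
    simp only [surrogate, hg.fderiv]
    rfl
  have hmax : IsLocalMaxOn (fun z : Point K M N τ =>
      surrogate ζ (fun b => p.f₀ b w.2.1 w.2.2.1 w.2.2.2 G) w.1 z.1) (p.feasibleSet τ) w := by
    refine IsMaxOn.localize fun z hz => ?_
    rw [Set.mem_ofPred_eq, surrogate_self]
    exact h z.1 hz.1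
  exact hmax.hasFDerivWithinAt_nonpos (f' := F'.comp projBits) hs.hasFDerivWithinAt hd

/-- Block optimality conditions, some of them at other optimal pilots `S`, imply stationarity. -/
theorem isStationary_of_blocks {w : Point K M N τ} {S : Fin K → Fin τ → ℂ} {ζ : ℝ} (hM : M ≠ 0)
    (hw : w ∈ p.feasibleSet τ) (hV : ∀ k, w.2.2.1 k ≠ 0)
    (hbits : ∀ b ∈ p.bitSet, surrogate ζ (fun b => p.f₀ b w.2.1 w.2.2.1 w.2.2.2 (p.Γopt w)) w.1 b
      ≤ p.f₀ w.1 w.2.1 w.2.2.1 w.2.2.2 (p.Γopt w))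
    (hentry : ∀ n m u, ‖u‖ = 1 / Real.sqrt M →
      p.f₀ w.1 (setEntry w.2.1 n m u) w.2.2.1 S (p.Γopt w)
        ≤ p.f₀ w.1 w.2.1 w.2.2.1 S (p.Γopt w))
    (hdigital : ∀ V, p.f₀ w.1 w.2.1 V S (p.Γopt w) ≤ p.f₀ w.1 w.2.1 w.2.2.1 S (p.Γopt w))
    (hpilot : ∀ T ∈ p.pilotSet τ, p.f₀ w.1 w.2.1 w.2.2.1 T (p.Γopt w)
      ≤ p.f₀ w.1 w.2.1 w.2.2.1 w.2.2.2 (p.Γopt w))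
    (hS : S ∈ p.pilotSet τ) (heq : p.f₀ w.1 w.2.1 w.2.2.1 S (p.Γopt w)
      = p.f₀ w.1 w.2.1 w.2.2.1 w.2.2.2 (p.Γopt w)) :
    p.IsStationary w := by
  set G := p.Γopt w with hG
  obtain ⟨F', hF⟩ : ∃ F' : Point K M N τ →L[ℝ] ℝ, HasFDerivAt
      (fun z : Point K M N τ => p.f₀ z.1 z.2.1 z.2.2.1 z.2.2.2 G) F' w :=
    ⟨_, ((p.contDiff_f₀_point G).differentiable (by norm_num) w).hasFDerivAt⟩
  obtain ⟨H', hH⟩ : ∃ H' : Point K M N τ →L[ℝ] ℝ, HasFDerivAt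
      (fun z : Point K M N τ => p.f₀ z.1 z.2.1 z.2.2.1 S G) H' w :=
    ⟨_, ((p.contDiff_f₀_fixed_pilot S G).differentiable (by norm_num) w).hasFDerivAt⟩
  refine ⟨hw, F', p.hasFDerivAt_obj hw hM hV hF, fun d hd => ?_⟩
  -- The projection that freezes the pilots. It allows `F'`, taken with the pilots of `w`, to be
  -- compared with `H'`, taken with the pilots `S`, in the directions `b`, `U`, `V`.
  let P : Point K M N τ →L[ℝ] Point K M N τ := ContinuousLinearMap.id ℝ _ - projPilot
  have hP : HasFDerivAt (fun z : Point K M N τ => p.f₀ z.1 z.2.1 z.2.2.1 w.2.2.2 G)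
      (F'.comp P) w := by
    have h1 : HasFDerivAt (fun z : Point K M N τ => w + P (z - w)) P w :=
      (hasFDerivAt_comp_sub P w).const_add w
    have h2 : ∀ z : Point K M N τ, w + P (z - w) = (z.1, z.2.1, z.2.2.1, w.2.2.2) := by
      intro z
      change w + ((z - w) - (0, 0, 0, (z - w).2.2.2)) = _
      refine Prod.ext ?_ (Prod.ext ?_ (Prod.ext ?_ ?_)) <;> simp
    simp only [h2] at h1
    exact HasFDerivAt.comp w (g := fun z : Point K M N τ => p.f₀ z.1 z.2.1 z.2.2.1 z.2.2.2 G)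
      (f := fun z : Point K M N τ => (z.1, z.2.1, z.2.2.1, w.2.2.2)) hF h1
  have hPH : F'.comp P = H' := by
    have h1 := p.hasFDerivAt_f₀_sub_pilot hw.1 (fun k => p.Γopt_eq_zero_of_xRx) hw.2.2 hS hpilot heq
    have h2 := (hP.fun_sub hH).unique h1
    exact sub_eq_zero.1 h2
  -- The direction is split by blocks, and `U` further by entries. The bit and pilot parts are
  -- tested with `F'`, the digital and entry parts with `H'`. The pieces need not lie in the tangent
  -- cone: each test composes the function with the projection of `z - w`.
  have hdec : d = projBits d + (projPilot d + (projDigital d + ∑ n, ∑ m, projEntry n m d)) := by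
    rw [sum_projEntry]
    change d = (d.1, 0, 0, 0) + ((0, 0, 0, d.2.2.2) + ((0, 0, d.2.2.1, 0) + (0, d.2.1, 0, 0)))
    refine Prod.ext ?_ (Prod.ext ?_ (Prod.ext ?_ ?_)) <;> simp
  have e1 : F' (projDigital d) = H' (projDigital d) := by
    rw [← hPH]
    change _ = F' (projDigital d - projPilot (projDigital d))
    rw [show projPilot (projDigital d) = (0 : Point K M N τ) from rfl, sub_zero]
  have e2 : ∀ n m, F' (projEntry n m d) = H' (projEntry n m d) := by
    intro n m
    rw [← hPH]
    change _ = F' (projEntry n m d - projPilot (projEntry n m d))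
    rw [show projPilot (projEntry n m d) = (0 : Point K M N τ) from rfl, sub_zero]
  have i1 := p.fderiv_bits_nonpos hF hbits hd
  have i2 : F' (projPilot d) ≤ 0 := by
    refine fderiv_nonpos_of_forall_le hF projPilot (fun z hz => ?_) hd
    have : w + projPilot (z - w) = (w.1, w.2.1, w.2.2.1, z.2.2.2) := by
      change w + (0, 0, 0, (z - w).2.2.2) = _
      refine Prod.ext ?_ (Prod.ext ?_ (Prod.ext ?_ ?_)) <;> simp
    rw [this]
    exact hpilot _ hz.2.2
  have i3 : H' (projDigital d) ≤ 0 := by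
    refine fderiv_nonpos_of_forall_le hH projDigital (fun z hz => ?_) hd
    have : w + projDigital (z - w) = (w.1, w.2.1, z.2.2.1, w.2.2.2) := by
      change w + (0, 0, (z - w).2.2.1, 0) = _
      refine Prod.ext ?_ (Prod.ext ?_ (Prod.ext ?_ ?_)) <;> simp
    rw [this]
    exact hdigital _
  have i4 : ∀ n m, H' (projEntry n m d) ≤ 0 := by
    intro n m
    refine fderiv_nonpos_of_forall_le hH (projEntry n m) (fun z hz => ?_) hd
    have : w + projEntry n m (z - w)
        = (w.1, setEntry w.2.1 n m (z.2.1 n m), w.2.2.1, w.2.2.2) := by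
      change w + (0, Pi.single n (Pi.single m ((z - w).2.1 n m)), 0, 0) = _
      rw [← add_single_eq_setEntry]
      refine Prod.ext ?_ (Prod.ext ?_ (Prod.ext ?_ ?_)) <;> simp
    rw [this]
    exact hentry _ _ _ (hz.2.1 n m)
  rw [hdec, map_add, map_add, map_add, map_sum, e1]
  simp only [map_sum, e2]
  have i5 : ∑ n, ∑ m, H' (projEntry n m d) ≤ 0 :=
    Finset.sum_nonpos fun n _ => Finset.sum_nonpos fun m _ => i4 n m
  linarith

end Stationarity

end System
end PilotDesign

/-! ### Limits of auxiliary variables and of digital combiners -/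

namespace PilotDesign
open Matrix Filter Topology
namespace System

variable {K M N τ : ℕ} (p : System K M N)

section Limits

theorem Γopt_rescale_eq {c : Fin K → ℂ} (hc : ∀ k, c k ≠ 0) (z : Point K M N τ) :
    p.Γopt (rescale c z) = fun k => (star (c k))⁻¹ • p.Γopt z k :=
  funext fun k => p.Γopt_rescale (hc k) z

theorem obj_rescale {c : Fin K → ℂ} (hc : ∀ k, c k ≠ 0) {z : Point K M N τ}
    (hz : z ∈ p.feasibleSet τ) : p.obj (rescale c z) = p.obj z := by
  rw [← p.obj_eq_f₀ hz, ← p.obj_eq_f₀ (show rescale c z ∈ p.feasibleSet τ from hz),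
    p.Γopt_rescale_eq hc]
  exact p.f₀_smul _ _ _ _ _ hc

theorem isClosed_feasibleSet : IsClosed (p.feasibleSet τ : Set (Point K M N τ)) :=
  (p.isCompact_bitSet.isClosed.preimage continuous_fst).inter
    ((isCompact_analogSet.isClosed.preimage (by fun_prop :
      Continuous fun z : Point K M N τ => z.2.1)).inter
    (p.isCompact_pilotSet.isClosed.preimage (by fun_prop :
      Continuous fun z : Point K M N τ => z.2.2.2)))

variable {ι : Type*}

theorem tendsto_f₀ {l : Filter ι} {b : ι → Fin N → ℝ} {U : ι → Fin N → Fin M → ℂ}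
    {V : ι → Fin K → Fin N → ℂ} {S : ι → Fin K → Fin τ → ℂ}
    {G : ι → Fin K → Matrix (Fin τ) (Fin M) ℂ} {b₀ : Fin N → ℝ} {U₀ : Fin N → Fin M → ℂ}
    {V₀ : Fin K → Fin N → ℂ} {S₀ : Fin K → Fin τ → ℂ} {G₀ : Fin K → Matrix (Fin τ) (Fin M) ℂ}
    (hb : Tendsto b l (𝓝 b₀)) (hU : Tendsto U l (𝓝 U₀)) (hV : Tendsto V l (𝓝 V₀))
    (hS : Tendsto S l (𝓝 S₀)) (hG : ∀ k i j, Tendsto (fun t => G t k i j) l (𝓝 (G₀ k i j))) :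
    Tendsto (fun t => p.f₀ (b t) (U t) (V t) (S t) (G t)) l (𝓝 (p.f₀ b₀ U₀ V₀ S₀ G₀)) := by
  have h1 : Tendsto (fun t => (((b t, U t, V t, S t), fun k i j => G t k i j) :
      JointPoint K M N τ)) l (𝓝 ((b₀, U₀, V₀, S₀), fun k i j => G₀ k i j)) :=
    (hb.prodMk_nhds (hU.prodMk_nhds (hV.prodMk_nhds hS))).prodMk_nhds
      (tendsto_pi_nhds.2 fun k => tendsto_pi_nhds.2 fun i => tendsto_pi_nhds.2 fun j => hG k i j)
  have hc : Continuous (p.f₀joint (τ := τ)) := p.contDiff_f₀joint.continuous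
  have h2 := (hc.tendsto ((b₀, U₀, V₀, S₀), fun k i j => G₀ k i j)).comp h1
  exact h2

/-- The gradient in the surrogate is a partial derivative of the `C²` function `f₀joint`, hence
jointly continuous in the centre and the auxiliary variables. -/
theorem tendsto_surrogate {l : Filter ι} {y : ι → Point K M N τ}
    {G : ι → Fin K → Matrix (Fin τ) (Fin M) ℂ} {w : Point K M N τ}
    {G₀ : Fin K → Matrix (Fin τ) (Fin M) ℂ} (hy : Tendsto y l (𝓝 w))
    (hG : ∀ k i j, Tendsto (fun t => G t k i j) l (𝓝 (G₀ k i j))) (ζ : ℝ) (b : Fin N → ℝ) :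
    Tendsto (fun t => surrogate ζ (fun b => p.f₀ b (y t).2.1 (y t).2.2.1 (y t).2.2.2 (G t))
      (y t).1 b) l
      (𝓝 (surrogate ζ (fun b => p.f₀ b w.2.1 w.2.2.1 w.2.2.2 G₀) w.1 b)) := by
  have h1 : Tendsto (fun t => ((y t, fun k i j => G t k i j) : JointPoint K M N τ)) l
      (𝓝 (w, fun k i j => G₀ k i j)) := hy.prodMk_nhds
      (tendsto_pi_nhds.2 fun k => tendsto_pi_nhds.2 fun i => tendsto_pi_nhds.2 fun j => hG k i j)
  have h2 : Continuous (fderiv ℝ (p.f₀joint (τ := τ))) :=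
    p.contDiff_f₀joint.continuous_fderiv (by norm_num)
  have h4 : Tendsto (fun t => (((b - (y t).1, 0, 0, 0), 0) : JointPoint K M N τ)) l
      (𝓝 ((b - w.1, 0, 0, 0), 0)) :=
    (Continuous.tendsto (f := fun z : Point K M N τ =>
      (((b - z.1, 0, 0, 0), 0) : JointPoint K M N τ)) (by fun_prop) w).comp hy
  have h3 : Continuous fun q : JointPoint K M N τ × JointPoint K M N τ =>
      fderiv ℝ (p.f₀joint (τ := τ)) q.1 q.2 := (h2.comp continuous_fst).clm_apply continuous_snd
  have h5 := (h3.tendsto ((w, fun k i j => G₀ k i j), ((b - w.1, 0, 0, 0), 0))).comp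
    (h1.prodMk_nhds h4)
  have h6 : Tendsto (fun t => ζ * ∑ n, (b n - (y t).1 n) ^ 2) l
      (𝓝 (ζ * ∑ n, (b n - w.1 n) ^ 2)) :=
    (Continuous.tendsto (f := fun z : Point K M N τ => ζ * ∑ n, (b n - z.1 n) ^ 2)
      (by fun_prop) w).comp hy
  have hc : Continuous (p.f₀joint (τ := τ)) := p.contDiff_f₀joint.continuous
  have h7 := (((hc.tendsto (w, fun k i j => G₀ k i j)).comp h1).add h5).sub h6
  have hfd : ∀ (y : Point K M N τ) (G : Fin K → Matrix (Fin τ) (Fin M) ℂ),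
      fderiv ℝ (fun b => p.f₀ b y.2.1 y.2.2.1 y.2.2.2 G) y.1
        = (fderiv ℝ (p.f₀joint (τ := τ)) (y, G)).comp
          ((ContinuousLinearMap.inl ℝ _ _).comp (ContinuousLinearMap.inl ℝ _ _)) := fun y G =>
    (p.hasFDerivAt_bits y.1 y.2.1 y.2.2.1 y.2.2.2 G).fderiv
  simp only [surrogate, hfd]
  exact h7

/-- Nearly optimal auxiliary variables converge to the optimal ones. -/
theorem tendsto_auxiliary {l : Filter ι} {y : ι → Point K M N τ} {w : Point K M N τ}
    {G : ι → Fin K → Matrix (Fin τ) (Fin M) ℂ} (hM : M ≠ 0) (hw : w ∈ p.feasibleSet τ)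
    (hV : ∀ k, w.2.2.1 k ≠ 0) (hy : Tendsto y l (𝓝 w)) (hyf : ∀ t, y t ∈ p.feasibleSet τ)
    (hgap : Tendsto (fun t => p.obj (y t)
      - p.f₀ (y t).1 (y t).2.1 (y t).2.2.1 (y t).2.2.2 (G t)) l (𝓝 0)) (k : Fin K) (i : Fin τ)
    (j : Fin M) : Tendsto (fun t => G t k i j) l (𝓝 (p.Γopt w k i j)) := by
  have hq := p.qpow_pos_of_feasible hw.1 hw.2.1 hM (hV k)
  have hqc : Tendsto (fun t => p.σ ^ 2 * p.qpow (y t).1 (y t).2.1 (y t).2.2.1 k) l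
      (𝓝 (p.σ ^ 2 * p.qpow w.1 w.2.1 w.2.2.1 k)) :=
    (((p.continuous_qpow (τ := τ) (M := M) k).tendsto w).comp hy).const_mul _
  have hc : 0 < p.σ ^ 2 * p.qpow w.1 w.2.1 w.2.2.1 k := mul_pos (pow_pos p.σ_pos 2) hq
  have hΓ : Tendsto (fun t => p.Γopt (y t) k i j) l (𝓝 (p.Γopt w k i j)) :=
    tendsto_pi_nhds.1 (tendsto_pi_nhds.1 ((p.continuousAt_Γopt
      (p.isUnit_B_of_feasible w.2.2.2 hw.1 hw.2.1 hM (hV k))).tendsto.comp hy) i) j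
  have hVe : ∀ᶠ t in l, ∀ k, (y t).2.2.1 k ≠ 0 := by
    rw [eventually_all]
    intro k
    have h1 : Tendsto (fun t => (y t).2.2.1 k) l (𝓝 (w.2.2.1 k)) :=
      (Continuous.tendsto (f := fun z : Point K M N τ => z.2.2.1 k) (by fun_prop) w).comp hy
    exact h1.eventually_ne (hV k)
  have hsq : Tendsto (fun t => ‖(p.Γopt (y t) k - G t k) i j‖ ^ 2) l (𝓝 0) := by
    have h0 := hgap.div hqc hc.ne'
    rw [zero_div] at h0
    refine tendsto_of_tendsto_of_tendsto_of_le_of_le' tendsto_const_nhds h0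
      (Eventually.of_forall fun t => by positivity) ?_
    filter_upwards [hVe, hqc.eventually (lt_mem_nhds hc)] with t ht ht'
    have hgapk : ∀ k, p.σ ^ 2 * p.qpow (y t).1 (y t).2.1 (y t).2.2.1 k
        * ∑ i, ∑ j, ‖(p.Γopt (y t) k - G t k) i j‖ ^ 2
        ≤ p.oterm (y t).1 (y t).2.1 (y t).2.2.1 (y t).2.2.2 k
          - p.fterm (y t).1 (y t).2.1 (y t).2.2.1 (y t).2.2.2 (G t) k := fun k =>
      (p.oterm_gap _ _ _ _ (G t) k (p.bitSet_β' (hyf t).1)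
        (p.qpow_pos_of_feasible (hyf t).1 (hyf t).2.1 hM (ht k))).1
    have hnn : ∀ k, 0 ≤ p.oterm (y t).1 (y t).2.1 (y t).2.2.1 (y t).2.2.2 k
          - p.fterm (y t).1 (y t).2.1 (y t).2.2.1 (y t).2.2.2 (G t) k := fun k => by
      refine le_trans ?_ (hgapk k)
      have := p.qpow_pos_of_feasible (hyf t).1 (hyf t).2.1 hM (ht k)
      positivity
    -- The gap of every user is nonnegative, so the total gap controls that of user `k`.
    have htot : p.oterm (y t).1 (y t).2.1 (y t).2.2.1 (y t).2.2.2 k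
          - p.fterm (y t).1 (y t).2.1 (y t).2.2.1 (y t).2.2.2 (G t) k
        ≤ p.obj (y t) - p.f₀ (y t).1 (y t).2.1 (y t).2.2.1 (y t).2.2.2 (G t) := by
      rw [obj, f_eq_sum_oterm, f₀_eq_sum_fterm, ← Finset.sum_sub_distrib]
      exact Finset.single_le_sum (f := fun k => p.oterm (y t).1 (y t).2.1 (y t).2.2.1 (y t).2.2.2 k
          - p.fterm (y t).1 (y t).2.1 (y t).2.2.1 (y t).2.2.2 (G t) k) (fun k _ => hnn k)
          (Finset.mem_univ k)
    rw [Pi.div_apply, le_div_iff₀' ht']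
    refine le_trans (mul_le_mul_of_nonneg_left ?_ ht'.le) ((hgapk k).trans htot)
    refine le_trans (Finset.single_le_sum (f := fun j => ‖(p.Γopt (y t) k - G t k) i j‖ ^ 2)
      (fun j _ => by positivity) (Finset.mem_univ j)) ?_
    exact Finset.single_le_sum (f := fun i => ∑ j, ‖(p.Γopt (y t) k - G t k) i j‖ ^ 2)
      (fun i _ => by positivity) (Finset.mem_univ i)
  have hn : Tendsto (fun t => (p.Γopt (y t) k - G t k) i j) l (𝓝 0) := by
    rw [tendsto_zero_iff_norm_tendsto_zero]
    have := hsq.sqrt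
    simpa [Real.sqrt_sq (norm_nonneg _)] using this
  simpa using hΓ.sub hn

/-- If digital combiners and auxiliary variables converge jointly up to scale, they can be rescaled
so as to converge along an ultrafilter. -/
theorem exists_renormalization (F : Ultrafilter ι) {V V' : ι → Fin K → Fin N → ℂ}
    {V₀ : Fin K → Fin N → ℂ} {G : ι → Fin K → Matrix (Fin τ) (Fin M) ℂ}
    {G₀ : Fin K → Matrix (Fin τ) (Fin M) ℂ} (hV : Tendsto V F (𝓝 V₀))
    (hG : ∀ k i j, Tendsto (fun t => G t k i j) F (𝓝 (G₀ k i j)))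
    (h : ∀ k n i j, Tendsto (fun t => ‖V t k n - V' t k n‖ * ‖G t k i j‖) F (𝓝 0)) :
    ∃ (e : ι → Fin K → ℂ) (V₁ : Fin K → Fin N → ℂ), (∀ t k, e t k ≠ 0) ∧
      (∀ k, G₀ k = 0 ∨ V₁ k = V₀ k) ∧ Tendsto (fun t k => e t k • V' t k) F (𝓝 V₁) ∧
      ∀ k i j, Tendsto (fun t => ((star (e t k))⁻¹ • G t k) i j) F (𝓝 (G₀ k i j)) := by
  have hVk : ∀ k n, Tendsto (fun t => V t k n) F (𝓝 (V₀ k n)) := fun k n =>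
    tendsto_pi_nhds.1 (tendsto_pi_nhds.1 hV k) n
  have key : ∀ k, ∃ (e : ι → ℂ) (v : Fin N → ℂ), (∀ t, e t ≠ 0) ∧ (G₀ k = 0 ∨ v = V₀ k) ∧
      Tendsto (fun t => e t • V' t k) F (𝓝 v) ∧
      ∀ i j, Tendsto (fun t => ((star (e t))⁻¹ • G t k) i j) F (𝓝 (G₀ k i j)) := by
    intro k
    by_cases h0 : G₀ k = 0
    -- If the limit of `G t k` is zero, the old combiners `V'` may be unbounded. They are normalized
    -- and converge along the ultrafilter to some vector, not necessarily `V₀ k`.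
    · let e : ι → ℂ := fun t => if V' t k = 0 then 1 else ((‖V' t k‖⁻¹ : ℝ) : ℂ)
      have he : ∀ t, e t ≠ 0 := by
        intro t
        by_cases h : V' t k = 0 <;> simp [e, h]
      have hball : ∀ t, e t • V' t k ∈ Metric.closedBall (0 : Fin N → ℂ) 1 := by
        intro t
        rw [mem_closedBall_zero_iff]
        by_cases h : V' t k = 0
        · simp [h]
        · simp only [e, h, if_false, norm_smul, Complex.norm_real, norm_inv, norm_norm]
          exact (inv_mul_cancel₀ (norm_ne_zero_iff.2 h)).le
      obtain ⟨v, -, hv⟩ := (isCompact_closedBall (0 : Fin N → ℂ) 1).ultrafilter_le_nhds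
        (F.map fun t => e t • V' t k) (tendsto_principal.2 (Eventually.of_forall hball))
      refine ⟨e, v, he, Or.inl h0, hv, fun i j => ?_⟩
      have hGz : Tendsto (fun t => ‖G t k i j‖) F (𝓝 0) := by
        have := (hG k i j).norm
        simpa [h0] using this
      -- Normalizing `V'` multiplies the norm of `G` by that of `V'`. The product still tends to
      -- zero because `V` converges, `G` tends to zero, and `‖V - V'‖ ‖G‖` tends to zero.
      have hprod : ∀ n, Tendsto (fun t => ‖V' t k n‖ * ‖G t k i j‖) F (𝓝 0) := by
        intro n
        have h1 := ((hVk k n).norm.mul hGz).add (h k n i j)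
        rw [mul_zero, add_zero] at h1
        refine squeeze_zero (fun t => by positivity) (fun t => ?_) h1
        rw [← add_mul]
        refine mul_le_mul_of_nonneg_right ?_ (norm_nonneg _)
        simpa using norm_sub_le (V t k n) (V t k n - V' t k n)
      have hsum : Tendsto (fun t => ‖G t k i j‖ + ∑ n, ‖V' t k n‖ * ‖G t k i j‖) F (𝓝 0) := by
        simpa using hGz.add (tendsto_finsetSum Finset.univ fun n _ => hprod n)
      have hz : G₀ k i j = 0 := by rw [h0]; rfl
      rw [hz, tendsto_zero_iff_norm_tendsto_zero]
      refine squeeze_zero (fun t => norm_nonneg _) (fun t => ?_) hsum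
      rw [Matrix.smul_apply, norm_smul, norm_inv, norm_star]
      by_cases h : V' t k = 0
      · simp [e, h]
      · simp only [e, h, if_false, Complex.norm_real, norm_inv, norm_norm, inv_inv]
        have h1 : ‖V' t k‖ ≤ ∑ n, ‖V' t k n‖ :=
          (pi_norm_le_iff_of_nonneg (by positivity)).2 fun n =>
            Finset.single_le_sum (f := fun n => ‖V' t k n‖) (fun n _ => norm_nonneg _)
              (Finset.mem_univ n)
        rw [← Finset.sum_mul]
        have h2 := mul_le_mul_of_nonneg_right h1 (norm_nonneg (G t k i j))
        have h3 := norm_nonneg (G t k i j)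
        linarith
    -- If some entry of the limit of `G t k` is nonzero, dividing by it shows that `V'` has the same
    -- limit as `V`; no scaling is needed.
    · refine ⟨fun _ => 1, V₀ k, fun _ => one_ne_zero, Or.inr rfl, ?_, ?_⟩
      · obtain ⟨i, j, hij⟩ : ∃ i j, G₀ k i j ≠ 0 := by
          by_contra hcon
          push Not at hcon
          exact h0 (Matrix.ext hcon)
        refine tendsto_pi_nhds.2 fun n => ?_
        have h1 := (h k n i j).div (hG k i j).norm (norm_ne_zero_iff.2 hij)
        rw [zero_div] at h1
        have h2 : Tendsto (fun t => ‖V t k n - V' t k n‖) F (𝓝 0) := by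
          refine h1.congr' ?_
          filter_upwards [(hG k i j).eventually_ne hij] with t ht
          exact mul_div_cancel_right₀ _ (norm_ne_zero_iff.2 ht)
        have h3 := (hVk k n).sub (tendsto_zero_iff_norm_tendsto_zero.2 h2)
        simpa using h3
      · intro i j
        simpa using hG k i j
  choose e v he hv hlim hGlim using key
  exact ⟨fun t k => e k t, v, fun t k => he k t, hv, tendsto_pi_nhds.2 hlim, hGlim⟩

end Limits

end System
end PilotDesign

/-! ### Passage to the limit in one iteration -/

namespace PilotDesign
open Matrix Filter Topology
namespace System

variable {K M N τ : ℕ} (p : System K M N)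

section LimitPoints

variable {ι : Type*}

theorem BlockAscent.obj_le {ζ δ : ℝ} {z z₁ : Point K M N τ}
    {Γ : Fin K → Matrix (Fin τ) (Fin M) ℂ} (h : p.BlockAscent ζ δ z z₁ Γ)
    (hz : z ∈ p.feasibleSet τ) (hz₁ : z₁ ∈ p.feasibleSet τ) :
    p.f₀ z.1 z.2.1 z.2.2.1 z.2.2.2 Γ ≤ p.f₀ z₁.1 z.2.1 z.2.2.1 z.2.2.2 Γ ∧
    p.f₀ z₁.1 z₁.2.1 z.2.2.1 z.2.2.2 Γ ≤ p.f₀ z₁.1 z₁.2.1 z₁.2.2.1 z.2.2.2 Γ ∧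
    p.f₀ z₁.1 z₁.2.1 z₁.2.2.1 z.2.2.2 Γ ≤ p.f₀ z₁.1 z₁.2.1 z₁.2.2.1 z₁.2.2.2 Γ ∧
    p.f₀ z₁.1 z₁.2.1 z₁.2.2.1 z₁.2.2.2 Γ ≤ p.obj z₁ := by
  refine ⟨?_, ?_, h.pilot _ hz.2.2, p.f₀_le_obj _ _ _ hz₁.1 hz₁.2.1⟩
  · have := h.bits z.1 hz.1
    rwa [surrogate_self] at this
  · refine le_trans (le_add_of_nonneg_right (Finset.sum_nonneg fun k _ => ?_)) (h.digital z.2.2.1)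
    have h1 : 0 ≤ p.qpow z₁.1 z₁.2.1 (z₁.2.2.1 - z.2.2.1) k := by
      refine Finset.sum_nonneg fun n _ => ?_
      have h2 := p.bitSet_β' hz₁.1 n
      have h3 : 0 ≤ 1 - p.β (z₁.1 n) := sub_nonneg.2 h2.2
      have h4 := h2.1
      positivity
    positivity

theorem tendsto_sq_zero {l : Filter ι} {f : ι → ℝ} (hf : ∀ t, 0 ≤ f t)
    (h : Tendsto (fun t => f t ^ 2) l (𝓝 0)) : Tendsto f l (𝓝 0) := by
  have := h.sqrt
  simpa [Real.sqrt_sq (hf _)] using this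

/-- The change of the digital combiners vanishes, relative to the auxiliary variables, if the gain
of their update does. -/
theorem tendsto_digital_change {l : Filter ι} {y : ι → Point K M N τ} {w : Point K M N τ}
    {D : ι → Fin K → Fin N → ℂ} {G : ι → Fin K → Matrix (Fin τ) (Fin M) ℂ} (hM : M ≠ 0)
    (hw : w ∈ p.feasibleSet τ) (hy : Tendsto y l (𝓝 w)) (hyf : ∀ t, y t ∈ p.feasibleSet τ)
    (h : Tendsto (fun t => ∑ k, p.σ ^ 2 * p.qpow (y t).1 (y t).2.1 (D t) k
      * ∑ i, ∑ j, ‖G t k i j‖ ^ 2) l (𝓝 0)) (k : Fin K) (n : Fin N) (i : Fin τ) (j : Fin M) :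
    Tendsto (fun t => ‖D t k n‖ * ‖G t k i j‖) l (𝓝 0) := by
  set q : ι → ℝ := fun t => (1 - p.β ((y t).1 n)) * p.β ((y t).1 n) with hq
  have hqc : Tendsto q l (𝓝 ((1 - p.β (w.1 n)) * p.β (w.1 n))) := by
    have hc : Continuous fun x : ℝ => (1 - p.β x) * p.β x :=
      (continuous_const.sub p.β_contDiff.continuous).mul p.β_contDiff.continuous
    have hb : Tendsto (fun t => (y t).1 n) l (𝓝 (w.1 n)) :=
      (Continuous.tendsto (f := fun z : Point K M N τ => z.1 n) (by fun_prop) w).comp hy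
    exact (hc.tendsto _).comp hb
  have hσ := p.σ_pos
  have hq0 : 0 < p.σ ^ 2 * ((1 - p.β (w.1 n)) * p.β (w.1 n)) := by
    have h1 := p.bitSet_β hw.1 n
    have h2 := h1.1
    have h3 : 0 < 1 - p.β (w.1 n) := sub_pos.2 h1.2
    positivity
  have hnn : ∀ t n, 0 ≤ (1 - p.β ((y t).1 n)) * p.β ((y t).1 n) := fun t n => by
    have h1 := p.bitSet_β' (hyf t).1 n
    exact mul_nonneg (sub_nonneg.2 h1.2) h1.1
  have hpow : ∀ t k, 0 ≤ p.qpow (y t).1 (y t).2.1 (D t) k := fun t k =>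
    Finset.sum_nonneg fun n _ => by have := hnn t n; positivity
  refine tendsto_sq_zero (fun t => by positivity) ?_
  have h0 := h.div (hqc.const_mul (p.σ ^ 2)) hq0.ne'
  rw [zero_div] at h0
  refine squeeze_zero' (Eventually.of_forall fun t => by positivity) ?_ h0
  filter_upwards [(hqc.const_mul (p.σ ^ 2)).eventually (lt_mem_nhds hq0)] with t ht
  rw [Pi.div_apply, le_div_iff₀ ht]
  have h1 : q t * ‖D t k n‖ ^ 2 ≤ p.qpow (y t).1 (y t).2.1 (D t) k := by
    have := Finset.single_le_sum (f := fun n => (1 - p.β ((y t).1 n)) * p.β ((y t).1 n)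
      * (∑ m, ‖(y t).2.1 n m‖ ^ 2) * ‖D t k n‖ ^ 2)
      (fun n _ => by have := hnn t n; positivity) (Finset.mem_univ n)
    rw [analogSet_row (hyf t).2.1 hM, mul_one] at this
    exact this
  have h2 : ‖G t k i j‖ ^ 2 ≤ ∑ i, ∑ j, ‖G t k i j‖ ^ 2 :=
    le_trans (Finset.single_le_sum (f := fun j => ‖G t k i j‖ ^ 2)
      (fun j _ => by positivity) (Finset.mem_univ j))
      (Finset.single_le_sum (f := fun i => ∑ j, ‖G t k i j‖ ^ 2)
      (fun i _ => by positivity) (Finset.mem_univ i))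
  have h3 := Finset.single_le_sum (f := fun k => p.σ ^ 2 * p.qpow (y t).1 (y t).2.1 (D t) k
      * ∑ i, ∑ j, ‖G t k i j‖ ^ 2)
      (fun k _ => by have := hpow t k; positivity) (Finset.mem_univ k)
  refine le_trans ?_ h3
  have h4 := mul_le_mul h1 h2 (by positivity) (hpow t k)
  have h5 : 0 ≤ p.σ ^ 2 := sq_nonneg _
  calc (‖D t k n‖ * ‖G t k i j‖) ^ 2 * (p.σ ^ 2 * q t)
      = p.σ ^ 2 * (q t * ‖D t k n‖ ^ 2 * ‖G t k i j‖ ^ 2) := by ring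
    _ ≤ p.σ ^ 2 * (p.qpow (y t).1 (y t).2.1 (D t) k * ∑ i, ∑ j, ‖G t k i j‖ ^ 2) :=
        mul_le_mul_of_nonneg_left h4 h5
    _ = _ := by ring

theorem setEntry_mem {U : Fin N → Fin M → ℂ} (hU : U ∈ analogSet N M) (n : Fin N) (m : Fin M)
    {u : ℂ} (hu : ‖u‖ = 1 / Real.sqrt M) : setEntry U n m u ∈ analogSet N M := by
  intro n' m'
  rw [setEntry_apply]
  split_ifs
  exacts [hu, hU _ _]

theorem tendsto_setEntry {l : Filter ι} {U : ι → Fin N → Fin M → ℂ} {U₀ : Fin N → Fin M → ℂ}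
    {u : ι → ℂ} {u₀ : ℂ} (hU : Tendsto U l (𝓝 U₀)) (hu : Tendsto u l (𝓝 u₀)) (n : Fin N)
    (m : Fin M) : Tendsto (fun t => setEntry (U t) n m (u t)) l (𝓝 (setEntry U₀ n m u₀)) := by
  refine tendsto_pi_nhds.2 fun n' => tendsto_pi_nhds.2 fun m' => ?_
  simp only [setEntry_apply]
  split_ifs
  exacts [hu, tendsto_pi_nhds.1 (tendsto_pi_nhds.1 hU n') m']

theorem tendsto_sweepAt {l : Filter ι} {U U₁ : ι → Fin N → Fin M → ℂ} {U₀ : Fin N → Fin M → ℂ}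
    (hU : Tendsto U l (𝓝 U₀)) (hU₁ : Tendsto U₁ l (𝓝 U₀)) (n : Fin N) (m : Fin M) :
    Tendsto (fun t => sweepAt (U t) (U₁ t) n m) l (𝓝 U₀) := by
  refine tendsto_pi_nhds.2 fun n' => tendsto_pi_nhds.2 fun m' => ?_
  simp only [sweepAt]
  split_ifs
  exacts [tendsto_pi_nhds.1 (tendsto_pi_nhds.1 hU₁ n') m',
    tendsto_pi_nhds.1 (tendsto_pi_nhds.1 hU n') m']

/-- A limit of points `y t` is stationary if each `y t` is the result of an iteration from a point
`x t`, the next update of the bits does not gain in the limit, and the total gain vanishes. -/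
theorem isStationary_of_tendsto {ζ δ L : ℝ} (hM : M ≠ 0) (F : Ultrafilter ι)
    {x y : ι → Point K M N τ} {w : Point K M N τ} {G : ι → Fin K → Matrix (Fin τ) (Fin M) ℂ}
    {u : ι → ℝ} (hV : ∀ k, w.2.2.1 k ≠ 0) (hy : Tendsto y F (𝓝 w))
    (hxf : ∀ t, x t ∈ p.feasibleSet τ) (hyf : ∀ t, y t ∈ p.feasibleSet τ)
    (hasc : ∀ᶠ t in F, p.BlockAscent ζ δ (x t) (y t) (G t))
    (hxL : Tendsto (fun t => p.f₀ (x t).1 (x t).2.1 (x t).2.2.1 (x t).2.2.2 (G t)) F (𝓝 L))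
    (hyL : Tendsto (fun t => p.obj (y t)) F (𝓝 L))
    (hbits : ∀ᶠ t in F, ∀ b ∈ p.bitSet, surrogate ζ (fun b => p.f₀ b (y t).2.1 (y t).2.2.1
      (y t).2.2.2 (p.Γopt (y t))) (y t).1 b ≤ u t) (huL : Tendsto u F (𝓝 L))
    (hsweep : 0 < δ ∨ Tendsto (fun t => (x t).2.1) F (𝓝 w.2.1)) : p.IsStationary w := by
  have hw : w ∈ p.feasibleSet τ :=
    p.isClosed_feasibleSet.mem_of_tendsto hy (Eventually.of_forall hyf)
  have hyb : Tendsto (fun t => (y t).1) F (𝓝 w.1) := (continuous_fst.tendsto w).comp hy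
  have hyU : Tendsto (fun t => (y t).2.1) F (𝓝 w.2.1) :=
    (Continuous.tendsto (f := fun z : Point K M N τ => z.2.1) (by fun_prop) w).comp hy
  have hyV : Tendsto (fun t => (y t).2.2.1) F (𝓝 w.2.2.1) :=
    (Continuous.tendsto (f := fun z : Point K M N τ => z.2.2.1) (by fun_prop) w).comp hy
  have hyS : Tendsto (fun t => (y t).2.2.2) F (𝓝 w.2.2.2) :=
    (Continuous.tendsto (f := fun z : Point K M N τ => z.2.2.2) (by fun_prop) w).comp hy
  have hchain := hasc.mono fun t h => BlockAscent.obj_le p h (hxf t) (hyf t)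
  -- Along an iteration the values of `f₀` increase from a sequence tending to `L` to one tending to
  -- `L`, so every intermediate value tends to `L` and every block gain tends to zero.
  have hT1 : Tendsto (fun t => p.f₀ (y t).1 (x t).2.1 (x t).2.2.1 (x t).2.2.2 (G t)) F (𝓝 L) := by
    refine tendsto_of_tendsto_of_tendsto_of_le_of_le' hxL hyL ?_ ?_
    · filter_upwards [hchain] with t h using h.1
    · filter_upwards [hchain, hasc] with t h h'
      exact h'.analog_le.trans (h.2.1.trans (h.2.2.1.trans h.2.2.2))
  have hT2 : Tendsto (fun t => p.f₀ (y t).1 (y t).2.1 (x t).2.2.1 (x t).2.2.2 (G t)) F (𝓝 L) := by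
    refine tendsto_of_tendsto_of_tendsto_of_le_of_le' hT1 hyL ?_ ?_
    · filter_upwards [hasc] with t h using h.analog_le
    · filter_upwards [hchain] with t h using h.2.1.trans (h.2.2.1.trans h.2.2.2)
  have hT3 : Tendsto (fun t => p.f₀ (y t).1 (y t).2.1 (y t).2.2.1 (x t).2.2.2 (G t)) F (𝓝 L) := by
    refine tendsto_of_tendsto_of_tendsto_of_le_of_le' hT2 hyL ?_ ?_
    · filter_upwards [hchain] with t h using h.2.1
    · filter_upwards [hchain] with t h using h.2.2.1.trans h.2.2.2
  have hT4 : Tendsto (fun t => p.f₀ (y t).1 (y t).2.1 (y t).2.2.1 (y t).2.2.2 (G t)) F (𝓝 L) := by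
    refine tendsto_of_tendsto_of_tendsto_of_le_of_le' hT3 hyL ?_ ?_
    · filter_upwards [hchain] with t h using h.2.2.1
    · filter_upwards [hchain] with t h using h.2.2.2
  have hG : ∀ k i j, Tendsto (fun t => G t k i j) F (𝓝 (p.Γopt w k i j)) :=
    p.tendsto_auxiliary hM hw hV hy hyf (by simpa using hyL.sub hT4)
  have hL : p.f₀ w.1 w.2.1 w.2.2.1 w.2.2.2 (p.Γopt w) = L :=
    tendsto_nhds_unique (p.tendsto_f₀ hyb hyU hyV hyS hG) hT4
  -- The old pilots need not approach those of `w`. They have some limit `S` along the ultrafilter,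
  -- and `hT3` and `hT4` make both limits optimal.
  obtain ⟨S, hS, hxS⟩ := (p.isCompact_pilotSet (τ := τ)).ultrafilter_le_nhds
    (F.map fun t => (x t).2.2.2) (tendsto_principal.2 (Eventually.of_forall fun t => (hxf t).2.2))
  replace hxS : Tendsto (fun t => (x t).2.2.2) F (𝓝 S) := hxS
  have hdig : Tendsto (fun t => ∑ k, p.σ ^ 2 * p.qpow (y t).1 (y t).2.1
      ((y t).2.2.1 - (x t).2.2.1) k * ∑ i, ∑ j, ‖G t k i j‖ ^ 2) F (𝓝 0) := by
    have h0 := hT3.sub hT2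
    rw [sub_self] at h0
    refine squeeze_zero' ?_ ?_ h0
    · refine Eventually.of_forall fun t => Finset.sum_nonneg fun k _ => ?_
      have h1 : 0 ≤ p.qpow (y t).1 (y t).2.1 ((y t).2.2.1 - (x t).2.2.1) k := by
        refine Finset.sum_nonneg fun n _ => ?_
        have h2 := p.bitSet_β' (hyf t).1 n
        have h3 : 0 ≤ 1 - p.β ((y t).1 n) := sub_nonneg.2 h2.2
        have h4 := h2.1
        positivity
      positivity
    · filter_upwards [hasc] with t h
      have := h.digital (x t).2.2.1
      linarith
  have hchange := p.tendsto_digital_change hM hw hy hyf hdig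
  obtain ⟨e, V₁, he, hV₁, heV, heG⟩ := exists_renormalization F hyV hG hchange
  have hcongr : ∀ b U S, p.f₀ b U V₁ S (p.Γopt w) = p.f₀ b U w.2.2.1 S (p.Γopt w) :=
    fun b U S => p.f₀_congr b U S hV₁
  have hscale : ∀ t b U S, p.f₀ b U (fun k => e t k • (x t).2.2.1 k) S
      (fun k => (star (e t k))⁻¹ • G t k) = p.f₀ b U (x t).2.2.1 S (G t) := fun t b U S =>
    p.f₀_smul b U _ S _ (he t)
  -- The conditions on `U` involve the old combiners. Rescaled by `e` these converge to `V₁`, which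
  -- may be replaced by the combiners of `w`, since they differ only where the auxiliary matrix is
  -- zero.
  have hlimU : ∀ {U : ι → Fin N → Fin M → ℂ} {U₀ : Fin N → Fin M → ℂ}, Tendsto U F (𝓝 U₀) →
      Tendsto (fun t => p.f₀ (y t).1 (U t) (x t).2.2.1 (x t).2.2.2 (G t)) F
        (𝓝 (p.f₀ w.1 U₀ w.2.2.1 S (p.Γopt w))) := by
    intro U U₀ hU
    rw [← hcongr]
    simp only [← hscale]
    exact p.tendsto_f₀ hyb hU heV hxS heG
  refine p.isStationary_of_blocks (S := S) (ζ := ζ) hM hw hV ?_ ?_ ?_ ?_ hS ?_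
  -- Bit optimality is read off the update that starts at `y t`, where all variables converge to
  -- those of `w`. Hence the change of `b`, or of an exactly maximized `U`, need not be controlled.
  · intro b hb
    rw [hL]
    have hΓ : ∀ k i j, Tendsto (fun t => p.Γopt (y t) k i j) F (𝓝 (p.Γopt w k i j)) :=
      fun k i j => tendsto_pi_nhds.1 (tendsto_pi_nhds.1 ((p.continuousAt_Γopt
        (p.isUnit_B_of_feasible w.2.2.2 hw.1 hw.2.1 hM (hV k))).tendsto.comp hy) i) j
    exact le_of_tendsto_of_tendsto (p.tendsto_surrogate hy hΓ ζ b) huL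
      (hbits.mono fun t h => h b hb)
  · intro n m v hv
    -- Along an ultrafilter one of the two kinds of `U`-update occurs eventually.
    rcases Ultrafilter.eventually_or.1 (hasc.mono fun t h => h.analog) with h | h
    · exact le_of_tendsto_of_tendsto (hlimU tendsto_const_nhds) (hlimU hyU)
        (h.mono fun t ht => ht _ (setEntry_mem hw.2.1 n m hv))
    · have hxU : Tendsto (fun t => (x t).2.1) F (𝓝 w.2.1) := by
        refine hsweep.elim (fun hδ => ?_) id
        refine tendsto_pi_nhds.2 fun n => tendsto_pi_nhds.2 fun m => ?_
        have hc : 0 < Real.sqrt M * δ :=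
          mul_pos (Real.sqrt_pos.2 (by exact_mod_cast Nat.pos_of_ne_zero hM)) hδ
        have h0 := (hT2.sub hT1).div_const (Real.sqrt M * δ)
        rw [sub_self, zero_div] at h0
        have h1 : Tendsto (fun t => ‖(y t).2.1 n m - (x t).2.1 n m‖) F (𝓝 0) := by
          refine tendsto_sq_zero (fun t => norm_nonneg _) ?_
          refine squeeze_zero' (Eventually.of_forall fun t => by positivity) ?_ h0
          filter_upwards [h] with t ht
          rw [le_div_iff₀' hc]
          exact ht.2 n m
        have h2 := (tendsto_pi_nhds.1 (tendsto_pi_nhds.1 hyU n) m).sub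
          (tendsto_zero_iff_norm_tendsto_zero.2 h1)
        simpa using h2
      have hs := tendsto_sweepAt hxU hyU n m
      have h1 := le_of_tendsto_of_tendsto
        (hlimU (tendsto_setEntry hs (tendsto_const_nhds (x := v)) n m))
        (hlimU (tendsto_setEntry hs (tendsto_pi_nhds.1 (tendsto_pi_nhds.1 hyU n) m) n m))
        (h.mono fun t ht => ht.1 n m v hv)
      rwa [setEntry_self] at h1
  · intro V
    refine le_of_tendsto_of_tendsto (p.tendsto_f₀ hyb hyU (tendsto_const_nhds (x := V)) hxS hG)
      (p.tendsto_f₀ hyb hyU hyV hxS hG) ?_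
    filter_upwards [hasc] with t h
    refine le_trans (le_add_of_nonneg_right (Finset.sum_nonneg fun k _ => ?_)) (h.digital V)
    have h1 : 0 ≤ p.qpow (y t).1 (y t).2.1 ((y t).2.2.1 - V) k := by
      refine Finset.sum_nonneg fun n _ => ?_
      have h2 := p.bitSet_β' (hyf t).1 n
      have h3 : 0 ≤ 1 - p.β ((y t).1 n) := sub_nonneg.2 h2.2
      have h4 := h2.1
      positivity
    positivity
  · intro T hT
    exact le_of_tendsto_of_tendsto (p.tendsto_f₀ hyb hyU hyV (tendsto_const_nhds (x := T)) hG)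
      (p.tendsto_f₀ hyb hyU hyV hyS hG) (hasc.mono fun t h => h.pilot T hT)
  · rw [hL]
    exact tendsto_nhds_unique (p.tendsto_f₀ hyb hyU hyV hxS hG) hT3

end LimitPoints

end System
end PilotDesign

/-! ### Runs of the algorithm and the theorem -/

namespace PilotDesign
open Matrix Filter Topology
namespace System
variable {K M N τ : ℕ} (p : System K M N)

section Runs

theorem IsRun.mem_feasibleSet {ζ δ : ℝ} {z : ℕ → Point K M N τ} (h : p.IsRun ζ δ z) (t : ℕ) :
    z t ∈ p.feasibleSet τ := by
  cases t with
  | zero => exact h.1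
  | succ t => exact Iteration.feasible p (h.2 t)

/-- The surrogates with constant `ζ` minorize the transformed objective. -/
def Minorizes (ζ : ℝ) (τ : ℕ) : Prop :=
  ∀ z ∈ p.feasibleSet τ, ∀ b ∈ p.bitSet, ∀ b' ∈ p.bitSet,
    surrogate ζ (fun b => p.f₀ b z.2.1 z.2.2.1 z.2.2.2 (p.Γopt z)) b' b
      ≤ p.f₀ b z.2.1 z.2.2.1 z.2.2.2 (p.Γopt z)

variable {ζ δ : ℝ} {z : ℕ → Point K M N τ}

theorem IsRun.blockAscent (h : p.IsRun ζ δ z) (hδ : 0 ≤ δ) (hζ : p.Minorizes ζ τ) (t : ℕ) :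
    p.BlockAscent ζ δ (z t) (z (t + 1)) (p.Γopt (z t)) :=
  Iteration.blockAscent p hδ (h.mem_feasibleSet p t) (h.2 t) (hζ _ (h.mem_feasibleSet p t))

/-- The value of the transformed objective after the bit update lies between two consecutive values
of the objective. -/
theorem IsRun.f₀_bits_le (h : p.IsRun ζ δ z) (hδ : 0 ≤ δ) (hζ : p.Minorizes ζ τ) (t : ℕ) :
    p.obj (z t) ≤ p.f₀ (z (t + 1)).1 (z t).2.1 (z t).2.2.1 (z t).2.2.2 (p.Γopt (z t)) ∧
      p.f₀ (z (t + 1)).1 (z t).2.1 (z t).2.2.1 (z t).2.2.2 (p.Γopt (z t)) ≤ p.obj (z (t + 1)) := by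
  have hA := h.blockAscent p hδ hζ t
  obtain ⟨h1, h2, h3, h4⟩ := BlockAscent.obj_le p hA (h.mem_feasibleSet p t)
    (h.mem_feasibleSet p (t + 1))
  rw [p.obj_eq_f₀ (h.mem_feasibleSet p t)] at h1
  exact ⟨h1, (hA.analog_le.trans h2).trans (h3.trans h4)⟩

theorem IsRun.monotone_obj (h : p.IsRun ζ δ z) (hδ : 0 ≤ δ) (hζ : p.Minorizes ζ τ) :
    Monotone fun t => p.obj (z t) :=
  monotone_nat_of_le_succ fun t => (h.f₀_bits_le p hδ hζ t).1.trans (h.f₀_bits_le p hδ hζ t).2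

theorem IsRun.tendsto_obj (h : p.IsRun ζ δ z) (hδ : 0 ≤ δ) (hζ : p.Minorizes ζ τ) :
    ∃ L, Tendsto (fun t => p.obj (z t)) atTop (𝓝 L) := by
  obtain ⟨C, hC⟩ := p.exists_obj_le τ
  exact ⟨_, tendsto_atTop_ciSup (h.monotone_obj p hδ hζ)
    ⟨C, Set.forall_mem_range.2 fun t => hC _ (h.mem_feasibleSet p t)⟩⟩

theorem obj_eq_zero (hM : M = 0) (w : Point K M N τ) : p.obj w = 0 := by
  rw [obj, f_eq_sum_oterm]
  exact Finset.sum_eq_zero fun k _ => p.oterm_eq_zero _ _ _ _ k (Or.inr hM)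

theorem isStationary_of_eq_zero (hM : M = 0) {w : Point K M N τ} (hw : w ∈ p.feasibleSet τ) :
    p.IsStationary w := by
  refine ⟨hw, 0, ?_, fun d _ => le_rfl⟩
  rw [show p.obj = fun _ : Point K M N τ => (0 : ℝ) from funext (p.obj_eq_zero hM)]
  exact hasFDerivAt_const _ _

/-- A limit, along an ultrafilter, of rescaled iterates is stationary. -/
theorem IsRun.isStationary_of_tendsto (h : p.IsRun ζ δ z) (hδ : 0 ≤ δ) (hζ : p.Minorizes ζ τ)
    (F : Ultrafilter ℕ) (hF : (F : Filter ℕ) ≤ atTop) {c : ℕ → Fin K → ℂ} {w : Point K M N τ}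
    (hV : ∀ k, w.2.2.1 k ≠ 0) (hw : Tendsto (fun t => rescale (c t) (z t)) F (𝓝 w))
    (hsweep : 0 < δ ∨ Tendsto (fun t => (z (t - 1)).2.1) F (𝓝 w.2.1)) : p.IsStationary w := by
  have hfeas : ∀ (c : Fin K → ℂ) t, rescale c (z t) ∈ p.feasibleSet τ :=
    fun _ t => h.mem_feasibleSet p t
  rcases eq_or_ne M 0 with hM | hM
  · exact p.isStationary_of_eq_zero hM
      (p.isClosed_feasibleSet.mem_of_tendsto hw (Eventually.of_forall fun t => hfeas _ t))
  obtain ⟨L, hL⟩ := h.tendsto_obj p hδ hζ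
  -- Vanishing scalars are allowed in the statement but are eventually excluded, because the limit
  -- has nonzero combiners.
  have hc : ∀ᶠ t in F, ∀ k, c t k ≠ 0 := by
    refine eventually_all.2 fun k => ?_
    have hk : Tendsto (fun t => c t k • (z t).2.2.1 k) F (𝓝 (w.2.2.1 k)) :=
      tendsto_pi_nhds.1
        (((continuous_fst.comp (continuous_snd.comp continuous_snd)).tendsto w).comp hw) k
    filter_upwards [hk.eventually_ne (hV k)] with t ht h0
    exact ht (by rw [h0, zero_smul])
  have h1 : ∀ᶠ t in F, 1 ≤ t := hF (eventually_ge_atTop 1)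
  refine p.isStationary_of_tendsto (ζ := ζ) (δ := δ) (L := L) hM F
    -- Both ends of the iteration carry the same scalars `c t`, as scale invariance requires; the
    -- old combiners may thus be unbounded. The spurious case `t = 0` of `t - 1` is excluded by
    -- `h1`.
    (x := fun t => rescale (c t) (z (t - 1))) (y := fun t => rescale (c t) (z t))
    (G := fun t k => (star (c t k))⁻¹ • p.Γopt (z (t - 1)) k) (u := fun t => p.obj (z (t + 1)))
    hV hw (fun t => hfeas _ _) (fun t => hfeas _ _) ?_ ?_ ?_ ?_ ?_ hsweep
  · filter_upwards [hc, h1] with t ht h1t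
    have h2 := h.blockAscent p hδ hζ (t - 1)
    rw [Nat.sub_add_cancel h1t] at h2
    exact BlockAscent.rescale p h2 ht
  · refine (((hL.comp (tendsto_sub_atTop_nat 1)).mono_left hF).congr' ?_)
    filter_upwards [hc] with t ht
    rw [Function.comp_apply, ← p.obj_eq_f₀ (h.mem_feasibleSet p (t - 1))]
    exact (p.f₀_smul _ _ _ _ _ ht).symm
  · refine (hL.mono_left hF).congr' ?_
    filter_upwards [hc] with t ht
    exact (p.obj_rescale ht (h.mem_feasibleSet p t)).symm
  · filter_upwards [hc] with t ht b hb
    have h2 := (BlockAscent.rescale p (h.blockAscent p hδ hζ t) ht).bits b hb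
    rw [← p.Γopt_rescale_eq ht] at h2
    refine h2.trans (le_of_eq_of_le ?_ (h.f₀_bits_le p hδ hζ t).2)
    rw [p.Γopt_rescale_eq ht]
    exact p.f₀_smul _ _ _ _ _ ht
  · exact (hL.comp (tendsto_add_atTop_nat 1)).mono_left hF

/-- Normalizing the digital combiners confines the iterates to a compact set. -/
theorem exists_mapClusterPt_rescale (hz : ∀ t, z t ∈ p.feasibleSet τ)
    (hV : ∀ t k, (z t).2.2.1 k ≠ 0) : ∃ (c : ℕ → Fin K → ℂ) (w : Point K M N τ),
      (∀ k, w.2.2.1 k ≠ 0) ∧ MapClusterPt w atTop (fun t => rescale (c t) (z t)) := by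
  have hcpt : IsCompact (p.bitSet ×ˢ analogSet N M ×ˢ
      (Set.univ.pi fun _ : Fin K => Metric.sphere (0 : Fin N → ℂ) 1) ×ˢ p.pilotSet τ) :=
    p.isCompact_bitSet.prod (isCompact_analogSet.prod
      ((isCompact_univ_pi fun _ => isCompact_sphere _ _).prod p.isCompact_pilotSet))
  obtain ⟨w, hw, hcl⟩ := hcpt.exists_mapClusterPt_of_frequently (l := atTop)
    (f := fun t => rescale (fun k => ((‖(z t).2.2.1 k‖⁻¹ : ℝ) : ℂ)) (z t))
    (Frequently.of_forall fun t => ⟨(hz t).1, (hz t).2.1, fun k _ => by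
      have h0 : ‖(z t).2.2.1 k‖ ≠ 0 := norm_ne_zero_iff.2 (hV t k)
      simp [rescale, norm_smul, h0], (hz t).2.2⟩)
  refine ⟨_, w, fun k hk => ?_, hcl⟩
  have h1 := hw.2.2.1 k (Set.mem_univ k)
  rw [hk] at h1
  simp at h1

end Runs

end System

end PilotDesign

theorem theorem1 {K M N τ : ℕ} (p : PilotDesign.System K M N) :
    ∃ ζ₀ : ℝ, 0 < ζ₀ ∧ ∀ ζ : ℝ, ζ₀ ≤ ζ → ∀ δ : ℝ, 0 ≤ δ →
      ∀ z : ℕ → PilotDesign.Point K M N τ, p.IsRun ζ δ z →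
        -- feasible iterates, monotone and convergent objective values, finite termination
        (∀ t, z t ∈ p.feasibleSet τ) ∧
        Monotone (fun t => p.obj (z t)) ∧
        (∃ L : ℝ, Filter.Tendsto (fun t => p.obj (z t)) Filter.atTop (nhds L)) ∧
        (∀ ε : ℝ, 0 < ε → ∃ t, p.obj (z (t + 1)) - p.obj (z t) < ε) ∧
        -- a limit of the iterates (up to scaling of the digital combiners) is stationary
        (∀ (c : ℕ → Fin K → ℂ) (w : PilotDesign.Point K M N τ), (∀ k, w.2.2.1 k ≠ 0) →
          Filter.Tendsto (fun t => PilotDesign.rescale (c t) (z t)) Filter.atTop (nhds w) →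
          p.IsStationary w) ∧
        -- so is every limit point, if the sweeps are nondegenerate
        (0 < δ → ∀ (c : ℕ → Fin K → ℂ) (w : PilotDesign.Point K M N τ), (∀ k, w.2.2.1 k ≠ 0) →
          MapClusterPt w Filter.atTop (fun t => PilotDesign.rescale (c t) (z t)) →
          p.IsStationary w) ∧
        -- and there are limit points, up to scaling of the digital combiners
        ((∀ t k, (z t).2.2.1 k ≠ 0) → ∃ (c : ℕ → Fin K → ℂ) (w : PilotDesign.Point K M N τ),
          (∀ k, w.2.2.1 k ≠ 0) ∧
          MapClusterPt w Filter.atTop (fun t => PilotDesign.rescale (c t) (z t))) := by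
  obtain ⟨ζ₁, hζ₁, hmin⟩ := p.exists_surrogate_le τ
  -- The Taylor constant may be zero; adding one only makes `ζ₀` positive.
  refine ⟨ζ₁ + 1, by linarith, fun ζ hζ δ hδ z hz => ?_⟩
  have hm : p.Minorizes ζ τ := fun z hz b hb b' hb' =>
    (PilotDesign.System.surrogate_anti (by linarith) _ b' b).trans (hmin z hz b hb b' hb')
  obtain ⟨L, hL⟩ := hz.tendsto_obj p hδ hm
  refine ⟨hz.mem_feasibleSet p, hz.monotone_obj p hδ hm, ⟨L, hL⟩, fun ε hε => ?_,
    fun c w hV hw => ?_, fun hδ' c w hV hw => ?_,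
    p.exists_mapClusterPt_rescale (hz.mem_feasibleSet p)⟩
  · have h0 := (hL.comp (Filter.tendsto_add_atTop_nat 1)).sub hL
    rw [sub_self] at h0
    exact (h0.eventually_lt_const hε).exists
  · have hU : Filter.Tendsto (fun t => (z t).2.1) Filter.atTop (nhds w.2.1) :=
      Filter.Tendsto.comp (f := fun t => PilotDesign.rescale (c t) (z t)) (g := fun w => w.2.1)
        ((continuous_fst.comp continuous_snd).tendsto w) hw
    -- For a convergent sequence any free ultrafilter serves, and the shifted combiners `U` have the
    -- same limit, so no lower bound on the sweep coefficients is needed.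
    exact hz.isStationary_of_tendsto p hδ hm (Filter.hyperfilter ℕ) Nat.hyperfilter_le_atTop
      hV (hw.mono_left Nat.hyperfilter_le_atTop)
      (Or.inr ((hU.comp (Filter.tendsto_sub_atTop_nat 1)).mono_left
        Nat.hyperfilter_le_atTop))
  · obtain ⟨F, hF, hw⟩ := mapClusterPt_iff_ultrafilter.1 hw
    exact hz.isStationary_of_tendsto p hδ hm F hF hV hw (Or.inl hδ')
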